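/- **Setting.** Let $p^\star$ be a probability measure on $\mathbb{R}^d$ and let $V_1,\dots,V_M\subseteq\mathbb{R}^d$ be linear subspaces with $\dim V_i=k_i\le k$ such that $\mathrm{supp}(p^\star)\subseteq\bigcup_i V_i$, $p^\star(V_i\cap V_j)=0$ for $i\ne j$, and $p^\star(V_i)\ge \frac1{c_pM}$ for all $i$, where $c_p>0$. Let $A_i\in\mathbb{R}^{d\times k_i}$ have orthonormal columns spanning $V_i$. If $Z_i$ has the law $p^\star$ conditioned on $V_i$, assume that $A_i^\top Z_i$ is $\sigma_i$-subgaussian: $\sigma_i>0$ and $\mathbb{E}\exp\big((\theta^\top A_i^\top Z_i/\sigma_i)^2\big)\le 2$ for all unit vectors $\theta\in\mathbb{R}^{k_i}$. Put $\sigma=\max_i\sigma_i$. For $t>0$ let $p_t=p^\star\ast\mathcal N(0,tI_d)$, with score $s_t^\star=\nabla\log p_t$, and let $\varphi_t(\cdot\,;m)$ be the density of $\mathcal N(0,tI_m)$. **Estimator.** Let $X^{(1)},\dots,X^{(N)}$ be i.i.d. from $p^\star$, $N\ge2$. Exact subspace recovery means that the $A_i$ are known and that a classifier $c:\mathbb{R}^d\to\{1,\dots,M\}$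 is given such that, for $p^\star$-almost every $x$, $c(x)=i\iff x\in V_i$ for all $i$. Let $\mathcal C_i=\{j: X^{(j)}\in V_i\}$ and $$\widehat g_t(i,z)=\frac1{|\mathcal C_i|}\sum_{j\in\mathcal C_i}\varphi_t(z-A_i^\top X^{(j)};k_i)$$ (read as $0$ if $\mathcal C_i=\emptyset$), $$\widehat s^{\,\mathsf{low}}_t(i,z)=\mathsf{clip}_{\sqrt{2\log N/t}}\Big(\tfrac{\nabla\widehat g_t(i,z)}{\widehat g_t(i,z)}\mathbf 1\big\{\widehat g_t(i,z)\ge\tfrac{\log N}{N(2\pi t)^{k_i/2}}\big\}\Big),$$ where $\mathsf{clip}_r(z)=z$ if $\|z\|_2\le r$ and $rz/\|z\|_2$ otherwise. Let $$\widehat s_t(i,x)=-\tfrac1t(x-A_iA_i^\top x)+A_i\,\widehat s^{\,\mathsf{low}}_t(i,A_i^\top x),$$ $$\widehat w_t(i,x)=\frac{\sum_{j}\varphi_t(x-X^{(j)};d)\mathbf 1\{c(X^{(j)})=i\}}{\sum_{j}\varphi_t(x-X^{(j)};d)}\,\mathbf 1\big\{\|x-A_iA_i^\top x\|_2\le R_t(i)\big\},\qquad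 R_t(i)=C_R\sqrt{td\log(Ndt^{k_i/2})},$$ with $R_t(i)=0$ where the logarithm is negative. The score estimator is $\widehat s_t(x)=\sum_{i=1}^M\widehat w_t(i,x)\,\widehat s_t(i,x)$. **Theorem 1.** There is a universal constant $C_R>0$ in the definition of the estimator such that the following holds. For every integer $k\ge 0$ there is an exponent $m$, depending only on $k$, and for all $c_p>0$, $\sigma_0>0$ and $a\in\mathbb{R}$ there is a constant $C>0$, depending only on $k,c_p,\sigma_0,a$, such that in the setting above, for all $d$, $M$, $N\ge2$, all $\sigma\ge\sigma_0$ and all $0<t\le N^a$, under exact subspace recovery, $$\mathbb{E}\big[\|\widehat s_t(X)-s_t^\star(X)\|_2^2\big]\le C\,\frac{dM^3}{N}\Big(\frac1t+\frac{\sigma^{k\vee2}}{t^{(k\vee2)/2+1}}\Big)(\log N)^m,$$ where the expectation is over the samples $X^{(1)},\dots,X^{(N)}$ and an independent $X\sim p_t$. In particular, $C$ and $m$ do not depend on $N$, $d$, $M$ or $t$, and the rate in $t$ depends only on $k$, not on $d$. -/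

import Mathlib

open MeasureTheory ProbabilityTheory
open scoped ENNReal

noncomputable section

namespace UnionScore

/-- Euclidean space `ℝ^n`. -/
abbrev E (n : ℕ) : Type := EuclideanSpace ℝ (Fin n)

/-- `p` is supported on the union of the linear subspaces `V i` of dimension `k i`, gives zero mass
to the intersections of different subspaces, and mass at least `1 / (cp * M)` to each of them. -/
structure IsUnionOfSubspaces {d M : ℕ} (p : Measure (E d)) (V : Fin M → Submodule ℝ (E d))
    (k : Fin M → ℕ) (cp : ℝ) : Prop where
  finrank_eq : ∀ i, Module.finrank ℝ (V i) = k i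
  support_subset : p.support ⊆ ⋃ i, (V i : Set (E d))
  inter_null : ∀ i j, i ≠ j → p ((V i : Set (E d)) ∩ (V j : Set (E d))) = 0
  mass_ge : ∀ i, ENNReal.ofReal (1 / (cp * M)) ≤ p (V i : Set (E d))

/-- `ν` is `s`-subgaussian: `𝔼 exp (⟨X, θ⟩ / s) ^ 2 ≤ 2` for every unit vector `θ`. -/
def IsSubgaussian {n : ℕ} (ν : Measure (E n)) (s : ℝ) : Prop :=
  0 < s ∧ ∀ θ : E n, ‖θ‖ = 1 →
    ∫⁻ x, ENNReal.ofReal (Real.exp ((inner ℝ x θ / s) ^ 2)) ∂ν ≤ 2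

/-- A matrix `A ∈ ℝ^{d × k}` with orthonormal columns is a linear isometry `ℝ^k → ℝ^d`; this is its
transpose. -/
abbrev tr {k d : ℕ} (A : E k →ₗᵢ[ℝ] E d) : E d →L[ℝ] E k :=
  ContinuousLinearMap.adjoint A.toContinuousLinearMap

/-- The orthogonal projection `A Aᵀ x` onto the column space of `A`. -/
def proj {k d : ℕ} (A : E k →ₗᵢ[ℝ] E d) (x : E d) : E d := A (tr A x)

/-- The law of `Aᵀ Z`, where `Z` has the law `p` conditioned on the column space of `A`. -/
def lowLaw {k d : ℕ} (p : Measure (E d)) (A : E k →ₗᵢ[ℝ] E d) : Measure (E k) :=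
  (cond p (Set.range A)).map (tr A)

/-- The density of `N(0, t I_n)`. -/
def gaussDensity (n : ℕ) (t : ℝ) (x : E n) : ℝ :=
  (2 * Real.pi * t) ^ (-((n : ℝ) / 2)) * Real.exp (-‖x‖ ^ 2 / (2 * t))

/-- The smoothed distribution `p_t = p ∗ N(0, t I_d)`. -/
def smoothedLaw {d : ℕ} (p : Measure (E d)) (t : ℝ) : Measure (E d) :=
  p ∗ multivariateGaussian (0 : E d) (t • (1 : Matrix (Fin d) (Fin d) ℝ))

/-- The density of `p_t`. -/
def smoothedDensity {d : ℕ} (p : Measure (E d)) (t : ℝ) (x : E d) : ℝ :=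
  ∫ y, gaussDensity d t (x - y) ∂p

/-- The true score `∇ log p_t`. -/
def score {d : ℕ} (p : Measure (E d)) (t : ℝ) (x : E d) : E d :=
  gradient (fun z => Real.log (smoothedDensity p t z)) x

/-- The clipping operator. -/
def clip {n : ℕ} (r : ℝ) (z : E n) : E n :=
  open Classical in if ‖z‖ ≤ r then z else (r / ‖z‖) • z

/-- The hard threshold `1{x ≥ η}`. -/
def threshold (x η : ℝ) : ℝ :=
  open Classical in if η ≤ x then 1 else 0

section Estimator

variable {d M N : ℕ}

/-- The indices of the samples that lie in the subspace `V`. -/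
def sampleIdx (V : Submodule ℝ (E d)) (X : Fin N → E d) : Finset (Fin N) :=
  open Classical in Finset.univ.filter fun j => X j ∈ V

/-- The kernel density estimator of the smoothed low-dimensional distribution on `V = range A`. -/
def lowDensityEst {k : ℕ} (V : Submodule ℝ (E d)) (A : E k →ₗᵢ[ℝ] E d) (t : ℝ) (X : Fin N → E d)
    (z : E k) : ℝ :=
  (1 / ((sampleIdx V X).card : ℝ)) * ∑ j ∈ sampleIdx V X, gaussDensity k t (z - tr A (X j))

/-- The thresholded and clipped low-dimensional score estimator. -/
def lowScoreEst {k : ℕ} (V : Submodule ℝ (E d)) (A : E k →ₗᵢ[ℝ] E d) (t : ℝ) (X : Fin N → E d)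
    (z : E k) : E k :=
  clip (Real.sqrt (2 * Real.log N / t))
    ((threshold (lowDensityEst V A t X z)
        (Real.log N / (N * (2 * Real.pi * t) ^ ((k : ℝ) / 2))) / lowDensityEst V A t X z) •
      gradient (lowDensityEst V A t X) z)

/-- The estimator of the `d`-dimensional score component belonging to `V`. -/
def componentScoreEst {k : ℕ} (V : Submodule ℝ (E d)) (A : E k →ₗᵢ[ℝ] E d) (t : ℝ)
    (X : Fin N → E d) (x : E d) : E d :=
  -((1 / t) • (x - proj A x)) + A (lowScoreEst V A t X (tr A x))

/-- The kernel estimator of `p_t`. -/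
def densityEst (t : ℝ) (X : Fin N → E d) (x : E d) : ℝ :=
  (1 / (N : ℝ)) * ∑ j, gaussDensity d t (x - X j)

/-- The kernel estimator of the part of `p_t` that comes from the `i`-th subspace; `c` is the
classification function. -/
def partialDensityEst (c : E d → Fin M) (t : ℝ) (X : Fin N → E d) (i : Fin M) (x : E d) : ℝ :=
  (1 / (N : ℝ)) * ∑ j, gaussDensity d t (x - X j) * (if c (X j) = i then 1 else 0)

/-- The radius `C_R √(t d log (N d t^{k/2}))` (equal to `0` where the logarithm is negative). -/
def regRadius (CR : ℝ) (d N k : ℕ) (t : ℝ) : ℝ :=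
  CR * Real.sqrt (t * d * Real.log (N * d * t ^ ((k : ℝ) / 2)))

/-- The regularized weight estimator. -/
def weightEst {k : ℕ} (CR : ℝ) (A : E k →ₗᵢ[ℝ] E d) (c : E d → Fin M) (t : ℝ) (X : Fin N → E d)
    (i : Fin M) (x : E d) : ℝ :=
  open Classical in
  if ‖x - proj A x‖ ≤ regRadius CR d N k t then
    partialDensityEst c t X i x / densityEst t X x
  else 0

/-- The score estimator `∑ i, ŵ_t(i, x) ŝ_t(i, x)` built from the samples `X`. -/
def scoreEst (CR : ℝ) (V : Fin M → Submodule ℝ (E d)) {k : Fin M → ℕ}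
    (A : ∀ i, E (k i) →ₗᵢ[ℝ] E d) (c : E d → Fin M) (t : ℝ) (X : Fin N → E d) (x : E d) : E d :=
  ∑ i, weightEst CR (A i) c t X i x • componentScoreEst (V i) (A i) t X x

end Estimator

/-- Exact subspace recovery: the columns of `A i` form an orthonormal basis of `V i`, and the
classifier `c` satisfies `c x = i ↔ x ∈ V i` for `p`-almost every `x`. -/
structure IsExactRecovery {d M : ℕ} (p : Measure (E d)) (V : Fin M → Submodule ℝ (E d))
    {k : Fin M → ℕ} (A : ∀ i, E (k i) →ₗᵢ[ℝ] E d) (c : E d → Fin M) : Prop where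
  range_eq : ∀ i, LinearMap.range (A i).toLinearMap = V i
  classify : ∀ᵐ x ∂p, ∀ i, c x = i ↔ x ∈ V i

end UnionScore

end

/-!
Write `p` as the sum of its restrictions to the subspaces `V i`. For `y ∈ V i` the `d`-dimensional
Gaussian kernel at `x - y` is the product of `normalFactor`, which does not depend on `y`, and of
the `k i`-dimensional kernel in the coordinates along `V i`. Hence the score of the smoothed law is
the mixture of the component scores `-(x - proj x) / t + A i (score of coordLaw i)`, weighted by
the posterior probabilities `weight i` of the subspaces (`IsExactRecovery.score_eq_sum`), and the
estimator replaces weights and low-dimensional scores by empirical versions. The squared error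
splits pointwise into an error of the weights inside the cut-off region, a loss through the cut-off,
and the errors of the low-dimensional scores (`IsExactRecovery.norm_scoreEst_sub_score_sq_le`).
Multiplying the smoothed law by `weight i` gives the smoothed law of the part of `p` on `V i`
(`lintegral_weight_mul`), so that each term becomes an integral over one part
(`IsExactRecovery.risk_le_sum`).

*Weights.* Estimated and true weights are both normalised, so their `ℓ¹` distance is at most twice
the sum over the subspaces of the relative errors of the unnormalised weights, each capped at `1`
(`sum_abs_div_sub_div_sq_le`). In the
relative error the normal factor can be absorbed into the weight, and the second moment of the
capped error is at most `2 * weight i * min 1 (peak / (N * G))`, where `G` is the density of the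
smoothed `coordLaw i` and `peak` is the maximum of the `k i`-dimensional kernel
(`IsExactRecovery.lintegral_relErr_sq_le`). The ambient dimension has disappeared.

*Low-dimensional scores.* By Jensen's inequality for the posterior law,
`‖∇G‖² / G ≤ (2 / t) * G * log (peak / G)` (`posteriorMoment_le_log`). Where `G` is above the
threshold `2 * log N * peak / N` this bounds the score by the clipping radius, and variance bounds
for the estimated density and gradient, which are averages of independent terms, give a squared
error of order `peak / (N * G)` up to logarithms and a factor `1 / t`. Below the threshold the
bound shows that `G` times the squared error is itself of order `peak / N`. In both cases the
expected error times `G` is, up to logarithms and the factor `1 / t`, at most a multiple of `peak / N`, and also of the density of `coordLaw i` smoothed at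
time `2 * t`.

*Truncation.* A function with these two bounds has an integral of order
`(1 / N) * (1 + σ ^ κ / t ^ (κ / 2))` up to logarithms, for every `κ ≥ k`: the first bound is
integrated over a ball whose squared radius is of order `(σ² + t) * log N`, and outside of it the
subgaussian tail of the smoothed law is used (`IsSubSubgaussian.lintegral_le_rate`). This produces
the rate; `κ = max k 2` is taken so that `σ² / t²` is dominated as well.

*Normal component.* The weight error is multiplied by the size of the component estimators, that is,
by `‖x - proj x‖² / t²`. For `d ≤ N` the cut-off bounds it by `d * log N / t`, up to a constant,
because `t ≤ N ^ a` makes the logarithm in the cut-off radius comparable with `log N`. For `d > N`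
it is at most `‖x‖² / t²`; its noise part is of order `d / t`, and its signal part, of order
`σ² / t²`, needs no further factor `1 / N` since `d / N ≥ 1`
(`IsExactRecovery.lintegral_weight_le_of_le_dim`). The distance of a noisy point to its own subspace
is at most the norm of the noise, so the loss through the cut-off is a Gaussian tail
(`IsExactRecovery.lintegral_cutoffErr_le`). The error of the weights has one factor `M` from the
Cauchy-Schwarz inequality and one from the sum over the subspaces; the total is below `M ^ 3`.
-/

namespace UnionScore

/-! ### The Gaussian kernel and the Gaussian measure -/

/-- The maximal value `(2πt)^{-n/2}` of the density of `N(0, t I_n)`. -/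
noncomputable def peak (n : ℕ) (t : ℝ) : ℝ := (2 * Real.pi * t) ^ (-((n : ℝ) / 2))

/-- The noise distribution `N(0, t I_n)`. -/
noncomputable abbrev noise (n : ℕ) (t : ℝ) : Measure (E n) :=
  multivariateGaussian (0 : E n) (t • (1 : Matrix (Fin n) (Fin n) ℝ))

section Kernel

variable {n : ℕ} {t : ℝ}

lemma peak_pos (ht : 0 < t) : 0 < peak n t := by unfold peak; positivity

lemma gaussDensity_eq (n : ℕ) (t : ℝ) (x : E n) :
    gaussDensity n t x = peak n t * Real.exp (-‖x‖ ^ 2 / (2 * t)) := rfl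

lemma gaussDensity_pos (ht : 0 < t) (x : E n) : 0 < gaussDensity n t x := by
  rw [gaussDensity_eq]; have := peak_pos (n := n) ht; positivity

lemma gaussDensity_le_peak (ht : 0 < t) (x : E n) : gaussDensity n t x ≤ peak n t := by
  rw [gaussDensity_eq]
  refine mul_le_of_le_one_right (peak_pos ht).le (Real.exp_le_one_iff.2 ?_)
  rw [neg_div]; simp only [Left.neg_nonpos_iff]; positivity

@[fun_prop]
lemma continuous_gaussDensity : Continuous (gaussDensity n t) := by
  unfold gaussDensity; fun_prop

@[fun_prop]
lemma measurable_gaussDensity : Measurable (gaussDensity n t) :=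
  continuous_gaussDensity.measurable

lemma gaussDensity_nonneg (ht : 0 < t) (x : E n) : 0 ≤ gaussDensity n t x :=
  (gaussDensity_pos ht x).le

lemma integrable_exp_neg_mul_sq_norm {b : ℝ} (hb : 0 < b) :
    Integrable (fun x : E n => Real.exp (-b * ‖x‖ ^ 2)) := by
  have h := (GaussianFourier.integrable_cexp_neg_mul_sq_norm_add (V := E n)
    (b := (b : ℂ)) (by simpa using hb) 0 0).norm
  refine h.congr (Filter.Eventually.of_forall fun x => ?_)
  simp only [Complex.norm_exp]
  congr 1
  norm_cast
  simp

lemma lintegral_exp_neg_mul_sq_norm {b : ℝ} (hb : 0 < b) :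
    ∫⁻ x : E n, ENNReal.ofReal (Real.exp (-b * ‖x‖ ^ 2)) =
      ENNReal.ofReal ((Real.pi / b) ^ ((n : ℝ) / 2)) := by
  rw [← ofReal_integral_eq_lintegral_ofReal (integrable_exp_neg_mul_sq_norm hb)
    (Filter.Eventually.of_forall fun x => (Real.exp_pos _).le),
    GaussianFourier.integral_rexp_neg_mul_sq_norm hb]
  simp

lemma integrable_gaussDensity (ht : 0 < t) : Integrable (gaussDensity n t) := by
  have h := (integrable_exp_neg_mul_sq_norm (n := n) (b := 1 / (2 * t)) (by positivity)).const_mul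
    (peak n t)
  refine h.congr (Filter.Eventually.of_forall fun x => ?_)
  simp only [gaussDensity_eq]
  congr 2; ring

lemma posSemidef_smul_one (ht : 0 < t) :
    (t • (1 : Matrix (Fin n) (Fin n) ℝ)).PosSemidef :=
  Matrix.PosSemidef.one.smul ht.le

lemma charFun_noise (ht : 0 < t) (y : E n) :
    charFun (noise n t) y = Complex.exp (-((t * ‖y‖ ^ 2 / 2 : ℝ) : ℂ)) := by
  rw [charFun_multivariateGaussian (posSemidef_smul_one ht)]
  congr 1
  have : y.ofLp ⬝ᵥ (t • (1 : Matrix (Fin n) (Fin n) ℝ)).mulVec y.ofLp = t * ‖y‖ ^ 2 := by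
    rw [Matrix.smul_mulVec, Matrix.one_mulVec, EuclideanSpace.real_norm_sq_eq]
    simp [dotProduct, Finset.mul_sum]
    exact Finset.sum_congr rfl fun i _ => by ring
  rw [this]
  simp

/-- `N(0, t I_n)` has the density `gaussDensity n t`; both sides have the same characteristic
function. -/
lemma noise_eq_withDensity (ht : 0 < t) :
    noise n t = volume.withDensity (fun x => ENNReal.ofReal (gaussDensity n t x)) := by
  have hfin : IsFiniteMeasure
      ((volume : Measure (E n)).withDensity (fun x => ENNReal.ofReal (gaussDensity n t x))) :=
    isFiniteMeasure_withDensity_ofReal (integrable_gaussDensity ht).2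
  refine Measure.ext_of_charFun (funext fun y => ?_)
  rw [charFun_noise ht, charFun_apply]
  rw [integral_withDensity_eq_integral_toReal_smul (by fun_prop)
    (Filter.Eventually.of_forall fun _ => ENNReal.ofReal_lt_top)]
  have h := GaussianFourier.integral_cexp_neg_mul_sq_norm_add (V := E n)
    (b := ((1 / (2 * t) : ℝ) : ℂ)) (by rw [Complex.ofReal_re]; positivity) Complex.I y
  have h2 : ∀ x : E n, (ENNReal.ofReal (gaussDensity n t x)).toReal •
      Complex.exp ((inner ℝ x y : ℝ) * Complex.I) = (peak n t : ℂ) *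
      Complex.exp (-((1 / (2 * t) : ℝ) : ℂ) * ‖x‖ ^ 2 + Complex.I * (inner ℝ y x : ℝ)) := by
    intro x
    rw [ENNReal.toReal_ofReal (gaussDensity_nonneg ht x), gaussDensity_eq, Complex.real_smul,
      Complex.exp_add, real_inner_comm]
    push_cast
    rw [mul_assoc]
    congr 2
    · congr 1; ring
    · congr 1; ring
  simp only [h2]
  rw [integral_const_mul, h]
  simp only [finrank_euclideanSpace, Fintype.card_fin]
  have h3 : ((Real.pi : ℂ) / ((1 / (2 * t) : ℝ) : ℂ)) ^ ((n : ℂ) / 2) =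
      (((2 * Real.pi * t) ^ ((n : ℝ) / 2) : ℝ) : ℂ) := by
    rw [Complex.ofReal_cpow (by positivity)]
    push_cast
    congr 1
    field_simp
  rw [h3, ← mul_assoc, ← Complex.ofReal_mul, peak, ← Real.rpow_add (by positivity)]
  simp only [neg_add_cancel, Real.rpow_zero, Complex.ofReal_one, one_mul]
  congr 1
  rw [Complex.I_sq]
  push_cast
  have : (t : ℂ) ≠ 0 := by exact_mod_cast ht.ne'
  field_simp
  ring

lemma lintegral_noise (ht : 0 < t) {f : E n → ℝ≥0∞} (hf : Measurable f) :
    ∫⁻ x, f x ∂(noise n t) = ∫⁻ x, ENNReal.ofReal (gaussDensity n t x) * f x := by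
  rw [noise_eq_withDensity ht, lintegral_withDensity_eq_lintegral_mul _ (by fun_prop) hf]
  rfl

/-- The image of `N(0, t I_d)` under the transpose of a matrix with orthonormal columns. -/
lemma map_tr_noise {k d : ℕ} (A : E k →ₗᵢ[ℝ] E d) (ht : 0 < t) :
    (noise d t).map (tr A) = noise k t := by
  refine Measure.ext_of_charFun (funext fun y => ?_)
  have h : charFun ((noise d t).map (tr A)) y = charFun (noise d t) (A y) := by
    rw [charFun_apply, integral_map (by fun_prop) (by fun_prop), charFun_apply]
    simp only [ContinuousLinearMap.adjoint_inner_left]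
    rfl
  rw [h, charFun_noise ht, charFun_noise ht, A.norm_map]

/-- The exponential square moment of the noise at the critical scale `4t`. -/
lemma lintegral_exp_sq_noise_le (ht : 0 < t) {b : ℝ} (hb : b ≤ 1 / (4 * t)) :
    ∫⁻ x, ENNReal.ofReal (Real.exp (b * ‖x‖ ^ 2)) ∂(noise n t) ≤
      ENNReal.ofReal (2 ^ ((n : ℝ) / 2)) := by
  rw [lintegral_noise ht (by fun_prop)]
  have h : ∀ x : E n, ENNReal.ofReal (gaussDensity n t x) *
      ENNReal.ofReal (Real.exp (b * ‖x‖ ^ 2)) ≤ ENNReal.ofReal (peak n t) *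
      ENNReal.ofReal (Real.exp (-(1 / (4 * t)) * ‖x‖ ^ 2)) := by
    intro x
    rw [← ENNReal.ofReal_mul (gaussDensity_nonneg ht x), ← ENNReal.ofReal_mul (peak_pos ht).le]
    refine ENNReal.ofReal_le_ofReal ?_
    rw [gaussDensity_eq, mul_assoc, ← Real.exp_add]
    refine mul_le_mul_of_nonneg_left (Real.exp_le_exp.2 ?_) (peak_pos ht).le
    have h1 : b * ‖x‖ ^ 2 ≤ 1 / (4 * t) * ‖x‖ ^ 2 :=
      mul_le_mul_of_nonneg_right hb (by positivity)
    have h2 : -‖x‖ ^ 2 / (2 * t) = - (2 * (1 / (4 * t) * ‖x‖ ^ 2)) := by field_simp; ring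
    rw [h2]; linarith
  refine (lintegral_mono h).trans ?_
  rw [lintegral_const_mul _ (by fun_prop), lintegral_exp_neg_mul_sq_norm (by positivity),
    ← ENNReal.ofReal_mul (peak_pos ht).le]
  refine ENNReal.ofReal_le_ofReal (le_of_eq ?_)
  have hs : (0 : ℝ) < 2 * Real.pi * t := by positivity
  rw [peak, show Real.pi / (1 / (4 * t)) = 2 * (2 * Real.pi * t) by field_simp; ring]
  generalize 2 * Real.pi * t = s at hs ⊢
  rw [Real.mul_rpow (by norm_num) hs.le, mul_left_comm, ← Real.rpow_add hs]
  simp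

lemma two_rpow_half_le_exp (n : ℕ) : (2 : ℝ) ^ ((n : ℝ) / 2) ≤ Real.exp n := by
  have h2 : (2 : ℝ) ≤ Real.exp 1 := by have := Real.add_one_le_exp 1; linarith
  calc (2 : ℝ) ^ ((n : ℝ) / 2) ≤ 2 ^ (n : ℝ) :=
        Real.rpow_le_rpow_of_exponent_le (by norm_num) (by linarith [Nat.cast_nonneg (α := ℝ) n])
    _ ≤ Real.exp 1 ^ (n : ℝ) := Real.rpow_le_rpow (by norm_num) h2 (Nat.cast_nonneg n)
    _ = Real.exp n := by rw [← Real.exp_mul, one_mul]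

/-- Chernoff bound for the tail of the squared norm of the noise. -/
lemma lintegral_tail_noise (ht : 0 < t) (hn : 1 ≤ n) {L : ℝ} (hL : 1 ≤ L) :
    ∫⁻ x, {x : E n | 16 * t * n * L < ‖x‖ ^ 2}.indicator
      (fun x => ENNReal.ofReal (‖x‖ ^ 2 / t)) x ∂(noise n t) ≤
      ENNReal.ofReal (8 * Real.exp (-L)) := by
  have hn' : (1 : ℝ) ≤ n := by exact_mod_cast hn
  have h : ∀ x : E n, {x : E n | 16 * t * n * L < ‖x‖ ^ 2}.indicator
      (fun x => ENNReal.ofReal (‖x‖ ^ 2 / t)) x ≤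
      ENNReal.ofReal (8 * Real.exp (-(2 * n * L))) *
      ENNReal.ofReal (Real.exp (1 / (4 * t) * ‖x‖ ^ 2)) := by
    intro x
    by_cases hx : 16 * t * n * L < ‖x‖ ^ 2
    · rw [Set.indicator_of_mem (by exact hx), ← ENNReal.ofReal_mul (by positivity), mul_assoc,
        ← Real.exp_add]
      refine ENNReal.ofReal_le_ofReal ?_
      have h1 : 2 * n * L ≤ ‖x‖ ^ 2 / (8 * t) := by
        rw [le_div_iff₀ (by positivity)]; linarith
      have h2 : 1 / (4 * t) * ‖x‖ ^ 2 = ‖x‖ ^ 2 / (8 * t) + ‖x‖ ^ 2 / (8 * t) := by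
        field_simp; ring
      have h3 : ‖x‖ ^ 2 / t = 8 * (‖x‖ ^ 2 / (8 * t)) := by field_simp
      rw [h2, h3]
      refine mul_le_mul_of_nonneg_left ?_ (by norm_num)
      calc ‖x‖ ^ 2 / (8 * t) ≤ Real.exp (‖x‖ ^ 2 / (8 * t)) := by
            linarith [Real.add_one_le_exp (‖x‖ ^ 2 / (8 * t))]
        _ ≤ _ := Real.exp_le_exp.2 (by linarith)
    · rw [Set.indicator_of_notMem (by exact hx)]; exact zero_le
  refine (lintegral_mono h).trans ?_
  rw [lintegral_const_mul _ (by fun_prop)]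
  refine (mul_le_mul_right (lintegral_exp_sq_noise_le ht le_rfl) _).trans ?_
  rw [← ENNReal.ofReal_mul (by positivity)]
  refine ENNReal.ofReal_le_ofReal ?_
  rw [mul_assoc]
  refine mul_le_mul_of_nonneg_left ?_ (by norm_num)
  refine (mul_le_mul_of_nonneg_left (two_rpow_half_le_exp n) (Real.exp_pos _).le).trans ?_
  rw [← Real.exp_add]
  refine Real.exp_le_exp.2 ?_
  nlinarith

lemma lintegral_sq_noise_le (ht : 0 < t) (hn : 1 ≤ n) :
    ∫⁻ x, ENNReal.ofReal (‖x‖ ^ 2 / t) ∂(noise n t) ≤ ENNReal.ofReal (24 * n) := by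
  have hn' : (1 : ℝ) ≤ n := by exact_mod_cast hn
  have h : ∀ x : E n, ENNReal.ofReal (‖x‖ ^ 2 / t) ≤ ENNReal.ofReal (16 * n) +
      {x : E n | 16 * t * n * 1 < ‖x‖ ^ 2}.indicator
      (fun x => ENNReal.ofReal (‖x‖ ^ 2 / t)) x := by
    intro x
    by_cases hx : 16 * t * n * 1 < ‖x‖ ^ 2
    · rw [Set.indicator_of_mem (by exact hx)]; exact le_add_self
    · rw [Set.indicator_of_notMem (by exact hx), add_zero]
      refine ENNReal.ofReal_le_ofReal ?_
      rw [div_le_iff₀ ht]; push Not at hx; linarith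
  refine (lintegral_mono h).trans ?_
  rw [lintegral_add_left measurable_const]
  refine (add_le_add_right (lintegral_tail_noise ht hn le_rfl) _).trans ?_
  rw [lintegral_const, measure_univ, mul_one, ← ENNReal.ofReal_add (by positivity) (by positivity)]
  refine ENNReal.ofReal_le_ofReal ?_
  have : Real.exp (-1) ≤ 1 := Real.exp_le_one_iff.2 (by norm_num)
  linarith

/-- A version of the tail bound that is also meaningful for small or negative `L`. -/
lemma lintegral_tail_noise' (ht : 0 < t) (hn : 1 ≤ n) (L : ℝ) :
    ∫⁻ x, {x : E n | 16 * (t * n * max L 0) < ‖x‖ ^ 2}.indicator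
      (fun x => ENNReal.ofReal (1 + ‖x‖ ^ 2 / t)) x ∂(noise n t) ≤
      ENNReal.ofReal (75 * n * Real.exp (-L)) := by
  have hn' : (1 : ℝ) ≤ n := by exact_mod_cast hn
  rcases le_total 1 L with hL | hL
  · have h : ∀ x : E n, {x : E n | 16 * (t * n * max L 0) < ‖x‖ ^ 2}.indicator
        (fun x => ENNReal.ofReal (1 + ‖x‖ ^ 2 / t)) x ≤ ENNReal.ofReal 2 *
        {x : E n | 16 * t * n * L < ‖x‖ ^ 2}.indicator
        (fun x => ENNReal.ofReal (‖x‖ ^ 2 / t)) x := by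
      intro x
      have hm : max L 0 = L := max_eq_left (by linarith)
      rw [hm, show 16 * (t * n * L) = 16 * t * n * L by ring]
      by_cases hx : 16 * t * n * L < ‖x‖ ^ 2
      · rw [Set.indicator_of_mem (by exact hx), Set.indicator_of_mem (by exact hx),
          ← ENNReal.ofReal_mul (by norm_num)]
        refine ENNReal.ofReal_le_ofReal ?_
        have : 1 ≤ ‖x‖ ^ 2 / t := by
          rw [le_div_iff₀ ht]
          have : 1 ≤ 16 * n * L := by nlinarith
          nlinarith
        linarith
      · rw [Set.indicator_of_notMem (by exact hx)]; exact zero_le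
    refine (lintegral_mono h).trans ?_
    rw [lintegral_const_mul' _ _ (by simp)]
    refine (mul_le_mul_right (lintegral_tail_noise ht hn hL) _).trans ?_
    rw [← ENNReal.ofReal_mul (by norm_num)]
    refine ENNReal.ofReal_le_ofReal ?_
    nlinarith [Real.exp_pos (-L)]
  · have h : ∀ x : E n, {x : E n | 16 * (t * n * max L 0) < ‖x‖ ^ 2}.indicator
        (fun x => ENNReal.ofReal (1 + ‖x‖ ^ 2 / t)) x ≤ 1 + ENNReal.ofReal (‖x‖ ^ 2 / t) := by
      intro x
      refine (Set.indicator_le_self _ _ x).trans ?_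
      rw [ENNReal.ofReal_add (by norm_num) (by positivity), ENNReal.ofReal_one]
    refine (lintegral_mono h).trans ?_
    rw [lintegral_add_left measurable_const, lintegral_const, measure_univ, mul_one]
    refine (add_le_add_right (lintegral_sq_noise_le ht hn) _).trans ?_
    rw [← ENNReal.ofReal_one, ← ENNReal.ofReal_add (by norm_num) (by positivity)]
    refine ENNReal.ofReal_le_ofReal ?_
    have h3 : Real.exp (-1) ≤ Real.exp (-L) := Real.exp_le_exp.2 (by linarith)
    have h4 : (1 : ℝ) / 3 ≤ Real.exp (-1) := by
      rw [Real.exp_neg, one_div]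
      exact inv_anti₀ (Real.exp_pos 1) (by linarith [Real.exp_one_lt_d9])
    nlinarith

end Kernel

/-! ### Smoothing of finite measures -/

section Smoothing

variable {n : ℕ} {t : ℝ}

/-- The gradient of the Gaussian density. -/
noncomputable def kernelGrad (n : ℕ) (t : ℝ) (u : E n) : E n := -((gaussDensity n t u / t) • u)

/-- The gradient of the smoothed density `smoothedDensity q t`, as an integral. -/
noncomputable def smoothedGrad (q : Measure (E n)) (t : ℝ) (z : E n) : E n :=
  ∫ y, kernelGrad n t (z - y) ∂q

/-- The (unnormalised) second moment of `(Y - z) / t` under the posterior law of `Y ∼ q` given the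
noisy observation `z`. -/
noncomputable def posteriorMoment (q : Measure (E n)) (t : ℝ) (z : E n) : ℝ :=
  ∫ y, gaussDensity n t (z - y) * (‖z - y‖ ^ 2 / t ^ 2) ∂q

@[fun_prop]
lemma continuous_kernelGrad : Continuous (kernelGrad n t) := by
  unfold kernelGrad; fun_prop

@[fun_prop]
lemma measurable_kernelGrad : Measurable (kernelGrad n t) := continuous_kernelGrad.measurable

lemma gaussDensity_mul_log (ht : 0 < t) (u : E n) :
    gaussDensity n t u * (‖u‖ ^ 2 / t ^ 2) =
      2 / t * (gaussDensity n t u * Real.log (peak n t / gaussDensity n t u)) := by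
  have h : peak n t / gaussDensity n t u = Real.exp (‖u‖ ^ 2 / (2 * t)) := by
    rw [gaussDensity_eq, neg_div, Real.exp_neg]
    have := (peak_pos (n := n) ht).ne'
    field_simp
  rw [h, Real.log_exp]
  field_simp

lemma peak_two_mul (ht : 0 < t) : peak n t = 2 ^ ((n : ℝ) / 2) * peak n (2 * t) := by
  rw [peak, peak, show 2 * Real.pi * (2 * t) = 2 * (2 * Real.pi * t) by ring]
  have hs : (0 : ℝ) < 2 * Real.pi * t := by positivity
  generalize 2 * Real.pi * t = s at hs ⊢
  rw [Real.mul_rpow (by norm_num) hs.le, ← mul_assoc, ← Real.rpow_add (by norm_num)]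
  simp

lemma gaussDensity_le_two_mul (ht : 0 < t) (u : E n) :
    gaussDensity n t u ≤ 2 ^ ((n : ℝ) / 2) * gaussDensity n (2 * t) u := by
  rw [gaussDensity_eq, gaussDensity_eq, peak_two_mul ht, mul_assoc]
  have := peak_pos (n := n) (t := 2 * t) (by positivity)
  gcongr ?_ * (?_ * Real.exp ?_)
  rw [neg_div, neg_div, neg_le_neg_iff]
  gcongr
  linarith

lemma gaussDensity_mul_sq_le (ht : 0 < t) (u : E n) :
    gaussDensity n t u * (‖u‖ ^ 2 / t ^ 2) ≤
      4 * 2 ^ ((n : ℝ) / 2) / t * gaussDensity n (2 * t) u := by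
  rw [gaussDensity_eq, gaussDensity_eq, peak_two_mul ht]
  have hp := peak_pos (n := n) (t := 2 * t) (by positivity)
  set v := ‖u‖ ^ 2 / (4 * t) with hv
  have h1 : -‖u‖ ^ 2 / (2 * t) = -v + -v := by rw [hv]; field_simp; ring
  have h2 : -‖u‖ ^ 2 / (2 * (2 * t)) = -v := by rw [hv]; field_simp; ring
  have h3 : ‖u‖ ^ 2 / t ^ 2 = 4 / t * v := by rw [hv]; field_simp
  rw [h1, h2, h3, Real.exp_add]
  have h4 : v * Real.exp (-v) ≤ 1 := by
    rw [Real.exp_neg, ← div_eq_mul_inv, div_le_one (Real.exp_pos _)]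
    linarith [Real.add_one_le_exp v]
  have h5 : 0 ≤ 4 * 2 ^ ((n : ℝ) / 2) / t * (peak n (2 * t) * Real.exp (-v)) := by positivity
  calc _ = 4 * 2 ^ ((n : ℝ) / 2) / t * (peak n (2 * t) * Real.exp (-v)) * (v * Real.exp (-v)) := by
        ring
    _ ≤ _ := mul_le_of_le_one_right h5 h4

lemma norm_kernelGrad_sq (ht : 0 < t) (u : E n) :
    ‖kernelGrad n t u‖ ^ 2 = gaussDensity n t u * (gaussDensity n t u * (‖u‖ ^ 2 / t ^ 2)) := by
  rw [kernelGrad, norm_neg, norm_smul, Real.norm_of_nonneg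
    (div_nonneg (gaussDensity_nonneg ht u) ht.le)]
  ring

lemma gaussDensity_mul_sq_le_const (ht : 0 < t) (u : E n) :
    gaussDensity n t u * (‖u‖ ^ 2 / t ^ 2) ≤
      4 * 2 ^ ((n : ℝ) / 2) / t * peak n (2 * t) :=
  (gaussDensity_mul_sq_le ht u).trans (mul_le_mul_of_nonneg_left
    (gaussDensity_le_peak (by positivity) u) (by positivity))

lemma exists_norm_kernelGrad_le (n : ℕ) (ht : 0 < t) : ∃ C : ℝ, ∀ u : E n, ‖kernelGrad n t u‖ ≤ C := by
  refine ⟨Real.sqrt (peak n t * (4 * 2 ^ ((n : ℝ) / 2) / t * peak n (2 * t))), fun u => ?_⟩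
  refine Real.le_sqrt_of_sq_le ?_
  rw [norm_kernelGrad_sq ht]
  exact mul_le_mul (gaussDensity_le_peak ht u) (gaussDensity_mul_sq_le_const ht u)
    (mul_nonneg (gaussDensity_nonneg ht u) (by positivity)) (peak_pos ht).le

lemma hasGradientAt_gaussDensity (u : E n) :
    HasGradientAt (gaussDensity n t) (kernelGrad n t u) u := by
  have h1 : HasFDerivAt (fun x : E n => ‖x‖ ^ 2) (2 • (innerSL ℝ u)) u :=
    (hasStrictFDerivAt_norm_sq u).hasFDerivAt
  have h2 := ((h1.neg.mul_const (2 * t)⁻¹).exp).const_mul (peak n t)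
  have h3 : gaussDensity n t = fun x : E n =>
      peak n t * Real.exp ((-fun x : E n => ‖x‖ ^ 2) x * (2 * t)⁻¹) := by
    funext x; rw [gaussDensity_eq]; rfl
  rw [hasGradientAt_iff_hasFDerivAt]
  rw [← h3] at h2
  refine h2.congr_fderiv ?_
  ext y
  simp only [kernelGrad, gaussDensity_eq, InnerProductSpace.toDual_apply_apply, inner_neg_left,
    inner_smul_left, smul_apply, neg_apply,
    innerSL_apply_apply, Pi.neg_apply, smul_eq_mul, nsmul_eq_mul]
  simp only [conj_trivial]
  push_cast
  rw [div_eq_mul_inv (-‖u‖ ^ 2)]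
  rcases eq_or_ne t 0 with h | h
  · simp [h]
  · field_simp

variable (q : Measure (E n)) [IsFiniteMeasure q]

lemma integrable_gaussDensity_sub (ht : 0 < t) (z : E n) :
    Integrable (fun y => gaussDensity n t (z - y)) q :=
  Integrable.of_bound (by fun_prop) (peak n t) (Filter.Eventually.of_forall fun y => by
    rw [Real.norm_of_nonneg (gaussDensity_nonneg ht _)]; exact gaussDensity_le_peak ht _)

lemma integrable_gaussDensity_mul_sq (ht : 0 < t) (z : E n) :
    Integrable (fun y => gaussDensity n t (z - y) * (‖z - y‖ ^ 2 / t ^ 2)) q :=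
  Integrable.of_bound (by fun_prop) _ (Filter.Eventually.of_forall fun y => by
    rw [Real.norm_of_nonneg (mul_nonneg (gaussDensity_nonneg ht _) (by positivity))]
    exact gaussDensity_mul_sq_le_const ht _)

lemma integrable_kernelGrad_sub (ht : 0 < t) (z : E n) :
    Integrable (fun y => kernelGrad n t (z - y)) q := by
  obtain ⟨C, hC⟩ := exists_norm_kernelGrad_le n ht
  exact Integrable.of_bound (by fun_prop) C (Filter.Eventually.of_forall fun y => hC _)

lemma smoothedDensity_nonneg (ht : 0 < t) (z : E n) : 0 ≤ smoothedDensity q t z :=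
  integral_nonneg fun y => gaussDensity_nonneg ht _

lemma smoothedDensity_pos [NeZero q] (ht : 0 < t) (z : E n) : 0 < smoothedDensity q t z := by
  rw [smoothedDensity, integral_pos_iff_support_of_nonneg (fun y => gaussDensity_nonneg ht _)
    (integrable_gaussDensity_sub q ht z)]
  have h : Function.support (fun y => gaussDensity n t (z - y)) = Set.univ :=
    Set.eq_univ_of_forall fun y => (gaussDensity_pos ht _).ne'
  rw [h]
  exact NeZero.pos _

lemma posteriorMoment_nonneg (ht : 0 < t) (z : E n) : 0 ≤ posteriorMoment q t z :=
  integral_nonneg fun y => mul_nonneg (gaussDensity_nonneg ht _) (by positivity)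

@[fun_prop]
lemma measurable_smoothedDensity : Measurable (smoothedDensity q t) := by
  have h : StronglyMeasurable (fun p : E n × E n => gaussDensity n t (p.1 - p.2)) :=
    Measurable.stronglyMeasurable (by fun_prop)
  exact h.integral_prod_right.measurable

@[fun_prop]
lemma measurable_smoothedGrad : Measurable (smoothedGrad q t) := by
  have h : StronglyMeasurable (fun p : E n × E n => kernelGrad n t (p.1 - p.2)) :=
    Measurable.stronglyMeasurable (by fun_prop)
  exact h.integral_prod_right.measurable

lemma smoothedDensity_le_two_mul (ht : 0 < t) (z : E n) :
    smoothedDensity q t z ≤ 2 ^ ((n : ℝ) / 2) * smoothedDensity q (2 * t) z := by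
  rw [smoothedDensity, smoothedDensity, ← integral_const_mul]
  exact integral_mono (integrable_gaussDensity_sub q ht z)
    ((integrable_gaussDensity_sub q (by positivity) z).const_mul _)
    fun y => gaussDensity_le_two_mul ht _

lemma posteriorMoment_le_two_mul (ht : 0 < t) (z : E n) :
    posteriorMoment q t z ≤ 4 * 2 ^ ((n : ℝ) / 2) / t * smoothedDensity q (2 * t) z := by
  rw [posteriorMoment, smoothedDensity, ← integral_const_mul]
  exact integral_mono (integrable_gaussDensity_mul_sq q ht z)
    ((integrable_gaussDensity_sub q (by positivity) z).const_mul _)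
    fun y => gaussDensity_mul_sq_le ht _

/-- Jensen's inequality for the posterior second moment: where the density is not small, the
posterior is concentrated at the scale `√t`. -/
lemma posteriorMoment_le_log [NeZero q] (ht : 0 < t) (hq : q.real Set.univ ≤ 1) (z : E n) :
    posteriorMoment q t z ≤
      2 / t * (smoothedDensity q t z * Real.log (peak n t / smoothedDensity q t z)) := by
  set G := smoothedDensity q t z with hG
  have hGpos : 0 < G := smoothedDensity_pos q ht z
  have hρ := peak_pos (n := n) ht
  -- the tangent line of the concave function `v ↦ v log (1 / v)` at the mean value
  have hpt : ∀ y, gaussDensity n t (z - y) * (‖z - y‖ ^ 2 / t ^ 2) ≤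
      2 / t * (gaussDensity n t (z - y) * (Real.log (peak n t / G) - 1) + G) := by
    intro y
    rw [gaussDensity_mul_log ht]
    refine mul_le_mul_of_nonneg_left ?_ (by positivity)
    have hφ := gaussDensity_pos ht (z - y)
    set φ := gaussDensity n t (z - y)
    have h1 : Real.log (peak n t / φ) = Real.log (peak n t / G) + Real.log (G / φ) := by
      rw [← Real.log_mul (by positivity) (by positivity)]
      congr 1; field_simp
    have h2 : φ * Real.log (G / φ) ≤ φ * (G / φ - 1) :=
      mul_le_mul_of_nonneg_left (Real.log_le_sub_one_of_pos (by positivity)) hφ.le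
    have h3 : φ * (G / φ - 1) = G - φ := by field_simp
    rw [h1]; linarith
  have hI := (integrable_gaussDensity_sub q ht z).mul_const (Real.log (peak n t / G) - 1)
  refine (integral_mono (integrable_gaussDensity_mul_sq q ht z)
    ((hI.add (integrable_const G)).const_mul (2 / t)) hpt).trans ?_
  simp only [Pi.add_apply]
  rw [integral_const_mul, integral_add hI (integrable_const G), integral_mul_const, integral_const,
    smul_eq_mul]
  refine mul_le_mul_of_nonneg_left ?_ (by positivity)
  change G * _ + _ ≤ _
  nlinarith

/-- Bias-variance decomposition for the posterior law of `-(z - Y) / t`. -/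
lemma integral_gaussDensity_mul_norm_sub_sq (ht : 0 < t) (z : E n)
    (hG : smoothedDensity q t z ≠ 0) :
    ∫ y, gaussDensity n t (z - y) * ‖-((1 / t) • (z - y)) -
        (1 / smoothedDensity q t z) • smoothedGrad q t z‖ ^ 2 ∂q =
      posteriorMoment q t z - ‖smoothedGrad q t z‖ ^ 2 / smoothedDensity q t z := by
  set G := smoothedDensity q t z with hGdef
  set s := (1 / G) • smoothedGrad q t z with hs
  have hpt : ∀ s y : E n, gaussDensity n t (z - y) * ‖-((1 / t) • (z - y)) - s‖ ^ 2 =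
      gaussDensity n t (z - y) * (‖z - y‖ ^ 2 / t ^ 2) - 2 * inner ℝ s (kernelGrad n t (z - y)) +
        gaussDensity n t (z - y) * ‖s‖ ^ 2 := by
    intro s y
    rw [norm_sub_sq_real, norm_neg, norm_smul, kernelGrad, inner_neg_left, inner_neg_right,
      real_inner_smul_left, real_inner_smul_right, real_inner_comm s, Real.norm_of_nonneg
      (by positivity)]
    ring
  simp only [hpt s]
  have h1 := integrable_gaussDensity_mul_sq q ht z
  have h2 := ((integrable_kernelGrad_sub q ht z).const_inner (𝕜 := ℝ) s).const_mul 2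
  have h3 := (integrable_gaussDensity_sub q ht z).mul_const (‖s‖ ^ 2)
  rw [integral_add (by exact h1.sub h2) h3, integral_sub h1 h2, integral_const_mul, integral_mul_const,
    integral_inner (integrable_kernelGrad_sub q ht z)]
  change posteriorMoment q t z - 2 * inner ℝ s (smoothedGrad q t z) + G * ‖s‖ ^ 2 = _
  rw [hs, real_inner_smul_left, real_inner_self_eq_norm_sq, norm_smul, mul_pow, Real.norm_eq_abs,
    sq_abs]
  field_simp
  ring

lemma norm_smoothedGrad_sq_le [NeZero q] (ht : 0 < t) (z : E n) :
    ‖smoothedGrad q t z‖ ^ 2 ≤ smoothedDensity q t z * posteriorMoment q t z := by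
  have hG := smoothedDensity_pos q ht z
  have h := integral_gaussDensity_mul_norm_sub_sq q ht z hG.ne'
  have h0 : 0 ≤ posteriorMoment q t z - ‖smoothedGrad q t z‖ ^ 2 / smoothedDensity q t z := by
    rw [← h]
    exact integral_nonneg fun y => mul_nonneg (gaussDensity_nonneg ht _) (by positivity)
  have h1 : ‖smoothedGrad q t z‖ ^ 2 / smoothedDensity q t z ≤ posteriorMoment q t z := by linarith
  rwa [div_le_iff₀ hG, mul_comm] at h1

lemma hasGradientAt_smoothedDensity (ht : 0 < t) (z : E n) :
    HasGradientAt (smoothedDensity q t) (smoothedGrad q t z) z := by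
  obtain ⟨C, hC⟩ := exists_norm_kernelGrad_le n ht
  rw [hasGradientAt_iff_hasFDerivAt]
  have key := hasFDerivAt_integral_of_dominated_of_fderiv_le (μ := q) (s := Set.univ)
    (F := fun x y => gaussDensity n t (x - y)) (x₀ := z)
    (F' := fun x y => InnerProductSpace.toDual ℝ (E n) (kernelGrad n t (x - y)))
    (bound := fun _ => C) Filter.univ_mem
    (Filter.Eventually.of_forall fun x => by fun_prop)
    (integrable_gaussDensity_sub q ht z)
    ((Continuous.aestronglyMeasurable (by fun_prop)))
    (Filter.Eventually.of_forall fun y x _ => by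
      rw [LinearIsometryEquiv.norm_map]; exact hC _)
    (integrable_const C)
    (Filter.Eventually.of_forall fun y x _ => by
      have h := (hasGradientAt_gaussDensity (t := t) (x - y)).hasFDerivAt
      exact (hasFDerivAt_comp_sub y).2 h)
  refine key.congr_fderiv ?_
  exact ((InnerProductSpace.toDual ℝ (E n)).toContinuousLinearEquiv.toContinuousLinearMap.integral_comp_comm
    (integrable_kernelGrad_sub q ht z))

lemma score_eq [NeZero q] (ht : 0 < t) (z : E n) :
    score q t z = (1 / smoothedDensity q t z) • smoothedGrad q t z := by
  have h := (hasGradientAt_smoothedDensity q ht z).hasFDerivAt.log (smoothedDensity_pos q ht z).ne'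
  refine HasGradientAt.gradient ?_
  rw [hasGradientAt_iff_hasFDerivAt]
  refine h.congr_fderiv ?_
  rw [map_smul, one_div]

lemma lintegral_smoothedLaw {h : E n → ℝ≥0∞} (hh : Measurable h) :
    ∫⁻ x, h x ∂(smoothedLaw q t) = ∫⁻ y, ∫⁻ ξ, h (y + ξ) ∂(noise n t) ∂q :=
  Measure.lintegral_conv hh

lemma smoothedLaw_eq_withDensity (ht : 0 < t) :
    smoothedLaw q t = volume.withDensity (fun x => ENNReal.ofReal (smoothedDensity q t x)) := by
  refine Measure.ext_of_lintegral _ fun h hh => ?_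
  rw [lintegral_smoothedLaw q hh, lintegral_withDensity_eq_lintegral_mul _ (by fun_prop) hh]
  have h1 : ∀ y, ∫⁻ ξ, h (y + ξ) ∂(noise n t) =
      ∫⁻ x, ENNReal.ofReal (gaussDensity n t (x - y)) * h x := by
    intro y
    rw [lintegral_noise ht (by fun_prop),
      ← lintegral_add_left_eq_self (fun x => ENNReal.ofReal (gaussDensity n t (x - y)) * h x) y]
    simp
  simp only [h1]
  rw [lintegral_lintegral_swap (Measurable.aemeasurable (by fun_prop))]
  refine lintegral_congr fun x => ?_
  rw [lintegral_mul_const _ (by fun_prop), Pi.mul_apply, smoothedDensity,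
    ofReal_integral_eq_lintegral_ofReal (integrable_gaussDensity_sub q ht x)
    (Filter.Eventually.of_forall fun y => gaussDensity_nonneg ht _)]

lemma lintegral_smoothedLaw_eq_volume (ht : 0 < t) {h : E n → ℝ≥0∞} (hh : Measurable h) :
    ∫⁻ x, h x ∂(smoothedLaw q t) = ∫⁻ x, ENNReal.ofReal (smoothedDensity q t x) * h x := by
  rw [smoothedLaw_eq_withDensity q ht, lintegral_withDensity_eq_lintegral_mul _ (by fun_prop) hh]
  rfl

end Smoothing

/-! ### Empirical means of independent samples -/

section Sampling

variable {Ω : Type*} [MeasurableSpace Ω] {μ : Measure Ω} [IsProbabilityMeasure μ] {N : ℕ}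

lemma lintegral_sq_empirical_sub_le {f : Ω → ℝ} (hf : Measurable f) {C : ℝ}
    (hC : ∀ x, |f x| ≤ C) (hN : 0 < N) :
    ∫⁻ X, ENNReal.ofReal (((1 / (N : ℝ)) * ∑ j, f (X j) - ∫ x, f x ∂μ) ^ 2)
      ∂(Measure.pi fun _ : Fin N => μ) ≤ ENNReal.ofReal (1 / N * ∫ x, f x ^ 2 ∂μ) := by
  have hN' : (N : ℝ) ≠ 0 := by positivity
  have hm : MemLp f 2 μ := MemLp.of_bound hf.aestronglyMeasurable C
    (Filter.Eventually.of_forall hC)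
  have hmj : ∀ j : Fin N, MemLp (fun X : Fin N → Ω => f (X j)) 2 (Measure.pi fun _ => μ) :=
    fun j => hm.comp_measurePreserving (measurePreserving_eval _ j)
  have hS : MemLp (∑ j : Fin N, fun X : Fin N → Ω => f (X j)) 2 (Measure.pi fun _ => μ) :=
    memLp_finsetSum' _ fun j _ => hmj j
  have hmean : ∫ X, (∑ j : Fin N, fun X : Fin N → Ω => f (X j)) X
      ∂(Measure.pi fun _ : Fin N => μ) = N * ∫ x, f x ∂μ := by
    simp only [Finset.sum_apply]
    rw [integral_finsetSum _ fun j _ => (hmj j).integrable (by norm_num)]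
    have : ∀ j : Fin N, ∫ X : Fin N → Ω, f (X j) ∂(Measure.pi fun _ => μ) = ∫ x, f x ∂μ := by
      intro j
      have h := (measurePreserving_eval (fun _ : Fin N => μ) j).map_eq
      conv_rhs => rw [← h]
      rw [integral_map (measurable_pi_apply j).aemeasurable hf.aestronglyMeasurable]
    simp [this]
  have hvar := variance_sum_pi (X := fun _ : Fin N => f) (μ := fun _ => μ) fun _ => hm
  rw [variance_eq_integral hS.aemeasurable, hmean] at hvar
  have hle : Var[f; μ] ≤ ∫ x, f x ^ 2 ∂μ := variance_le_expectation_sq hf.aestronglyMeasurable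
  have hpt : ∀ X : Fin N → Ω, ((1 / (N : ℝ)) * ∑ j, f (X j) - ∫ x, f x ∂μ) ^ 2 =
      (1 / (N : ℝ)) ^ 2 *
        ((∑ j : Fin N, fun X : Fin N → Ω => f (X j)) X - N * ∫ x, f x ∂μ) ^ 2 := by
    intro X
    simp only [Finset.sum_apply]
    field_simp
  simp only [hpt]
  rw [← ofReal_integral_eq_lintegral_ofReal]
  · rw [integral_const_mul, hvar]
    refine ENNReal.ofReal_le_ofReal ?_
    simp only [Finset.sum_const, Finset.card_univ, Fintype.card_fin, nsmul_eq_mul]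
    rw [show (1 / (N : ℝ)) ^ 2 * (N * Var[f; μ]) = 1 / N * Var[f; μ] by field_simp]
    gcongr
  · exact ((hS.sub (memLp_const _)).integrable_sq).const_mul _
  · exact Filter.Eventually.of_forall fun X => by positivity

lemma lintegral_norm_sq_empirical_sub_le {k : ℕ} {f : Ω → E k} (hf : Measurable f) {C : ℝ}
    (hC : ∀ x, ‖f x‖ ≤ C) (hN : 0 < N) :
    ∫⁻ X, ENNReal.ofReal (‖(1 / (N : ℝ)) • ∑ j, f (X j) - ∫ x, f x ∂μ‖ ^ 2)
      ∂(Measure.pi fun _ : Fin N => μ) ≤ ENNReal.ofReal (1 / N * ∫ x, ‖f x‖ ^ 2 ∂μ) := by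
  have hint : Integrable f μ := Integrable.of_bound hf.aestronglyMeasurable C
    (Filter.Eventually.of_forall hC)
  have hcoord : ∀ i, (∫ x, f x ∂μ) i = ∫ x, f x i ∂μ := fun i =>
    ((EuclideanSpace.proj (𝕜 := ℝ) i).integral_comp_comm hint).symm
  have hb : ∀ i x, |f x i| ≤ C := fun i x => (PiLp.norm_apply_le (f x) i).trans (hC x)
  have hfi : ∀ i, Measurable fun x => f x i := fun i => by fun_prop
  have hpt : ∀ X : Fin N → Ω, ENNReal.ofReal (‖(1 / (N : ℝ)) • ∑ j, f (X j) - ∫ x, f x ∂μ‖ ^ 2) =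
      ∑ i, ENNReal.ofReal (((1 / (N : ℝ)) * ∑ j, f (X j) i - ∫ x, f x i ∂μ) ^ 2) := by
    intro X
    rw [EuclideanSpace.real_norm_sq_eq, ENNReal.ofReal_sum_of_nonneg fun i _ => by positivity]
    simp [hcoord]
  simp only [hpt]
  rw [lintegral_finsetSum _ fun i _ => by fun_prop]
  refine (Finset.sum_le_sum fun i _ => lintegral_sq_empirical_sub_le (hfi i) (hb i) hN).trans ?_
  rw [← ENNReal.ofReal_sum_of_nonneg fun i _ => mul_nonneg (by positivity)
    (integral_nonneg fun x => by positivity), ← Finset.mul_sum, ← integral_finsetSum]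
  · simp only [EuclideanSpace.real_norm_sq_eq]; exact le_rfl
  · intro i _
    exact (MemLp.of_bound (hfi i).aestronglyMeasurable C
      (Filter.Eventually.of_forall (hb i))).integrable_sq

lemma lintegral_abs_empirical_sub_le {f : Ω → ℝ} (hf : Measurable f) (hf0 : ∀ x, 0 ≤ f x)
    (hint : Integrable f μ) (hN : 0 < N) :
    ∫⁻ X, ENNReal.ofReal |(1 / (N : ℝ)) * ∑ j, f (X j) - ∫ x, f x ∂μ|
      ∂(Measure.pi fun _ : Fin N => μ) ≤ ENNReal.ofReal (2 * ∫ x, f x ∂μ) := by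
  have hm0 : 0 ≤ ∫ x, f x ∂μ := integral_nonneg hf0
  have hpt : ∀ X : Fin N → Ω, ENNReal.ofReal |(1 / (N : ℝ)) * ∑ j, f (X j) - ∫ x, f x ∂μ| ≤
      ENNReal.ofReal (1 / N) * ∑ j, ENNReal.ofReal (f (X j)) + ENNReal.ofReal (∫ x, f x ∂μ) := by
    intro X
    rw [← ENNReal.ofReal_sum_of_nonneg fun j _ => hf0 _, ← ENNReal.ofReal_mul (by positivity),
      ← ENNReal.ofReal_add (mul_nonneg (by positivity) (Finset.sum_nonneg fun j _ => hf0 _)) hm0]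
    refine ENNReal.ofReal_le_ofReal ?_
    have h0 : 0 ≤ (1 / (N : ℝ)) * ∑ j, f (X j) :=
      mul_nonneg (by positivity) (Finset.sum_nonneg fun j _ => hf0 _)
    rw [abs_le]; constructor <;> linarith
  refine (lintegral_mono hpt).trans ?_
  rw [lintegral_add_right _ measurable_const, lintegral_const_mul _ (by fun_prop),
    lintegral_finsetSum _ fun i _ => by fun_prop]
  have h1 : ∀ j : Fin N, ∫⁻ X : Fin N → Ω, ENNReal.ofReal (f (X j)) ∂(Measure.pi fun _ => μ) =
      ENNReal.ofReal (∫ x, f x ∂μ) := by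
    intro j
    rw [(measurePreserving_eval (fun _ : Fin N => μ) j).lintegral_comp
      (f := fun x => ENNReal.ofReal (f x)) (by fun_prop),
      ofReal_integral_eq_lintegral_ofReal hint (Filter.Eventually.of_forall hf0)]
  simp only [h1, Finset.sum_const, Finset.card_univ, Fintype.card_fin, nsmul_eq_mul,
    lintegral_const, measure_univ, mul_one]
  rw [← ENNReal.ofReal_natCast, ← ENNReal.ofReal_mul (by positivity),
    ← ENNReal.ofReal_mul (by positivity), ← ENNReal.ofReal_add (by positivity) hm0]
  refine ENNReal.ofReal_le_ofReal (le_of_eq ?_)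
  have hN' : (N : ℝ) ≠ 0 := by positivity
  field_simp
  ring

end Sampling

/-! ### Truncation of integrals over the low-dimensional space -/

section Truncation

variable {n : ℕ} {t : ℝ}

/-- A one-dimensional subgaussian bound in each coordinate gives an exponential moment of the squared
norm; by convexity of `exp` it suffices to lose the dimension in the exponent. -/
lemma lintegral_exp_norm_sq_le (q : Measure (E n)) (hq : q Set.univ ≤ 1) {σ b : ℝ} {k : ℕ}
    (hnk : n ≤ k) (hb : 0 ≤ b) (hbk : b * k ≤ 1 / σ ^ 2)
    (hsub : ∀ θ : E n, ‖θ‖ = 1 →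
      ∫⁻ x, ENNReal.ofReal (Real.exp ((inner ℝ x θ / σ) ^ 2)) ∂q ≤ 2) :
    ∫⁻ x, ENNReal.ofReal (Real.exp (b * ‖x‖ ^ 2)) ∂q ≤ 2 := by
  rcases Nat.eq_zero_or_pos n with hn | hn
  · subst hn
    have h : ∀ x : E 0, ENNReal.ofReal (Real.exp (b * ‖x‖ ^ 2)) = 1 := by
      intro x; rw [Subsingleton.elim x 0]; simp
    simp only [h, lintegral_const, one_mul]
    exact hq.trans (by norm_num)
  have hn' : (0 : ℝ) < n := by exact_mod_cast hn
  have hpt : ∀ x : E n, ENNReal.ofReal (Real.exp (b * ‖x‖ ^ 2)) ≤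
      ∑ i : Fin n, ENNReal.ofReal (1 / n) *
        ENNReal.ofReal (Real.exp ((inner ℝ x (EuclideanSpace.single i (1 : ℝ)) / σ) ^ 2)) := by
    intro x
    have hJ := convexOn_exp.map_sum_le (t := Finset.univ) (w := fun _ : Fin n => 1 / (n : ℝ))
      (p := fun i => b * n * x i ^ 2) (fun i _ => by positivity) (by simp [hn'.ne'])
      (fun i _ => Set.mem_univ _)
    simp only [smul_eq_mul] at hJ
    have h1 : ∑ i, 1 / (n : ℝ) * (b * n * x i ^ 2) = b * ‖x‖ ^ 2 := by
      rw [EuclideanSpace.real_norm_sq_eq, Finset.mul_sum]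
      refine Finset.sum_congr rfl fun i _ => ?_
      field_simp
    rw [h1] at hJ
    refine (ENNReal.ofReal_le_ofReal hJ).trans ?_
    rw [ENNReal.ofReal_sum_of_nonneg fun i _ => by positivity]
    refine Finset.sum_le_sum fun i _ => ?_
    rw [← ENNReal.ofReal_mul (by positivity)]
    refine ENNReal.ofReal_le_ofReal (mul_le_mul_of_nonneg_left (Real.exp_le_exp.2 ?_) (by positivity))
    have h2 : inner ℝ x (EuclideanSpace.single i (1 : ℝ)) = x i := by
      simp [EuclideanSpace.inner_single_right]
    rw [h2, div_pow, div_eq_mul_one_div, mul_comm]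
    refine mul_le_mul_of_nonneg_left ?_ (by positivity)
    refine le_trans (mul_le_mul_of_nonneg_left ?_ hb) hbk
    exact_mod_cast hnk
  refine (lintegral_mono hpt).trans ?_
  rw [lintegral_finsetSum _ fun i _ => by fun_prop]
  have h3 : ∀ i ∈ Finset.univ, ∫⁻ x, ENNReal.ofReal (1 / n) *
        ENNReal.ofReal (Real.exp ((inner ℝ x (EuclideanSpace.single i (1 : ℝ)) / σ) ^ 2)) ∂q ≤
        ENNReal.ofReal (1 / n) * 2 := by
    intro i _
    rw [lintegral_const_mul _ (by fun_prop)]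
    exact mul_le_mul_right (hsub _ (by simp)) _
  refine (Finset.sum_le_sum h3).trans ?_
  rw [Finset.sum_const, Finset.card_univ, Fintype.card_fin, nsmul_eq_mul, ← mul_assoc,
    ← ENNReal.ofReal_natCast, ← ENNReal.ofReal_mul hn'.le, mul_one_div_cancel hn'.ne']
  simp

/-- `q` is a measure of mass at most one with the subgaussian bound with parameter `σ` in each
direction: the form in which subgaussianity is used for the unnormalised laws `q` on a subspace. -/
structure IsSubSubgaussian (q : Measure (E n)) (σ : ℝ) : Prop where
  mass : q Set.univ ≤ 1
  pos : 0 < σ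
  bound : ∀ θ : E n, ‖θ‖ = 1 →
      ∫⁻ x, ENNReal.ofReal (Real.exp ((inner ℝ x θ / σ) ^ 2)) ∂q ≤ 2

lemma IsSubSubgaussian.lintegral_exp_smoothedLaw_le {q : Measure (E n)} {σ : ℝ} {k : ℕ}
    (hq : IsSubSubgaussian q σ) (hnk : n ≤ k) (ht : 0 < t) [IsFiniteMeasure q] :
    ∫⁻ x, ENNReal.ofReal (Real.exp (‖x‖ ^ 2 / (2 * k * σ ^ 2 + 16 * t)))
      ∂(smoothedLaw q (2 * t)) ≤ 2 * ENNReal.ofReal (2 ^ ((n : ℝ) / 2)) := by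
  have hσ := hq.pos
  set B := 2 * k * σ ^ 2 + 16 * t with hB
  have hBpos : 0 < B := by positivity
  rw [lintegral_smoothedLaw q (by fun_prop)]
  have hpt : ∀ y : E n, ∫⁻ ξ, ENNReal.ofReal (Real.exp (‖y + ξ‖ ^ 2 / B)) ∂(noise n (2 * t)) ≤
      ENNReal.ofReal (Real.exp (2 / B * ‖y‖ ^ 2)) * ENNReal.ofReal (2 ^ ((n : ℝ) / 2)) := by
    intro y
    have h1 : ∀ ξ : E n, ENNReal.ofReal (Real.exp (‖y + ξ‖ ^ 2 / B)) ≤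
        ENNReal.ofReal (Real.exp (2 / B * ‖y‖ ^ 2)) *
          ENNReal.ofReal (Real.exp (2 / B * ‖ξ‖ ^ 2)) := by
      intro ξ
      rw [← ENNReal.ofReal_mul (by positivity), ← Real.exp_add]
      refine ENNReal.ofReal_le_ofReal (Real.exp_le_exp.2 ?_)
      have h2 : ‖y + ξ‖ ^ 2 ≤ 2 * (‖y‖ ^ 2 + ‖ξ‖ ^ 2) := by
        have := norm_add_le y ξ
        nlinarith [norm_nonneg (y + ξ), sq_nonneg (‖y‖ - ‖ξ‖), norm_nonneg y, norm_nonneg ξ]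
      rw [← mul_add, div_mul_eq_mul_div]
      gcongr
    refine (lintegral_mono h1).trans ?_
    rw [lintegral_const_mul _ (by fun_prop)]
    refine mul_le_mul_right (lintegral_exp_sq_noise_le (by positivity) ?_) _
    rw [div_le_div_iff₀ hBpos (by positivity)]
    have : 0 ≤ 2 * k * σ ^ 2 := by positivity
    linarith
  refine (lintegral_mono hpt).trans ?_
  rw [lintegral_mul_const _ (by fun_prop)]
  refine mul_le_mul_left (lintegral_exp_norm_sq_le q hq.mass hnk (by positivity) ?_ hq.bound) _
  rw [div_mul_eq_mul_div, div_le_div_iff₀ hBpos (by positivity)]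
  linarith

/-- A function that is bounded both by a constant and by a multiple of a smoothed subgaussian
density has an integral of the order of the constant times the volume of a ball of squared radius
`log N * (2 * k * σ ^ 2 + 16 * t)`, up to a remainder of order `1 / N`. -/
lemma IsSubSubgaussian.lintegral_le_of_le {q : Measure (E n)} {σ : ℝ} {k N : ℕ}
    (hq : IsSubSubgaussian q σ) (hnk : n ≤ k) (ht : 0 < t) [IsFiniteMeasure q] (hN : 2 ≤ N)
    {F : E n → ℝ≥0∞} {κ K : ℝ} (hκ : 0 ≤ κ) (hK : 0 ≤ K) (h1 : ∀ z, F z ≤ ENNReal.ofReal κ)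
    (h2 : ∀ z, F z ≤ ENNReal.ofReal (K * smoothedDensity q (2 * t) z)) :
    ∫⁻ z, F z ≤ ENNReal.ofReal (Real.exp 1 * κ *
      (Real.pi * (Real.log N * (2 * k * σ ^ 2 + 16 * t))) ^ ((n : ℝ) / 2) +
        K / N * (2 * 2 ^ ((n : ℝ) / 2))) := by
  have hσ := hq.pos
  have hN0 : (0 : ℝ) < N := by positivity
  have hℓ : 0 < Real.log N := Real.log_pos (by exact_mod_cast hN)
  have hexp := hq.lintegral_exp_smoothedLaw_le hnk ht
  set B := 2 * k * σ ^ 2 + 16 * t with hB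
  have hBpos : 0 < B := by positivity
  have hsd := fun z => smoothedDensity_nonneg q (t := 2 * t) (by positivity) z
  have hpt : ∀ z, F z ≤ ENNReal.ofReal (Real.exp 1 * κ) *
      ENNReal.ofReal (Real.exp (-(1 / (Real.log N * B)) * ‖z‖ ^ 2)) +
      ENNReal.ofReal (K / N) * (ENNReal.ofReal (smoothedDensity q (2 * t) z) *
        ENNReal.ofReal (Real.exp (‖z‖ ^ 2 / B))) := by
    intro z
    rcases le_total (‖z‖ ^ 2) (Real.log N * B) with hz | hz
    · refine le_add_right ((h1 z).trans ?_)
      rw [← ENNReal.ofReal_mul (by positivity)]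
      refine ENNReal.ofReal_le_ofReal ?_
      rw [mul_right_comm, ← Real.exp_add]
      refine le_mul_of_one_le_left hκ (Real.one_le_exp ?_)
      have : 1 / (Real.log N * B) * ‖z‖ ^ 2 ≤ 1 := by
        rw [one_div_mul_eq_div, div_le_one (by positivity)]; exact hz
      linarith
    · refine le_add_left ((h2 z).trans ?_)
      rw [← ENNReal.ofReal_mul (hsd z), ← ENNReal.ofReal_mul (by positivity)]
      refine ENNReal.ofReal_le_ofReal ?_
      have h3 : (N : ℝ) ≤ Real.exp (‖z‖ ^ 2 / B) := by
        rw [← Real.log_le_iff_le_exp hN0, le_div_iff₀ hBpos]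
        exact hz
      calc K * smoothedDensity q (2 * t) z = K / N * (smoothedDensity q (2 * t) z * N) := by
            field_simp
        _ ≤ _ := mul_le_mul_of_nonneg_left (mul_le_mul_of_nonneg_left h3 (hsd z)) (by positivity)
  refine (lintegral_mono hpt).trans ?_
  rw [lintegral_add_left (by fun_prop), lintegral_const_mul _ (by fun_prop),
    lintegral_const_mul _ (by fun_prop), lintegral_exp_neg_mul_sq_norm (by positivity),
    ← lintegral_smoothedLaw_eq_volume q (by positivity) (by fun_prop),
    ENNReal.ofReal_add (by positivity) (by positivity), ← ENNReal.ofReal_mul (by positivity)]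
  refine add_le_add (le_of_eq ?_) ?_
  · congr 3; field_simp
  · rw [ENNReal.ofReal_mul (by positivity), ENNReal.ofReal_mul (p := 2) (by positivity),
      ENNReal.ofReal_ofNat]
    exact mul_le_mul_right hexp _

/-- The volume factor of the truncation, in terms of the ratio of the subgaussian scale and the
noise scale. -/
lemma volume_factor_le {k κ N : ℕ} (hnk : n ≤ k) (hkκ : k ≤ κ) {σ : ℝ} (hσ : 0 < σ) (ht : 0 < t)
    (hN : 2 ≤ N) :
    peak n t * (Real.pi * (Real.log N * (2 * k * σ ^ 2 + 16 * t))) ^ ((n : ℝ) / 2) ≤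
      (4 * (k + 8)) ^ κ * (Real.log N ^ κ * (1 + σ ^ κ / t ^ ((κ : ℝ) / 2))) := by
  have hℓ : 1 / 2 ≤ Real.log N := by
    have h2 : Real.log 2 ≤ Real.log N := Real.log_le_log (by norm_num) (by exact_mod_cast hN)
    linarith [Real.log_two_gt_d9]
  set ℓ := Real.log N
  set u := σ ^ 2 / t with hu
  have hu0 : 0 ≤ u := by positivity
  have hk0 : (0 : ℝ) ≤ k := Nat.cast_nonneg k
  have h1 : peak n t * (Real.pi * (ℓ * (2 * k * σ ^ 2 + 16 * t))) ^ ((n : ℝ) / 2) =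
      (ℓ * (k * u + 8)) ^ ((n : ℝ) / 2) := by
    have hs : (0 : ℝ) < 2 * Real.pi * t := by positivity
    have h2 : Real.pi * (ℓ * (2 * k * σ ^ 2 + 16 * t)) =
        2 * Real.pi * t * (ℓ * (k * u + 8)) := by rw [hu]; field_simp; ring
    rw [h2, peak]
    generalize 2 * Real.pi * t = s at hs ⊢
    rw [Real.mul_rpow hs.le (by positivity), ← mul_assoc, ← Real.rpow_add hs]
    simp
  have h2 : ℓ * (k * u + 8) ≤ (2 * ℓ * (k + 8)) * (1 + u) := by
    have : k * u + 8 ≤ 2 * (k + 8) * (1 + u) := by nlinarith [mul_nonneg hk0 hu0]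
    calc ℓ * (k * u + 8) ≤ ℓ * (2 * (k + 8) * (1 + u)) := by gcongr
      _ = _ := by ring
  have hb1 : 1 ≤ 2 * ℓ * (k + 8) := by nlinarith
  have hnκ : (n : ℝ) / 2 ≤ (κ : ℝ) / 2 := by
    have : (n : ℝ) ≤ κ := by exact_mod_cast hnk.trans hkκ
    linarith
  have h3 : (1 + u) ^ ((κ : ℝ) / 2) ≤ 2 ^ ((κ : ℝ) / 2) * (1 + u ^ ((κ : ℝ) / 2)) := by
    have hm : (1 + u) ≤ 2 * max 1 u := by
      have := le_max_left 1 u; have := le_max_right 1 u; linarith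
    have hm0 : 0 ≤ max 1 u := le_trans hu0 (le_max_right _ _)
    refine (Real.rpow_le_rpow (by positivity) hm (by positivity)).trans ?_
    rw [Real.mul_rpow (by norm_num) hm0]
    refine mul_le_mul_of_nonneg_left ?_ (by positivity)
    rcases max_choice 1 u with h | h <;> rw [h]
    · rw [Real.one_rpow]; have : 0 ≤ u ^ ((κ : ℝ) / 2) := by positivity
      linarith
    · linarith
  have h4 : u ^ ((κ : ℝ) / 2) = σ ^ κ / t ^ ((κ : ℝ) / 2) := by
    rw [hu, Real.div_rpow (by positivity) ht.le, ← Real.rpow_natCast σ 2, ← Real.rpow_mul hσ.le,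
      ← Real.rpow_natCast σ κ]
    congr 2; push_cast; ring
  rw [h1, ← h4]
  have hb2 : 1 ≤ 2 * ℓ * (k + 8) * (1 + u) := by nlinarith
  calc (ℓ * (k * u + 8)) ^ ((n : ℝ) / 2) ≤ (2 * ℓ * (k + 8) * (1 + u)) ^ ((n : ℝ) / 2) :=
        Real.rpow_le_rpow (by positivity) h2 (by positivity)
    _ ≤ (2 * ℓ * (k + 8) * (1 + u)) ^ ((κ : ℝ) / 2) := Real.rpow_le_rpow_of_exponent_le hb2 hnκ
    _ = (2 * ℓ * (k + 8)) ^ ((κ : ℝ) / 2) * (1 + u) ^ ((κ : ℝ) / 2) :=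
        Real.mul_rpow (by positivity) (by positivity)
    _ ≤ (2 * ℓ * (k + 8)) ^ ((κ : ℝ) / 2) * (2 ^ ((κ : ℝ) / 2) * (1 + u ^ ((κ : ℝ) / 2))) := by
        gcongr
    _ = (4 * ℓ * (k + 8)) ^ ((κ : ℝ) / 2) * (1 + u ^ ((κ : ℝ) / 2)) := by
        rw [← mul_assoc, ← Real.mul_rpow (by positivity) (by norm_num)]
        congr 2; ring
    _ ≤ (4 * ℓ * (k + 8)) ^ (κ : ℝ) * (1 + u ^ ((κ : ℝ) / 2)) := by
        refine mul_le_mul_of_nonneg_right ?_ (by positivity)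
        refine Real.rpow_le_rpow_of_exponent_le (by nlinarith) ?_
        have : (0 : ℝ) ≤ κ := Nat.cast_nonneg κ
        linarith
    _ = _ := by
        rw [Real.rpow_natCast, show 4 * ℓ * (k + 8) = (4 * (k + 8)) * ℓ by ring, mul_pow]
        ring

/-- The form of the truncation bound in which it is used: functions bounded by
`peak / N` and by the smoothed density have integrals of order `1 / N`, up to a polynomial in the
ratio of the scales and logarithms. -/
lemma IsSubSubgaussian.lintegral_le_rate {q : Measure (E n)} {σ : ℝ} {k κ N : ℕ}
    (hq : IsSubSubgaussian q σ) (hnk : n ≤ k) (hkκ : k ≤ κ) (ht : 0 < t) [IsFiniteMeasure q]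
    (hN : 2 ≤ N) {F : E n → ℝ≥0∞} {K : ℝ} (hK : 0 ≤ K)
    (h1 : ∀ z, F z ≤ ENNReal.ofReal (K * (peak n t / N)))
    (h2 : ∀ z, F z ≤ ENNReal.ofReal (K * smoothedDensity q (2 * t) z)) :
    ∫⁻ z, F z ≤ ENNReal.ofReal (5 * (4 * (k + 8)) ^ κ * (K / N) *
      (Real.log N ^ κ * (1 + σ ^ κ / t ^ ((κ : ℝ) / 2)))) := by
  have hσ := hq.pos
  have hp := peak_pos (n := n) ht
  refine (hq.lintegral_le_of_le hnk ht hN (κ := K * (peak n t / N)) (by positivity) hK h1 h2).trans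
    (ENNReal.ofReal_le_ofReal ?_)
  have hv := volume_factor_le hnk hkκ hσ ht hN
  have hℓ : 1 / 2 ≤ Real.log N := by
    have h2 : Real.log 2 ≤ Real.log N := Real.log_le_log (by norm_num) (by exact_mod_cast hN)
    linarith [Real.log_two_gt_d9]
  have hk0 : (0 : ℝ) ≤ k := Nat.cast_nonneg k
  have h3 : (2 : ℝ) ^ ((n : ℝ) / 2) ≤
      (4 * (k + 8)) ^ κ * (Real.log N ^ κ * (1 + σ ^ κ / t ^ ((κ : ℝ) / 2))) := by
    calc (2 : ℝ) ^ ((n : ℝ) / 2) ≤ 2 ^ (κ : ℝ) := by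
          refine Real.rpow_le_rpow_of_exponent_le (by norm_num) ?_
          have : (n : ℝ) ≤ κ := by exact_mod_cast hnk.trans hkκ
          have : (0 : ℝ) ≤ n := Nat.cast_nonneg n
          linarith
      _ = 2 ^ κ := Real.rpow_natCast _ _
      _ ≤ (4 * (k + 8) * Real.log N) ^ κ := by
          refine pow_le_pow_left₀ (by norm_num) ?_ κ
          nlinarith
      _ = (4 * (k + 8)) ^ κ * (Real.log N ^ κ * 1) := by rw [mul_pow, mul_one]
      _ ≤ _ := by
          gcongr
          have : 0 ≤ σ ^ κ / t ^ ((κ : ℝ) / 2) := by positivity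
          linarith
  set Q := (4 * ((k : ℝ) + 8)) ^ κ * (Real.log N ^ κ * (1 + σ ^ κ / t ^ ((κ : ℝ) / 2)))
  have he : Real.exp 1 ≤ 3 := by linarith [Real.exp_one_lt_d9]
  have hKN : 0 ≤ K / N := by positivity
  have hQ : 0 ≤ Q := by positivity
  calc _ = Real.exp 1 * (K / N) * (peak n t *
        (Real.pi * (Real.log N * (2 * k * σ ^ 2 + 16 * t))) ^ ((n : ℝ) / 2)) +
        K / N * (2 * 2 ^ ((n : ℝ) / 2)) := by ring
    _ ≤ 3 * (K / N) * Q + K / N * (2 * Q) := by gcongr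
    _ = 5 * (K / N) * Q := by ring
    _ = _ := by simp only [Q]; ring

end Truncation

/-! ### Kernel estimators on a piece of the sample space -/

section Kernel

variable {Ω : Type*} [MeasurableSpace Ω] {N k : ℕ} {t : ℝ}

/-- The image under `T` of the part of `p` that lives on `S`; it has mass `p S`. -/
noncomputable def subLaw (p : Measure Ω) (S : Set Ω) (T : Ω → E k) : Measure (E k) :=
  (p.restrict S).map T

/-- The kernel estimator of the smoothed density of `subLaw p S T`. -/
noncomputable def empDensity (S : Set Ω) (T : Ω → E k) (t : ℝ) (X : Fin N → Ω) (z : E k) : ℝ :=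
  (1 / (N : ℝ)) * ∑ j, S.indicator (fun ω => gaussDensity k t (z - T ω)) (X j)

/-- The gradient of `empDensity`. -/
noncomputable def empGrad (S : Set Ω) (T : Ω → E k) (t : ℝ) (X : Fin N → Ω) (z : E k) : E k :=
  (1 / (N : ℝ)) • ∑ j, S.indicator (fun ω => kernelGrad k t (z - T ω)) (X j)

/-- The score of the smoothed law `subLaw p S T`. -/
noncomputable def subScore (q : Measure (E k)) (t : ℝ) (z : E k) : E k :=
  (1 / smoothedDensity q t z) • smoothedGrad q t z

variable {p : Measure Ω} [IsProbabilityMeasure p] {S : Set Ω} {T : Ω → E k}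

instance : IsFiniteMeasure (subLaw p S T) := by unfold subLaw; infer_instance

lemma subLaw_univ_le (hT : Measurable T) : subLaw p S T Set.univ ≤ 1 := by
  rw [subLaw, Measure.map_apply hT MeasurableSet.univ, Set.preimage_univ, Measure.restrict_apply_univ]
  exact prob_le_one

lemma subLaw_real_univ_le (hT : Measurable T) : (subLaw p S T).real Set.univ ≤ 1 :=
  ENNReal.toReal_le_of_le_ofReal (by norm_num) (by simpa using subLaw_univ_le hT)

omit [IsProbabilityMeasure p] in
lemma integral_indicator_comp {F : Type*} [NormedAddCommGroup F] [NormedSpace ℝ F]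
    (hS : MeasurableSet S) (hT : Measurable T) {f : E k → F} (hf : StronglyMeasurable f) :
    ∫ ω, S.indicator (fun ω => f (T ω)) ω ∂p = ∫ y, f y ∂(subLaw p S T) := by
  rw [integral_indicator hS, subLaw, integral_map hT.aemeasurable hf.aestronglyMeasurable]

lemma empDensity_nonneg (ht : 0 < t) (X : Fin N → Ω) (z : E k) : 0 ≤ empDensity S T t X z :=
  mul_nonneg (by positivity) (Finset.sum_nonneg fun _ _ =>
    Set.indicator_nonneg (fun _ _ => gaussDensity_nonneg ht _) _)

@[fun_prop]
lemma measurable_empDensity (hS : MeasurableSet S) (hT : Measurable T) :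
    Measurable (fun w : (Fin N → Ω) × E k => empDensity S T t w.1 w.2) := by
  unfold empDensity
  refine (Finset.measurable_sum _ fun j _ => ?_).const_mul _
  have h : Measurable ((Prod.fst ⁻¹' S).indicator
      (fun w : Ω × E k => gaussDensity k t (w.2 - T w.1))) :=
    Measurable.indicator (by fun_prop) (measurable_fst hS)
  exact h.comp (f := fun w : (Fin N → Ω) × E k => (w.1 j, w.2)) (by fun_prop)

@[fun_prop]
lemma measurable_empGrad (hS : MeasurableSet S) (hT : Measurable T) :
    Measurable (fun w : (Fin N → Ω) × E k => empGrad S T t w.1 w.2) := by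
  unfold empGrad
  suffices h : Measurable fun w : (Fin N → Ω) × E k =>
      ∑ j, S.indicator (fun ω => kernelGrad k t (w.2 - T ω)) (w.1 j) from h.const_smul (1 / (N : ℝ))
  refine Finset.measurable_sum _ fun j _ => ?_
  have h : Measurable ((Prod.fst ⁻¹' S).indicator
      (fun w : Ω × E k => kernelGrad k t (w.2 - T w.1))) :=
    Measurable.indicator (by fun_prop) (measurable_fst hS)
  exact h.comp (f := fun w : (Fin N → Ω) × E k => (w.1 j, w.2)) (by fun_prop)

lemma lintegral_sq_empDensity_sub_le (hS : MeasurableSet S) (hT : Measurable T) (ht : 0 < t)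
    (hN : 0 < N) (z : E k) :
    ∫⁻ X, ENNReal.ofReal ((empDensity S T t X z - smoothedDensity (subLaw p S T) t z) ^ 2)
      ∂(Measure.pi fun _ : Fin N => p) ≤
      ENNReal.ofReal (1 / N * (peak k t * smoothedDensity (subLaw p S T) t z)) := by
  set f : Ω → ℝ := S.indicator (fun ω => gaussDensity k t (z - T ω)) with hf
  have hfm : Measurable f := Measurable.indicator (by fun_prop) hS
  have hfb : ∀ ω, 0 ≤ f ω ∧ f ω ≤ peak k t := fun ω =>
    ⟨Set.indicator_nonneg (fun _ _ => gaussDensity_nonneg ht _) _,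
      Set.indicator_le' (fun _ _ => gaussDensity_le_peak ht _) (fun _ _ => (peak_pos ht).le) ω⟩
  have hmean : ∫ ω, f ω ∂p = smoothedDensity (subLaw p S T) t z :=
    integral_indicator_comp hS hT (f := fun y => gaussDensity k t (z - y))
      (Measurable.stronglyMeasurable (by fun_prop))
  have hint : Integrable f p := Integrable.of_bound hfm.aestronglyMeasurable (peak k t)
    (Filter.Eventually.of_forall fun ω => by rw [Real.norm_of_nonneg (hfb ω).1]; exact (hfb ω).2)
  have h := lintegral_sq_empirical_sub_le (μ := p) (N := N) hfm (C := peak k t)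
    (fun ω => by rw [abs_of_nonneg (hfb ω).1]; exact (hfb ω).2) hN
  rw [hmean] at h
  refine h.trans (ENNReal.ofReal_le_ofReal (mul_le_mul_of_nonneg_left ?_ (by positivity)))
  rw [← hmean, ← integral_const_mul]
  refine integral_mono (MemLp.of_bound hfm.aestronglyMeasurable (peak k t)
    (Filter.Eventually.of_forall fun ω => by
      rw [Real.norm_of_nonneg (hfb ω).1]; exact (hfb ω).2)).integrable_sq (hint.const_mul _)
    fun ω => ?_
  simp only [sq]
  exact mul_le_mul_of_nonneg_right (hfb ω).2 (hfb ω).1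

lemma lintegral_abs_empDensity_sub_le (hS : MeasurableSet S) (hT : Measurable T) (ht : 0 < t)
    (hN : 0 < N) (z : E k) :
    ∫⁻ X, ENNReal.ofReal |empDensity S T t X z - smoothedDensity (subLaw p S T) t z|
      ∂(Measure.pi fun _ : Fin N => p) ≤
      ENNReal.ofReal (2 * smoothedDensity (subLaw p S T) t z) := by
  set f : Ω → ℝ := S.indicator (fun ω => gaussDensity k t (z - T ω)) with hf
  have hfm : Measurable f := Measurable.indicator (by fun_prop) hS
  have hfb : ∀ ω, 0 ≤ f ω ∧ f ω ≤ peak k t := fun ω =>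
    ⟨Set.indicator_nonneg (fun _ _ => gaussDensity_nonneg ht _) _,
      Set.indicator_le' (fun _ _ => gaussDensity_le_peak ht _) (fun _ _ => (peak_pos ht).le) ω⟩
  have hmean : ∫ ω, f ω ∂p = smoothedDensity (subLaw p S T) t z :=
    integral_indicator_comp hS hT (f := fun y => gaussDensity k t (z - y))
      (Measurable.stronglyMeasurable (by fun_prop))
  have hint : Integrable f p := Integrable.of_bound hfm.aestronglyMeasurable (peak k t)
    (Filter.Eventually.of_forall fun ω => by rw [Real.norm_of_nonneg (hfb ω).1]; exact (hfb ω).2)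
  have h := lintegral_abs_empirical_sub_le (μ := p) (N := N) hfm (fun ω => (hfb ω).1) hint hN
  rw [hmean] at h
  exact h

/-- The fluctuation of the estimated gradient around the true score times the estimated density:
its summands are centred, and their variance is controlled by the posterior moment. -/
lemma lintegral_sq_empGrad_sub_le [NeZero (subLaw p S T)] (hS : MeasurableSet S)
    (hT : Measurable T) (ht : 0 < t) (hN : 0 < N) (z : E k) :
    ∫⁻ X, ENNReal.ofReal (‖empGrad S T t X z -
        empDensity S T t X z • subScore (subLaw p S T) t z‖ ^ 2)
      ∂(Measure.pi fun _ : Fin N => p) ≤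
      ENNReal.ofReal (1 / N * (peak k t * posteriorMoment (subLaw p S T) t z)) := by
  set q := subLaw p S T with hq
  set s := subScore q t z with hs
  have hG := smoothedDensity_pos q ht z
  set g : E k → E k := fun y => kernelGrad k t (z - y) - gaussDensity k t (z - y) • s with hg
  have hgm : Measurable g := by fun_prop
  set f : Ω → E k := S.indicator (fun ω => g (T ω)) with hf
  have hfm : Measurable f := Measurable.indicator (by fun_prop) hS
  obtain ⟨C, hC⟩ := exists_norm_kernelGrad_le k ht
  have hgb : ∀ y, ‖g y‖ ≤ C + peak k t * ‖s‖ := fun y => by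
    refine (norm_sub_le _ _).trans (add_le_add (hC _) ?_)
    rw [norm_smul, Real.norm_of_nonneg (gaussDensity_nonneg ht _)]
    exact mul_le_mul_of_nonneg_right (gaussDensity_le_peak ht _) (norm_nonneg _)
  have hC0 : 0 ≤ C + peak k t * ‖s‖ := (norm_nonneg _).trans (hgb 0)
  have hfb : ∀ ω, ‖f ω‖ ≤ C + peak k t * ‖s‖ := fun ω => by
    by_cases h : ω ∈ S
    · rw [hf, Set.indicator_of_mem h]; exact hgb _
    · rw [hf, Set.indicator_of_notMem h, norm_zero]; exact hC0
  have hmean : ∫ ω, f ω ∂p = 0 := by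
    rw [hf, integral_indicator_comp hS hT hgm.stronglyMeasurable, ← hq, hg,
      integral_sub (integrable_kernelGrad_sub q ht z)
        ((integrable_gaussDensity_sub q ht z).smul_const s), integral_smul_const]
    change smoothedGrad q t z - smoothedDensity q t z • s = 0
    rw [hs, subScore, smul_smul, mul_one_div_cancel hG.ne', one_smul, sub_self]
  have h := lintegral_norm_sq_empirical_sub_le (μ := p) (N := N) hfm hfb hN
  rw [hmean] at h
  have hpt : ∀ X : Fin N → Ω, empGrad S T t X z - empDensity S T t X z • s =
      (1 / (N : ℝ)) • ∑ j, f (X j) - 0 := by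
    intro X
    rw [empGrad, empDensity, mul_smul, ← smul_sub, Finset.sum_smul, ← Finset.sum_sub_distrib,
      sub_zero]
    congr 1
    refine Finset.sum_congr rfl fun j _ => ?_
    by_cases h : X j ∈ S
    · simp [hf, hg, Set.indicator_of_mem h]
    · simp [hf, Set.indicator_of_notMem h]
  simp only [hpt]
  refine h.trans (ENNReal.ofReal_le_ofReal (mul_le_mul_of_nonneg_left ?_ (by positivity)))
  have h2 : ∀ ω, ‖f ω‖ ^ 2 = S.indicator (fun ω => ‖g (T ω)‖ ^ 2) ω := by
    intro ω
    by_cases h : ω ∈ S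
    · simp [hf, Set.indicator_of_mem h]
    · simp [hf, Set.indicator_of_notMem h]
  simp only [h2]
  rw [integral_indicator_comp hS hT (f := fun y => ‖g y‖ ^ 2)
    (Measurable.stronglyMeasurable (by fun_prop)), ← hq]
  have hbv := integral_gaussDensity_mul_norm_sub_sq q ht z hG.ne'
  have h3 : ∀ y, ‖g y‖ ^ 2 = gaussDensity k t (z - y) *
      (gaussDensity k t (z - y) * ‖-((1 / t) • (z - y)) - s‖ ^ 2) := by
    intro y
    have : g y = gaussDensity k t (z - y) • (-((1 / t) • (z - y)) - s) := by
      rw [hg, smul_sub, smul_neg, smul_smul, mul_one_div]; rfl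
    rw [this, norm_smul, mul_pow, Real.norm_eq_abs, sq_abs]
    ring
  have hi : Integrable (fun y => ‖g y‖ ^ 2) q := by
    refine Integrable.of_bound (Measurable.aestronglyMeasurable (by fun_prop))
      ((C + peak k t * ‖s‖) ^ 2) (Filter.Eventually.of_forall fun y => ?_)
    rw [Real.norm_of_nonneg (by positivity)]
    exact pow_le_pow_left₀ (norm_nonneg _) (hgb y) 2
  have hi2 : Integrable (fun y => gaussDensity k t (z - y) * ‖-((1 / t) • (z - y)) - s‖ ^ 2) q := by
    refine Integrable.mono' (((integrable_gaussDensity_mul_sq q ht z).add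
      ((integrable_gaussDensity_sub q ht z).mul_const (‖s‖ ^ 2))).const_mul 2)
      (Measurable.aestronglyMeasurable (by fun_prop)) (Filter.Eventually.of_forall fun y => ?_)
    have h0 := gaussDensity_nonneg ht (z - y)
    rw [Real.norm_of_nonneg (by positivity)]
    have h4 : ‖-((1 / t) • (z - y)) - s‖ ^ 2 ≤ 2 * (‖z - y‖ ^ 2 / t ^ 2 + ‖s‖ ^ 2) := by
      have h5 := norm_sub_le (-((1 / t) • (z - y))) s
      have h6 : ‖-((1 / t) • (z - y))‖ ^ 2 = ‖z - y‖ ^ 2 / t ^ 2 := by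
        rw [norm_neg, norm_smul, mul_pow, Real.norm_eq_abs, sq_abs]; ring
      rw [← h6]
      nlinarith [sq_nonneg (‖-((1 / t) • (z - y))‖ - ‖s‖), norm_nonneg (-((1 / t) • (z - y)) - s)]
    calc _ ≤ gaussDensity k t (z - y) * (2 * (‖z - y‖ ^ 2 / t ^ 2 + ‖s‖ ^ 2)) := by gcongr
      _ = _ := by simp only [Pi.add_apply]; ring
  calc ∫ y, ‖g y‖ ^ 2 ∂q ≤ ∫ y, peak k t *
        (gaussDensity k t (z - y) * ‖-((1 / t) • (z - y)) - s‖ ^ 2) ∂q := by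
        refine integral_mono hi (hi2.const_mul _) fun y => ?_
        simp only [h3]
        exact mul_le_mul_of_nonneg_right (gaussDensity_le_peak ht _)
          (mul_nonneg (gaussDensity_nonneg ht _) (by positivity))
    _ = peak k t * (posteriorMoment q t z - ‖smoothedGrad q t z‖ ^ 2 / smoothedDensity q t z) := by
        rw [integral_const_mul]; congr 1
    _ ≤ _ := by
        refine mul_le_mul_of_nonneg_left ?_ (peak_pos ht).le
        have : 0 ≤ ‖smoothedGrad q t z‖ ^ 2 / smoothedDensity q t z := by positivity
        linarith

end Kernel

/-! ### Clipping -/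

lemma norm_clip_le {n : ℕ} {r : ℝ} (hr : 0 ≤ r) (z : E n) : ‖clip r z‖ ≤ r := by
  unfold clip
  split_ifs with h
  · exact h
  · push Not at h
    rw [norm_smul, norm_div, norm_norm, Real.norm_of_nonneg hr,
      div_mul_cancel₀ _ (hr.trans_lt h).ne']

/-- Clipping is the metric projection onto a ball, hence does not increase the distance to a point
of the ball. -/
lemma norm_clip_sub_le {n : ℕ} {r : ℝ} {z s : E n} (hs : ‖s‖ ≤ r) : ‖clip r z - s‖ ≤ ‖z - s‖ := by
  unfold clip
  split_ifs with h
  · exact le_rfl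
  · push Not at h
    have hr : 0 ≤ r := (norm_nonneg s).trans hs
    have hz : 0 < ‖z‖ := hr.trans_lt h
    set c := r / ‖z‖ with hc
    have hc1 : c < 1 := (div_lt_one hz).2 h
    have hcz : c * ‖z‖ = r := div_mul_cancel₀ _ hz.ne'
    refine abs_le_of_sq_le_sq' ?_ (norm_nonneg _) |>.2
    rw [norm_sub_sq_real, norm_sub_sq_real, norm_smul, real_inner_smul_left, Real.norm_of_nonneg
      (by positivity)]
    have hin : inner ℝ z s ≤ ‖z‖ * r :=
      (real_inner_le_norm z s).trans (mul_le_mul_of_nonneg_left hs hz.le)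
    have h1 : 0 ≤ (1 - c) * (‖z‖ * r - inner ℝ z s) := mul_nonneg (by linarith) (by linarith)
    have h2 : 0 ≤ ((1 - c) * ‖z‖) ^ 2 := sq_nonneg _
    rw [← hcz] at h1
    nlinarith

/-! ### The low-dimensional score estimator -/

section LowScore

lemma half_le_log {N : ℕ} (hN : 2 ≤ N) : 1 / 2 ≤ Real.log N := by
  have h2 : Real.log 2 ≤ Real.log N := Real.log_le_log (by norm_num) (by exact_mod_cast hN)
  linarith [Real.log_two_gt_d9]

section Deterministic

variable {d k N : ℕ} {t : ℝ} {V : Submodule ℝ (E d)} {A : E k →ₗᵢ[ℝ] E d}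

/-- The threshold of the low-dimensional density estimator is `(log N / N)` times the peak. -/
lemma threshold_level_eq (ht : 0 < t) :
    Real.log N / (N * (2 * Real.pi * t) ^ ((k : ℝ) / 2)) = Real.log N * (peak k t / N) := by
  rw [peak, Real.rpow_neg (by positivity)]
  field_simp

lemma sum_sampleIdx_eq {F : Type*} [AddCommMonoid F] (X : Fin N → E d) (f : E d → F) :
    ∑ j ∈ sampleIdx V X, f (X j) = ∑ j, (V : Set (E d)).indicator f (X j) := by
  classical
  unfold sampleIdx
  rw [Finset.sum_filter]
  refine Finset.sum_congr rfl fun j _ => ?_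
  simp [Set.indicator_apply]

lemma lowDensityEst_eq (hN : 0 < N) (X : Fin N → E d) (z : E k) :
    lowDensityEst V A t X z = (N / (sampleIdx V X).card : ℝ) * empDensity V (tr A) t X z := by
  have hN' : (N : ℝ) ≠ 0 := by positivity
  rw [lowDensityEst, sum_sampleIdx_eq X fun x => gaussDensity k t (z - tr A x), empDensity]
  field_simp

lemma gradient_lowDensityEst (hN : 0 < N) (X : Fin N → E d) (z : E k) :
    gradient (lowDensityEst V A t X) z =
      (N / (sampleIdx V X).card : ℝ) • empGrad V (tr A) t X z := by
  have hN' : (N : ℝ) ≠ 0 := by positivity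
  refine HasGradientAt.gradient ?_
  rw [hasGradientAt_iff_hasFDerivAt]
  have h : HasFDerivAt (fun z => (1 / ((sampleIdx V X).card : ℝ)) *
      ∑ j ∈ sampleIdx V X, gaussDensity k t (z - tr A (X j)))
      ((1 / ((sampleIdx V X).card : ℝ)) • ∑ j ∈ sampleIdx V X,
        InnerProductSpace.toDual ℝ (E k) (kernelGrad k t (z - tr A (X j)))) z := by
    refine HasFDerivAt.const_mul (HasFDerivAt.fun_sum fun j _ => ?_) _
    exact (hasFDerivAt_comp_sub _).2 (hasGradientAt_gaussDensity (t := t) _).hasFDerivAt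
  refine h.congr_fderiv ?_
  rw [empGrad, ← sum_sampleIdx_eq X fun x => kernelGrad k t (z - tr A x), smul_smul, map_smul,
    map_sum]
  congr 1
  field_simp

lemma norm_lowScoreEst_le (X : Fin N → E d) (z : E k) :
    ‖lowScoreEst V A t X z‖ ≤ Real.sqrt (2 * Real.log N / t) :=
  norm_clip_le (Real.sqrt_nonneg _) _

/-- Where the density `G` is above the threshold, the error of the estimated score is controlled by
the fluctuations of the estimated density and of the estimated gradient. -/
lemma norm_lowScoreEst_sub_sq_le (ht : 0 < t) (hN : 2 ≤ N) (X : Fin N → E d) (z : E k)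
    {G : ℝ} {s : E k} (hs : ‖s‖ ≤ Real.sqrt (2 * Real.log N / t))
    (hG : 2 * (Real.log N * (peak k t / N)) ≤ G) :
    ‖lowScoreEst V A t X z - s‖ ^ 2 ≤
      4 * ‖empGrad V (tr A) t X z - empDensity V (tr A) t X z • s‖ ^ 2 / G ^ 2 +
        16 * (2 * Real.log N / t) * (empDensity V (tr A) t X z - G) ^ 2 / G ^ 2 := by
  have hℓ := half_le_log hN
  have hN0 : 0 < N := by omega
  have hp := peak_pos (n := k) ht
  have hη : 0 < Real.log N * (peak k t / N) := by positivity
  have hG0 : 0 < G := by linarith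
  set r := Real.sqrt (2 * Real.log N / t) with hr
  have hr2 : r ^ 2 = 2 * Real.log N / t := Real.sq_sqrt (by positivity)
  rw [← hr2]
  set Gh := empDensity (V : Set (E d)) (tr A) t X z with hGh
  rcases le_total (G / 2) Gh with h | h
  · have hGh0 : 0 < Gh := by linarith
    have hcard : 0 < (sampleIdx V X).card := by
      rw [Finset.card_pos]
      by_contra hcon
      rw [Finset.not_nonempty_iff_eq_empty] at hcon
      have : Gh = 0 := by
        rw [hGh, empDensity, ← sum_sampleIdx_eq X fun x => gaussDensity k t (z - tr A x), hcon]
        simp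
      linarith
    have hle : ((sampleIdx V X).card : ℝ) ≤ N := by
      have := Finset.card_le_univ (sampleIdx V X)
      simpa using (by exact_mod_cast this : ((sampleIdx V X).card : ℝ) ≤ Fintype.card (Fin N))
    have hc0 : (0 : ℝ) < (sampleIdx V X).card := by exact_mod_cast hcard
    have hratio : 1 ≤ (N : ℝ) / (sampleIdx V X).card := (one_le_div hc0).2 hle
    have hest : lowScoreEst V A t X z = clip r ((1 / Gh) • empGrad V (tr A) t X z) := by
      rw [lowScoreEst, lowDensityEst_eq hN0, gradient_lowDensityEst hN0, threshold_level_eq ht,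
        ← hGh]
      have hthr : threshold (N / (sampleIdx V X).card * Gh) (Real.log N * (peak k t / N)) = 1 := by
        unfold threshold
        refine if_pos ?_
        have : Gh ≤ N / (sampleIdx V X).card * Gh := le_mul_of_one_le_left hGh0.le hratio
        linarith
      rw [hthr, smul_smul]
      congr 2
      field_simp
    rw [hest]
    have h1 : ‖clip r ((1 / Gh) • empGrad V (tr A) t X z) - s‖ ≤
        ‖empGrad V (tr A) t X z - Gh • s‖ / Gh := by
      refine (norm_clip_sub_le hs).trans (le_of_eq ?_)
      have : (1 / Gh) • empGrad V (tr A) t X z - s =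
          (1 / Gh) • (empGrad V (tr A) t X z - Gh • s) := by
        rw [smul_sub, smul_smul, one_div_mul_cancel hGh0.ne', one_smul]
      rw [this, norm_smul, Real.norm_of_nonneg (by positivity), one_div_mul_eq_div]
    have h2 : 0 ≤ 16 * r ^ 2 * (Gh - G) ^ 2 / G ^ 2 := by positivity
    calc ‖clip r ((1 / Gh) • empGrad V (tr A) t X z) - s‖ ^ 2
        ≤ (‖empGrad V (tr A) t X z - Gh • s‖ / Gh) ^ 2 :=
          pow_le_pow_left₀ (norm_nonneg _) h1 2
      _ ≤ (‖empGrad V (tr A) t X z - Gh • s‖ / (G / 2)) ^ 2 := by gcongr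
      _ = 4 * ‖empGrad V (tr A) t X z - Gh • s‖ ^ 2 / G ^ 2 := by field_simp; norm_num
      _ ≤ _ := by linarith
  · have h1 : ‖lowScoreEst V A t X z - s‖ ≤ 2 * r := by
      refine (norm_sub_le _ _).trans ?_
      linarith [norm_lowScoreEst_le (V := V) (A := A) (t := t) X z]
    have h2 : 0 ≤ 4 * ‖empGrad V (tr A) t X z - Gh • s‖ ^ 2 / G ^ 2 := by positivity
    have h3 : 1 ≤ 4 * (Gh - G) ^ 2 / G ^ 2 := by
      rw [one_le_div (by positivity)]
      nlinarith
    have h4 : 4 * r ^ 2 * 1 ≤ 4 * r ^ 2 * (4 * (Gh - G) ^ 2 / G ^ 2) :=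
      mul_le_mul_of_nonneg_left h3 (by positivity)
    calc ‖lowScoreEst V A t X z - s‖ ^ 2 ≤ (2 * r) ^ 2 := pow_le_pow_left₀ (norm_nonneg _) h1 2
      _ = 4 * r ^ 2 * 1 := by ring
      _ ≤ 4 * r ^ 2 * (4 * (Gh - G) ^ 2 / G ^ 2) := h4
      _ = 16 * r ^ 2 * (Gh - G) ^ 2 / G ^ 2 := by ring
      _ ≤ _ := by linarith

end Deterministic

variable {d k N : ℕ} {t : ℝ}

open Classical in
/-- An upper bound of the squared error of the low-dimensional score estimator: the bound by the
fluctuations where the density is above the threshold, capped everywhere by the bound that follows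
from the clipping. It stands in for the error itself because it is visibly jointly measurable. -/
noncomputable def lowErrBound (q : Measure (E k)) (S : Set (E d)) (T : E d → E k) (t : ℝ)
    (X : Fin N → E d) (z : E k) : ℝ :=
  min (4 * Real.log N / t + 2 * ‖subScore q t z‖ ^ 2)
    (if 2 * (Real.log N * (peak k t / N)) ≤ smoothedDensity q t z then
      4 * ‖empGrad S T t X z - empDensity S T t X z • subScore q t z‖ ^ 2 /
          smoothedDensity q t z ^ 2 +
        16 * (2 * Real.log N / t) * (empDensity S T t X z - smoothedDensity q t z) ^ 2 /
          smoothedDensity q t z ^ 2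
    else 4 * Real.log N / t + 2 * ‖subScore q t z‖ ^ 2)

lemma measurable_subScore (q : Measure (E k)) [IsFiniteMeasure q] :
    Measurable (subScore q t) := by
  unfold subScore
  exact (Measurable.const_div (measurable_smoothedDensity q) 1).smul (measurable_smoothedGrad q)

lemma measurable_lowErrBound (q : Measure (E k)) [IsFiniteMeasure q] {S : Set (E d)}
    {T : E d → E k} (hS : MeasurableSet S) (hT : Measurable T) :
    Measurable (fun w : (Fin N → E d) × E k => lowErrBound q S T t w.1 w.2) := by
  unfold lowErrBound
  have h1 := measurable_empDensity (N := N) (t := t) hS hT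
  have h2 := measurable_empGrad (N := N) (t := t) hS hT
  have h3 : Measurable fun w : (Fin N → E d) × E k => smoothedDensity q t w.2 :=
    (measurable_smoothedDensity q).comp measurable_snd
  have h4 : Measurable fun w : (Fin N → E d) × E k => subScore q t w.2 :=
    (measurable_subScore q).comp measurable_snd
  have h5 : Measurable fun w : (Fin N → E d) × E k =>
      4 * Real.log N / t + 2 * ‖subScore q t w.2‖ ^ 2 := by fun_prop
  refine h5.min (Measurable.ite (measurableSet_le measurable_const h3) ?_ h5)
  fun_prop

section Bounds

variable (q : Measure (E k)) [IsFiniteMeasure q] [NeZero q]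

lemma smoothedDensity_mul_norm_subScore_sq_le (ht : 0 < t) (z : E k) :
    smoothedDensity q t z * ‖subScore q t z‖ ^ 2 ≤ posteriorMoment q t z := by
  have hG := smoothedDensity_pos q ht z
  have h := norm_smoothedGrad_sq_le q ht z
  rw [subScore, norm_smul, mul_pow, Real.norm_eq_abs, sq_abs]
  have : smoothedDensity q t z * ((1 / smoothedDensity q t z) ^ 2 * ‖smoothedGrad q t z‖ ^ 2) =
      ‖smoothedGrad q t z‖ ^ 2 / smoothedDensity q t z := by field_simp
  rw [this, div_le_iff₀ hG, mul_comm]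
  exact h

/-- Above the threshold the score is bounded by the clipping radius. -/
lemma posteriorMoment_le_of_threshold_le (ht : 0 < t) (hq : q.real Set.univ ≤ 1) (hN : 2 ≤ N)
    {z : E k} (hz : 2 * (Real.log N * (peak k t / N)) ≤ smoothedDensity q t z) :
    posteriorMoment q t z ≤ 2 * Real.log N / t * smoothedDensity q t z := by
  have hG := smoothedDensity_pos q ht z
  have hp := peak_pos (n := k) ht
  have hℓ := half_le_log hN
  have hN0 : (0 : ℝ) < N := by positivity
  refine (posteriorMoment_le_log q ht hq z).trans ?_
  have h1 : Real.log (peak k t / smoothedDensity q t z) ≤ Real.log N := by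
    refine Real.log_le_log (by positivity) ?_
    rw [div_le_iff₀ hG]
    have : peak k t / N ≤ smoothedDensity q t z := by
      have : 1 * (peak k t / N) ≤ 2 * Real.log N * (peak k t / N) :=
        mul_le_mul_of_nonneg_right (by linarith) (by positivity)
      linarith
    rw [div_le_iff₀ hN0] at this
    linarith
  calc 2 / t * (smoothedDensity q t z * Real.log (peak k t / smoothedDensity q t z)) ≤
      2 / t * (smoothedDensity q t z * Real.log N) := by gcongr
    _ = _ := by ring

lemma norm_subScore_le_of_threshold_le (ht : 0 < t) (hq : q.real Set.univ ≤ 1) (hN : 2 ≤ N)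
    {z : E k} (hz : 2 * (Real.log N * (peak k t / N)) ≤ smoothedDensity q t z) :
    ‖subScore q t z‖ ≤ Real.sqrt (2 * Real.log N / t) := by
  have hG := smoothedDensity_pos q ht z
  refine Real.le_sqrt_of_sq_le ?_
  have h := (smoothedDensity_mul_norm_subScore_sq_le q ht z).trans
    (posteriorMoment_le_of_threshold_le q ht hq hN hz)
  rw [mul_comm (2 * Real.log N / t)] at h
  exact le_of_mul_le_mul_left h hG

/-- Below the threshold the posterior moment is of the order of the threshold, up to logarithms. -/
lemma posteriorMoment_le_of_le_threshold (ht : 0 < t) (hq : q.real Set.univ ≤ 1) (hN : 2 ≤ N)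
    {z : E k} (hz : smoothedDensity q t z ≤ 2 * (Real.log N * (peak k t / N))) :
    posteriorMoment q t z ≤ 12 * Real.log N ^ 2 / t * (peak k t / N) := by
  have hG := smoothedDensity_pos q ht z
  have hp := peak_pos (n := k) ht
  have hℓ := half_le_log hN
  have hN0 : (0 : ℝ) < N := by positivity
  refine (posteriorMoment_le_log q ht hq z).trans ?_
  set G := smoothedDensity q t z
  have h1 : Real.log (peak k t / G) = Real.log N + Real.log (peak k t / N / G) := by
    rw [← Real.log_mul (by positivity) (by positivity)]
    congr 1; field_simp
  have h2 : G * Real.log (peak k t / N / G) ≤ G * (peak k t / N / G - 1) :=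
    mul_le_mul_of_nonneg_left (Real.log_le_sub_one_of_pos (by positivity)) hG.le
  have h3 : G * (peak k t / N / G - 1) = peak k t / N - G := by field_simp
  have h4 : G * Real.log N ≤ 2 * (Real.log N * (peak k t / N)) * Real.log N := by gcongr
  have h5 : 0 < peak k t / N := by positivity
  have h6 : 1 * (peak k t / N) ≤ (4 * Real.log N ^ 2) * (peak k t / N) :=
    mul_le_mul_of_nonneg_right (by nlinarith) h5.le
  calc 2 / t * (G * Real.log (peak k t / G)) ≤
      2 / t * (6 * Real.log N ^ 2 * (peak k t / N)) := by
        refine mul_le_mul_of_nonneg_left ?_ (by positivity)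
        rw [h1]; nlinarith
    _ = _ := by ring

end Bounds

/-- The constant in the two bounds for the low-dimensional error. -/
noncomputable def lowErrConst (k N : ℕ) (t : ℝ) : ℝ :=
  80 * 2 ^ ((k : ℝ) / 2) * (Real.log N ^ 2 / t)

/-- The first of the two bounds for the low-dimensional error that the truncation needs. Passing to
time `2 * t` absorbs the factor `‖z - y‖ ^ 2 / t` in the posterior moment. -/
lemma mul_lintegral_lowErrBound_le_density {p : Measure (E d)} [IsProbabilityMeasure p]
    {S : Set (E d)} {T : E d → E k} [NeZero (subLaw p S T)]
    (ht : 0 < t) (hN : 2 ≤ N) (z : E k) :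
    ENNReal.ofReal (smoothedDensity (subLaw p S T) t z) *
      ∫⁻ X, ENNReal.ofReal (lowErrBound (subLaw p S T) S T t X z)
        ∂(Measure.pi fun _ : Fin N => p) ≤
      ENNReal.ofReal (lowErrConst k N t * smoothedDensity (subLaw p S T) (2 * t) z) := by
  set q := subLaw p S T
  have hG := smoothedDensity_pos q ht z
  have hℓ := half_le_log hN
  have h1 : ∫⁻ X, ENNReal.ofReal (lowErrBound q S T t X z) ∂(Measure.pi fun _ : Fin N => p) ≤
      ENNReal.ofReal (4 * Real.log N / t + 2 * ‖subScore q t z‖ ^ 2) := by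
    refine (lintegral_mono (g := fun _ => _) fun X =>
      ENNReal.ofReal_le_ofReal (min_le_left _ _)).trans ?_
    rw [lintegral_const, measure_univ, mul_one]
  refine (mul_le_mul_right h1 _).trans ?_
  rw [← ENNReal.ofReal_mul hG.le]
  refine ENNReal.ofReal_le_ofReal ?_
  have h2 := smoothedDensity_mul_norm_subScore_sq_le q ht z
  have h3 := posteriorMoment_le_two_mul q ht z
  have h4 := smoothedDensity_le_two_mul q ht z
  have h5 := smoothedDensity_pos q (t := 2 * t) (by positivity) z
  rw [lowErrConst]
  set G2 := smoothedDensity q (2 * t) z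
  set P := (2 : ℝ) ^ ((k : ℝ) / 2)
  have hP : 0 < P := by positivity
  calc smoothedDensity q t z * (4 * Real.log N / t + 2 * ‖subScore q t z‖ ^ 2)
      = 4 * Real.log N / t * smoothedDensity q t z +
        2 * (smoothedDensity q t z * ‖subScore q t z‖ ^ 2) := by ring
    _ ≤ 4 * Real.log N / t * (P * G2) + 2 * (4 * P / t * G2) :=
        add_le_add (mul_le_mul_of_nonneg_left h4 (by positivity))
          (mul_le_mul_of_nonneg_left (h2.trans h3) (by norm_num))
    _ = (4 * Real.log N + 8) * (P * G2 / t) := by ring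
    _ ≤ (80 * Real.log N ^ 2) * (P * G2 / t) := by gcongr; nlinarith
    _ = _ := by ring

/-- The second of the two bounds: the variance bounds above the threshold, and the smallness of the
density and of its posterior moment below it. -/
lemma mul_lintegral_lowErrBound_le_peak {p : Measure (E d)} [IsProbabilityMeasure p]
    {S : Set (E d)} {T : E d → E k} [NeZero (subLaw p S T)] (hS : MeasurableSet S)
    (hT : Measurable T) (ht : 0 < t) (hN : 2 ≤ N) (z : E k) :
    ENNReal.ofReal (smoothedDensity (subLaw p S T) t z) *
      ∫⁻ X, ENNReal.ofReal (lowErrBound (subLaw p S T) S T t X z)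
        ∂(Measure.pi fun _ : Fin N => p) ≤
      ENNReal.ofReal (lowErrConst k N t * (peak k t / N)) := by
  have hN0 : 0 < N := by omega
  have hE1 := lintegral_sq_empDensity_sub_le (p := p) hS hT ht hN0 z
  have hE2 := lintegral_sq_empGrad_sub_le (p := p) hS hT ht hN0 z
  have hq := subLaw_real_univ_le (p := p) (S := S) hT
  have hm1 : Measurable fun X : Fin N → E d => empDensity S T t X z :=
    (measurable_empDensity (N := N) (t := t) hS hT).comp (f := fun X => (X, z)) (by fun_prop)
  have hm2 : Measurable fun X : Fin N → E d => empGrad S T t X z :=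
    (measurable_empGrad (N := N) (t := t) hS hT).comp (f := fun X => (X, z)) (by fun_prop)
  set q := subLaw p S T
  have hG := smoothedDensity_pos q ht z
  have hℓ := half_le_log hN
  have hp := peak_pos (n := k) ht
  have hP : (1 : ℝ) ≤ 2 ^ ((k : ℝ) / 2) := Real.one_le_rpow (by norm_num) (by positivity)
  have hN1 : (0 : ℝ) < N := by positivity
  have hconst : 80 * (Real.log N ^ 2 / t) * (peak k t / N) ≤ lowErrConst k N t * (peak k t / N) := by
    rw [lowErrConst]
    gcongr
    linarith
  by_cases hz : 2 * (Real.log N * (peak k t / N)) ≤ smoothedDensity q t z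
  · set G := smoothedDensity q t z with hGdef
    have hJ := posteriorMoment_le_of_threshold_le q ht hq hN hz
    rw [← hGdef] at hJ
    have h1 : ∀ X : Fin N → E d, ENNReal.ofReal (lowErrBound q S T t X z) ≤
        ENNReal.ofReal (4 / G ^ 2) *
          ENNReal.ofReal (‖empGrad S T t X z - empDensity S T t X z • subScore q t z‖ ^ 2) +
        ENNReal.ofReal (16 * (2 * Real.log N / t) / G ^ 2) *
          ENNReal.ofReal ((empDensity S T t X z - G) ^ 2) := by
      intro X
      rw [← ENNReal.ofReal_mul (by positivity), ← ENNReal.ofReal_mul (by positivity),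
        ← ENNReal.ofReal_add (by positivity) (by positivity)]
      refine ENNReal.ofReal_le_ofReal ((min_le_right _ _).trans ?_)
      rw [if_pos hz]
      refine le_of_eq ?_
      ring
    have h2 : ∫⁻ X, ENNReal.ofReal (lowErrBound q S T t X z) ∂(Measure.pi fun _ : Fin N => p) ≤
        ENNReal.ofReal (4 / G ^ 2 * (1 / N * (peak k t * posteriorMoment q t z)) +
          16 * (2 * Real.log N / t) / G ^ 2 * (1 / N * (peak k t * G))) := by
      have hJ0 := posteriorMoment_nonneg q ht z
      refine (lintegral_mono h1).trans ?_
      rw [lintegral_add_left (by fun_prop), lintegral_const_mul _ (by fun_prop),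
        lintegral_const_mul _ (by fun_prop), ENNReal.ofReal_add (by positivity) (by positivity),
        ENNReal.ofReal_mul (p := 4 / G ^ 2) (by positivity),
        ENNReal.ofReal_mul (p := 16 * (2 * Real.log N / t) / G ^ 2) (by positivity)]
      exact add_le_add (mul_le_mul_right hE2 _) (mul_le_mul_right hE1 _)
    refine (mul_le_mul_right h2 _).trans ?_
    rw [← ENNReal.ofReal_mul hG.le]
    refine ENNReal.ofReal_le_ofReal (le_trans ?_ hconst)
    calc G * (4 / G ^ 2 * (1 / N * (peak k t * posteriorMoment q t z)) +
          16 * (2 * Real.log N / t) / G ^ 2 * (1 / N * (peak k t * G)))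
        ≤ G * (4 / G ^ 2 * (1 / N * (peak k t * (2 * Real.log N / t * G))) +
          16 * (2 * Real.log N / t) / G ^ 2 * (1 / N * (peak k t * G))) := by gcongr
      _ = 40 * Real.log N * (peak k t / N / t) := by field_simp; ring
      _ ≤ 80 * Real.log N ^ 2 * (peak k t / N / t) :=
          mul_le_mul_of_nonneg_right (by nlinarith) (by positivity)
      _ = _ := by ring
  · push Not at hz
    have hJ := posteriorMoment_le_of_le_threshold q ht hq hN hz.le
    have hs := smoothedDensity_mul_norm_subScore_sq_le q ht z
    set G := smoothedDensity q t z with hGdef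
    have h1 : ∫⁻ X, ENNReal.ofReal (lowErrBound q S T t X z) ∂(Measure.pi fun _ : Fin N => p) ≤
        ENNReal.ofReal (4 * Real.log N / t + 2 * ‖subScore q t z‖ ^ 2) := by
      refine (lintegral_mono (g := fun _ => _) fun X =>
        ENNReal.ofReal_le_ofReal (min_le_left _ _)).trans ?_
      rw [lintegral_const, measure_univ, mul_one]
    refine (mul_le_mul_right h1 _).trans ?_
    rw [← ENNReal.ofReal_mul hG.le]
    refine ENNReal.ofReal_le_ofReal (le_trans ?_ hconst)
    calc G * (4 * Real.log N / t + 2 * ‖subScore q t z‖ ^ 2)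
        = 4 * Real.log N / t * G + 2 * (G * ‖subScore q t z‖ ^ 2) := by ring
      _ ≤ 4 * Real.log N / t * (2 * (Real.log N * (peak k t / N))) +
          2 * (12 * Real.log N ^ 2 / t * (peak k t / N)) :=
          add_le_add (mul_le_mul_of_nonneg_left hz.le (by positivity))
            (mul_le_mul_of_nonneg_left (hs.trans hJ) (by norm_num))
      _ = 32 * (Real.log N ^ 2 / t) * (peak k t / N) := by ring
      _ ≤ _ := by gcongr; norm_num

/-- The squared error of the low-dimensional score estimator is below `lowErrBound`. -/
lemma norm_lowScoreEst_sub_subScore_sq_le {V : Submodule ℝ (E d)} {A : E k →ₗᵢ[ℝ] E d}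
    (q : Measure (E k)) [IsFiniteMeasure q] [NeZero q] (ht : 0 < t) (hq : q.real Set.univ ≤ 1)
    (hN : 2 ≤ N) (X : Fin N → E d) (z : E k) :
    ‖lowScoreEst V A t X z - subScore q t z‖ ^ 2 ≤ lowErrBound q V (tr A) t X z := by
  have hcrude : ‖lowScoreEst V A t X z - subScore q t z‖ ^ 2 ≤
      4 * Real.log N / t + 2 * ‖subScore q t z‖ ^ 2 := by
    have hℓ := half_le_log hN
    have h1 := norm_lowScoreEst_le (V := V) (A := A) (t := t) X z
    have h2 := norm_sub_le (lowScoreEst V A t X z) (subScore q t z)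
    have h3 : ‖lowScoreEst V A t X z‖ ^ 2 ≤ 2 * Real.log N / t := by
      rw [← Real.sq_sqrt (show 0 ≤ 2 * Real.log N / t by positivity)]
      exact pow_le_pow_left₀ (norm_nonneg _) h1 2
    have h4 : 4 * Real.log N / t = 2 * (2 * Real.log N / t) := by ring
    rw [h4]
    nlinarith [sq_nonneg (‖lowScoreEst V A t X z‖ - ‖subScore q t z‖),
      norm_nonneg (lowScoreEst V A t X z - subScore q t z)]
  refine le_min hcrude ?_
  split_ifs with h
  · exact norm_lowScoreEst_sub_sq_le ht hN X z (norm_subScore_le_of_threshold_le q ht hq hN h) h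
  · exact hcrude

end LowScore

/-! ### Splitting along a subspace -/

section Splitting

variable {d k N : ℕ} {t : ℝ} (A : E k →ₗᵢ[ℝ] E d)

lemma tr_apply_self (z : E k) : tr A (A z) = z := by
  refine ext_inner_right ℝ fun w => ?_
  rw [ContinuousLinearMap.adjoint_inner_left]
  exact A.inner_map_map z w

lemma inner_sub_proj_apply (x : E d) (z : E k) : inner ℝ (x - proj A x) (A z) = (0 : ℝ) := by
  rw [inner_sub_left, proj, A.inner_map_map, ContinuousLinearMap.adjoint_inner_left]
  exact sub_self _

lemma norm_sub_proj_add_sq (x : E d) (z : E k) :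
    ‖(x - proj A x) + A z‖ ^ 2 = ‖x - proj A x‖ ^ 2 + ‖z‖ ^ 2 := by
  rw [norm_add_sq_real, inner_sub_proj_apply, A.norm_map]; ring

lemma norm_sub_proj_sq_add (x : E d) : ‖x - proj A x‖ ^ 2 + ‖tr A x‖ ^ 2 = ‖x‖ ^ 2 := by
  rw [← norm_sub_proj_add_sq, proj, sub_add_cancel]

lemma norm_sub_proj_le (x : E d) : ‖x - proj A x‖ ≤ ‖x‖ := by
  refine abs_le_of_sq_le_sq' ?_ (norm_nonneg _) |>.2
  have := norm_sub_proj_sq_add A x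
  nlinarith [sq_nonneg ‖tr A x‖]

lemma proj_of_mem_range {y : E d} (hy : y ∈ Set.range A) : proj A y = y := by
  obtain ⟨z, rfl⟩ := hy
  rw [proj, tr_apply_self]

lemma sub_eq_of_mem_range (x : E d) {y : E d} (hy : y ∈ Set.range A) :
    x - y = (x - proj A x) + A (tr A x - tr A y) := by
  have := proj_of_mem_range A hy
  rw [map_sub]
  change x - y = x - proj A x + (proj A x - proj A y)
  rw [this]; abel

@[fun_prop]
lemma measurable_proj : Measurable (proj A) := by
  unfold proj
  exact A.continuous.measurable.comp (tr A).continuous.measurable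

/-- The density of the noise in the directions orthogonal to the range of `A`. -/
noncomputable def normalFactor (t : ℝ) (x : E d) : ℝ :=
  (2 * Real.pi * t) ^ (-(((d : ℝ) - k) / 2)) * Real.exp (-‖x - proj A x‖ ^ 2 / (2 * t))

lemma normalFactor_pos (ht : 0 < t) (x : E d) : 0 < normalFactor A t x := by
  unfold normalFactor; positivity

lemma gaussDensity_sub_of_mem_range (ht : 0 < t) (x : E d) {y : E d} (hy : y ∈ Set.range A) :
    gaussDensity d t (x - y) = normalFactor A t x * gaussDensity k t (tr A x - tr A y) := by
  have h : ‖x - y‖ ^ 2 = ‖x - proj A x‖ ^ 2 + ‖tr A x - tr A y‖ ^ 2 := by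
    rw [← norm_sub_proj_add_sq, ← sub_eq_of_mem_range A x hy]
  rw [gaussDensity, gaussDensity, normalFactor, h]
  have h1 : (2 * Real.pi * t) ^ (-((d : ℝ) / 2)) =
      (2 * Real.pi * t) ^ (-(((d : ℝ) - k) / 2)) * (2 * Real.pi * t) ^ (-((k : ℝ) / 2)) := by
    rw [← Real.rpow_add (by positivity)]; congr 1; ring
  have h2 : Real.exp (-(‖x - proj A x‖ ^ 2 + ‖tr A x - tr A y‖ ^ 2) / (2 * t)) =
      Real.exp (-‖x - proj A x‖ ^ 2 / (2 * t)) * Real.exp (-‖tr A x - tr A y‖ ^ 2 / (2 * t)) := by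
    rw [← Real.exp_add]; congr 1; ring
  rw [h1, h2]; ring

lemma kernelGrad_sub_of_mem_range (ht : 0 < t) (x : E d) {y : E d} (hy : y ∈ Set.range A) :
    kernelGrad d t (x - y) = gaussDensity d t (x - y) • (-((1 / t) • (x - proj A x))) +
      normalFactor A t x • A (kernelGrad k t (tr A x - tr A y)) := by
  rw [kernelGrad, gaussDensity_sub_of_mem_range A ht x hy]
  rw [sub_eq_of_mem_range A x hy]
  rw [kernelGrad, map_neg, map_smul, smul_add, smul_neg, smul_neg, smul_smul, smul_smul, neg_add]
  congr 3
  · ring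
  · ring

/-- The score of the part of the smoothed law that comes from the range of `A`; `q` is the law in the
coordinates of the subspace. -/
noncomputable def componentScore (q : Measure (E k)) (t : ℝ) (x : E d) : E d :=
  -((1 / t) • (x - proj A x)) + A (subScore q t (tr A x))

variable (p : Measure (E d)) [IsProbabilityMeasure p]

lemma measurableSet_range : MeasurableSet (Set.range A) := by
  have h : Set.range A = ((LinearMap.range A.toLinearMap : Submodule ℝ (E d)) : Set (E d)) := by
    ext; simp
  rw [h]
  exact (Submodule.closed_of_finiteDimensional _).measurableSet

lemma smoothedDensity_restrict_range (ht : 0 < t) (x : E d) :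
    smoothedDensity (p.restrict (Set.range A)) t x =
      normalFactor A t x * smoothedDensity (subLaw p (Set.range A) (tr A)) t (tr A x) := by
  rw [smoothedDensity, setIntegral_congr_fun (measurableSet_range A)
    (fun y hy => gaussDensity_sub_of_mem_range A ht x hy), integral_const_mul, smoothedDensity,
    subLaw, integral_map (by fun_prop) (by fun_prop)]

lemma smoothedGrad_restrict_range (ht : 0 < t) (x : E d)
    [NeZero (subLaw p (Set.range A) (tr A))] :
    smoothedGrad (p.restrict (Set.range A)) t x =
      smoothedDensity (p.restrict (Set.range A)) t x •
        componentScore A (subLaw p (Set.range A) (tr A)) t x := by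
  have hG := smoothedDensity_pos (subLaw p (Set.range A) (tr A)) ht (tr A x)
  have hi2 : Integrable (fun y => kernelGrad k t (tr A x - tr A y)) (p.restrict (Set.range A)) := by
    obtain ⟨C, hC⟩ := exists_norm_kernelGrad_le k ht
    exact Integrable.of_bound (by fun_prop) C (Filter.Eventually.of_forall fun y => hC _)
  have hi3 : Integrable (fun y => normalFactor A t x • A (kernelGrad k t (tr A x - tr A y)))
      (p.restrict (Set.range A)) :=
    (A.toContinuousLinearMap.integrable_comp hi2).smul (normalFactor A t x)
  rw [smoothedGrad, setIntegral_congr_fun (measurableSet_range A)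
    (fun y hy => kernelGrad_sub_of_mem_range A ht x hy),
    integral_add ((integrable_gaussDensity_sub _ ht x).smul_const _) hi3, integral_smul_const,
    integral_smul]
  have h1 : ∫ y, A (kernelGrad k t (tr A x - tr A y)) ∂(p.restrict (Set.range A)) =
      A (smoothedGrad (subLaw p (Set.range A) (tr A)) t (tr A x)) := by
    rw [smoothedGrad, subLaw, integral_map (by fun_prop) (by fun_prop)]
    exact A.toContinuousLinearMap.integral_comp_comm hi2
  rw [h1, componentScore, smul_add]
  congr 1
  rw [smoothedDensity_restrict_range A p ht x, subScore, map_smul, smul_smul, mul_assoc,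
    mul_one_div_cancel hG.ne', mul_one]

lemma sum_indicator_gaussDensity_eq (ht : 0 < t) (X : Fin N → E d) (x : E d) :
    (1 / (N : ℝ)) * ∑ j, (Set.range A).indicator (fun y => gaussDensity d t (x - y)) (X j) =
      normalFactor A t x * empDensity (Set.range A) (tr A) t X (tr A x) := by
  rw [empDensity, mul_left_comm, Finset.mul_sum (f := fun j => (Set.range A).indicator
    (fun ω => gaussDensity k t (tr A x - tr A ω)) (X j))]
  refine congrArg ((1 / (N : ℝ)) * ·) (Finset.sum_congr rfl fun j _ => ?_)
  by_cases h : X j ∈ Set.range A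
  · rw [Set.indicator_of_mem h, Set.indicator_of_mem h, gaussDensity_sub_of_mem_range A ht x h]
  · rw [Set.indicator_of_notMem h, Set.indicator_of_notMem h, mul_zero]

/-- The coordinates along the subspace of a sample from the smoothed law have the smoothed law in
`k` dimensions. -/
lemma lintegral_smoothedLaw_comp_tr (ht : 0 < t) {h : E k → ℝ≥0∞} (hh : Measurable h) :
    ∫⁻ x, h (tr A x) ∂(smoothedLaw (p.restrict (Set.range A)) t) =
      ∫⁻ z, ENNReal.ofReal (smoothedDensity (subLaw p (Set.range A) (tr A)) t z) * h z := by
  rw [← lintegral_smoothedLaw_eq_volume _ ht hh, ← lintegral_map hh (by fun_prop)]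
  congr 1
  rw [smoothedLaw, Measure.map_conv_continuousLinearMap, map_tr_noise A ht]
  rfl

lemma componentScoreEst_sub_componentScore (V : Submodule ℝ (E d)) (q : Measure (E k))
    (X : Fin N → E d) (x : E d) :
    ‖componentScoreEst V A t X x - componentScore A q t x‖ =
      ‖lowScoreEst V A t X (tr A x) - subScore q t (tr A x)‖ := by
  rw [componentScoreEst, componentScore, add_sub_add_left_eq_sub, ← map_sub, A.norm_map]

lemma norm_componentScoreEst_sq_le (V : Submodule ℝ (E d)) (ht : 0 < t) (hN : 2 ≤ N)
    (X : Fin N → E d) (x : E d) :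
    ‖componentScoreEst V A t X x‖ ^ 2 ≤ ‖x - proj A x‖ ^ 2 / t ^ 2 + 2 * Real.log N / t := by
  have h0 := half_le_log hN
  have h1 : ‖componentScoreEst V A t X x‖ ^ 2 = ‖x - proj A x‖ ^ 2 / t ^ 2 +
      ‖lowScoreEst V A t X (tr A x)‖ ^ 2 := by
    rw [componentScoreEst, norm_add_sq_real, inner_neg_left, real_inner_smul_left,
      inner_sub_proj_apply, A.norm_map, norm_neg, norm_smul, mul_pow, Real.norm_eq_abs, sq_abs]
    ring
  rw [h1]
  have h2 := norm_lowScoreEst_le (V := V) (A := A) (t := t) X (tr A x)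
  have h3 : ‖lowScoreEst V A t X (tr A x)‖ ^ 2 ≤ 2 * Real.log N / t := by
    rw [← Real.sq_sqrt (show 0 ≤ 2 * Real.log N / t by positivity)]
    exact pow_le_pow_left₀ (norm_nonneg _) h2 2
  linarith

end Splitting

/-! ### Perturbation of weights -/

section Weights

variable {ι : Type*} [Fintype ι]

/-- Normalised weights depend on the unnormalised ones in a Lipschitz way, relative to one of the
two normalising constants. -/
lemma sum_abs_div_sub_div_sq_le {a b : ι → ℝ} (ha : ∀ i, 0 ≤ a i) (hb : ∀ i, 0 ≤ b i)
    (hA : 0 < ∑ i, a i) (hB : 0 < ∑ i, b i) :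
    (∑ i, |a i / ∑ j, a j - b i / ∑ j, b j|) ^ 2 ≤
      4 * Fintype.card ι * ∑ i, min 1 (|a i - b i| / ∑ j, b j) ^ 2 := by
  set P := ∑ j, a j with hP
  set Q := ∑ j, b j with hQ
  have hm0 : ∀ i, 0 ≤ min 1 (|a i - b i| / Q) := fun i => le_min zero_le_one (by positivity)
  have h2 : ∑ i, |a i / P - b i / Q| ≤ 2 := by
    calc ∑ i, |a i / P - b i / Q| ≤ ∑ i, (a i / P + b i / Q) := by
          refine Finset.sum_le_sum fun i _ => ?_
          have h1 : 0 ≤ a i / P := div_nonneg (ha i) hA.le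
          have h2 : 0 ≤ b i / Q := div_nonneg (hb i) hB.le
          rw [abs_le]; constructor <;> linarith
      _ = 2 := by
          rw [Finset.sum_add_distrib, ← Finset.sum_div, ← Finset.sum_div, ← hP, ← hQ,
            div_self hA.ne', div_self hB.ne']; norm_num
  have h3 : ∑ i, |a i / P - b i / Q| ≤ 2 * ∑ i, |a i - b i| / Q := by
    have hPQ : |Q - P| ≤ ∑ i, |a i - b i| := by
      rw [hP, hQ, ← Finset.sum_sub_distrib]
      refine (Finset.abs_sum_le_sum_abs _ _).trans (le_of_eq ?_)
      exact Finset.sum_congr rfl fun i _ => abs_sub_comm _ _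
    calc ∑ i, |a i / P - b i / Q| ≤ ∑ i, (|a i - b i| / Q + a i * (|Q - P| / (P * Q))) := by
          refine Finset.sum_le_sum fun i _ => ?_
          have : a i / P - b i / Q = (a i - b i) / Q + a i * ((Q - P) / (P * Q)) := by
            field_simp; ring
          rw [this]
          refine (abs_add_le _ _).trans (le_of_eq ?_)
          rw [abs_div, abs_of_pos hB, abs_mul, abs_of_nonneg (ha i), abs_div,
            abs_of_pos (mul_pos hA hB)]
      _ = ∑ i, |a i - b i| / Q + |Q - P| / Q := by
          rw [Finset.sum_add_distrib, ← Finset.sum_mul, ← hP]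
          congr 1; field_simp
      _ ≤ ∑ i, |a i - b i| / Q + (∑ i, |a i - b i|) / Q := by gcongr
      _ = _ := by rw [← Finset.sum_div]; ring
  -- if one relative error exceeds the cap, the trivial bound `2` suffices
  have h4 : ∑ i, |a i / P - b i / Q| ≤ 2 * ∑ i, min 1 (|a i - b i| / Q) := by
    by_cases h : ∃ i, 1 ≤ |a i - b i| / Q
    · obtain ⟨i, hi⟩ := h
      have : 1 ≤ ∑ i, min 1 (|a i - b i| / Q) := by
        refine le_trans (le_of_eq (min_eq_left hi).symm)
          (Finset.single_le_sum (f := fun i => min 1 (|a i - b i| / Q)) (fun i _ => hm0 i)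
            (Finset.mem_univ i))
      linarith
    · push Not at h
      refine h3.trans (le_of_eq ?_)
      congr 1
      exact Finset.sum_congr rfl fun i _ => (min_eq_right (h i).le).symm
  have h5 : (∑ i, min 1 (|a i - b i| / Q)) ^ 2 ≤
      Fintype.card ι * ∑ i, min 1 (|a i - b i| / Q) ^ 2 := by
    have := sq_sum_le_card_mul_sum_sq (s := (Finset.univ : Finset ι))
      (f := fun i => min 1 (|a i - b i| / Q))
    simpa using this
  calc (∑ i, |a i / P - b i / Q|) ^ 2 ≤ (2 * ∑ i, min 1 (|a i - b i| / Q)) ^ 2 :=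
        pow_le_pow_left₀ (Finset.sum_nonneg fun i _ => abs_nonneg _) h4 2
    _ = 4 * (∑ i, min 1 (|a i - b i| / Q)) ^ 2 := by ring
    _ ≤ 4 * (Fintype.card ι * ∑ i, min 1 (|a i - b i| / Q) ^ 2) := by gcongr
    _ = _ := by ring

variable {F : Type*} [NormedAddCommGroup F] [InnerProductSpace ℝ F]

lemma norm_sum_smul_sq_le {w : ι → ℝ} (hw : ∀ i, 0 ≤ w i) (hw1 : ∑ i, w i ≤ 1) (v : ι → F) :
    ‖∑ i, w i • v i‖ ^ 2 ≤ ∑ i, w i * ‖v i‖ ^ 2 := by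
  have h1 : ‖∑ i, w i • v i‖ ≤ ∑ i, w i * ‖v i‖ := by
    refine (norm_sum_le _ _).trans (le_of_eq (Finset.sum_congr rfl fun i _ => ?_))
    rw [norm_smul, Real.norm_of_nonneg (hw i)]
  have h2 : (∑ i, w i * ‖v i‖) ^ 2 ≤ (∑ i, w i) * ∑ i, w i * ‖v i‖ ^ 2 :=
    Finset.sum_sq_le_sum_mul_sum_of_sq_le_mul _ (fun i _ => hw i)
      (fun i _ => mul_nonneg (hw i) (by positivity)) (fun i _ => le_of_eq (by ring))
  calc ‖∑ i, w i • v i‖ ^ 2 ≤ (∑ i, w i * ‖v i‖) ^ 2 := pow_le_pow_left₀ (norm_nonneg _) h1 2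
    _ ≤ (∑ i, w i) * ∑ i, w i * ‖v i‖ ^ 2 := h2
    _ ≤ _ := mul_le_of_le_one_left
        (Finset.sum_nonneg fun i _ => mul_nonneg (hw i) (by positivity)) hw1

open Classical in
/-- The error of a mixture of scores with truncated estimated weights: weight errors inside the
truncation region, the mass outside of it, and the errors of the components. -/
lemma norm_sum_truncated_sub_sq_le {w u : ι → ℝ} (hw : ∀ i, 0 ≤ w i) (hw1 : ∑ i, w i = 1)
    (v s : ι → F) (In : ι → Prop) {H : ℝ} (hH0 : 0 ≤ H) (hH : ∀ i, In i → ‖v i‖ ^ 2 ≤ H) :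
    ‖∑ i, (if In i then u i else 0) • v i - ∑ i, w i • s i‖ ^ 2 ≤
      3 * ((∑ i, |u i - w i|) ^ 2 * H) + 3 * ∑ i, w i * (if In i then 0 else ‖v i‖ ^ 2) +
        3 * ∑ i, w i * ‖v i - s i‖ ^ 2 := by
  set x := ∑ i, (if In i then u i - w i else 0) • v i with hx
  set y := ∑ i, w i • (if In i then 0 else -v i) with hy
  set z := ∑ i, w i • (v i - s i) with hz
  have hsum : ∑ i, (if In i then u i else 0) • v i - ∑ i, w i • s i = x + y + z := by
    rw [hx, hy, hz, ← Finset.sum_sub_distrib, ← Finset.sum_add_distrib, ← Finset.sum_add_distrib]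
    refine Finset.sum_congr rfl fun i _ => ?_
    split_ifs
    · rw [sub_smul, smul_sub, smul_zero]; abel
    · rw [zero_smul, smul_sub, smul_neg]; abel
  have h3 : ‖x + y + z‖ ^ 2 ≤ 3 * ‖x‖ ^ 2 + 3 * ‖y‖ ^ 2 + 3 * ‖z‖ ^ 2 := by
    have : ‖x + y + z‖ ≤ ‖x‖ + ‖y‖ + ‖z‖ := norm_add₃_le
    nlinarith [norm_nonneg (x + y + z), sq_nonneg (‖x‖ - ‖y‖), sq_nonneg (‖x‖ - ‖z‖),
      sq_nonneg (‖y‖ - ‖z‖), norm_nonneg x, norm_nonneg y, norm_nonneg z]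
  have hx1 : ‖x‖ ^ 2 ≤ (∑ i, |u i - w i|) ^ 2 * H := by
    have h : ‖x‖ ≤ (∑ i, |u i - w i|) * Real.sqrt H := by
      rw [hx, Finset.sum_mul]
      refine (norm_sum_le _ _).trans (Finset.sum_le_sum fun i _ => ?_)
      rw [norm_smul]
      split_ifs with h
      · exact mul_le_mul_of_nonneg_left (Real.le_sqrt_of_sq_le (hH i h)) (abs_nonneg _)
      · rw [norm_zero, zero_mul]; positivity
    calc ‖x‖ ^ 2 ≤ ((∑ i, |u i - w i|) * Real.sqrt H) ^ 2 :=
          pow_le_pow_left₀ (norm_nonneg _) h 2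
      _ = _ := by rw [mul_pow, Real.sq_sqrt hH0]
  have hy1 : ‖y‖ ^ 2 ≤ ∑ i, w i * (if In i then 0 else ‖v i‖ ^ 2) := by
    refine (norm_sum_smul_sq_le hw hw1.le _).trans (le_of_eq ?_)
    refine Finset.sum_congr rfl fun i _ => ?_
    split_ifs <;> simp
  have hz1 := norm_sum_smul_sq_le hw hw1.le fun i => v i - s i
  rw [hsum]
  linarith

end Weights

/-! ### The mixture over the subspaces -/

section Mixture

variable {d M N : ℕ} {t : ℝ} {p : Measure (E d)} [IsProbabilityMeasure p]
  {V : Fin M → Submodule ℝ (E d)} {k : Fin M → ℕ} {A : ∀ i, E (k i) →ₗᵢ[ℝ] E d} {c : E d → Fin M}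

lemma IsExactRecovery.coe_eq_range (h : IsExactRecovery p V A c) (i : Fin M) :
    (V i : Set (E d)) = Set.range (A i) := by
  rw [← h.range_eq i]; ext; simp

lemma measurableSet_submodule (W : Submodule ℝ (E d)) : MeasurableSet (W : Set (E d)) :=
  W.closed_of_finiteDimensional.measurableSet

/-- The law of the coordinates of the part of `p` on the `i`-th subspace. -/
noncomputable def coordLaw (p : Measure (E d)) (V : Fin M → Submodule ℝ (E d))
    (A : ∀ i, E (k i) →ₗᵢ[ℝ] E d) (i : Fin M) : Measure (E (k i)) :=
  subLaw p (V i) (tr (A i))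

/-- The contribution of the `i`-th subspace to the smoothed density. -/
noncomputable def partialDensity (p : Measure (E d)) (V : Fin M → Submodule ℝ (E d)) (t : ℝ)
    (i : Fin M) (x : E d) : ℝ :=
  smoothedDensity (p.restrict (V i)) t x

/-- The posterior probability of the `i`-th subspace given the noisy observation `x`. -/
noncomputable def weight (p : Measure (E d)) (V : Fin M → Submodule ℝ (E d)) (t : ℝ)
    (i : Fin M) (x : E d) : ℝ :=
  partialDensity p V t i x / smoothedDensity p t x

/-- The kernel estimator of `partialDensity`, written in the coordinates of the subspace. -/
noncomputable def partialDensityEmp (V : Fin M → Submodule ℝ (E d))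
    (A : ∀ i, E (k i) →ₗᵢ[ℝ] E d) (t : ℝ) (X : Fin N → E d) (i : Fin M) (x : E d) : ℝ :=
  normalFactor (A i) t x * empDensity (V i) (tr (A i)) t X (tr (A i) x)

instance : IsFiniteMeasure (coordLaw p V A i) := by unfold coordLaw; infer_instance

omit [IsProbabilityMeasure p] in
lemma coordLaw_neZero {i : Fin M} (h : p (V i) ≠ 0) : NeZero (coordLaw p V A i) := by
  refine ⟨fun h0 => h ?_⟩
  rw [coordLaw, subLaw, Measure.map_eq_zero_iff (by fun_prop), Measure.restrict_eq_zero] at h0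
  exact h0

lemma IsExactRecovery.partialDensity_eq (h : IsExactRecovery p V A c) (ht : 0 < t) (i : Fin M)
    (x : E d) : partialDensity p V t i x =
      normalFactor (A i) t x * smoothedDensity (coordLaw p V A i) t (tr (A i) x) := by
  rw [partialDensity, coordLaw, h.coe_eq_range i, smoothedDensity_restrict_range (A i) p ht x]

lemma IsExactRecovery.integral_eq_sum {F : Type*} [NormedAddCommGroup F] [NormedSpace ℝ F]
    (h : IsExactRecovery p V A c) {f : E d → F} (hf : Integrable f p) :
    ∫ x, f x ∂p = ∑ i, ∫ x in (V i : Set (E d)), f x ∂p := by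
  have h1 : f =ᵐ[p] fun x => ∑ i, (V i : Set (E d)).indicator f x := by
    filter_upwards [h.classify] with x hx
    rw [Finset.sum_eq_single (c x)]
    · rw [Set.indicator_of_mem ((hx (c x)).1 rfl)]
    · intro i _ hi
      exact Set.indicator_of_notMem (fun hmem => hi ((hx i).2 hmem).symm) _
    · simp
  rw [integral_congr_ae h1, integral_finsetSum _ fun i _ =>
    hf.indicator (measurableSet_submodule (V i))]
  exact Finset.sum_congr rfl fun i _ => integral_indicator (measurableSet_submodule (V i))

lemma IsExactRecovery.sum_partialDensity (h : IsExactRecovery p V A c) (ht : 0 < t) (x : E d) :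
    ∑ i, partialDensity p V t i x = smoothedDensity p t x :=
  (h.integral_eq_sum (integrable_gaussDensity_sub p ht x)).symm

lemma partialDensity_nonneg (ht : 0 < t) (i : Fin M) (x : E d) : 0 ≤ partialDensity p V t i x :=
  smoothedDensity_nonneg _ ht x

lemma weight_nonneg (ht : 0 < t) (i : Fin M) (x : E d) : 0 ≤ weight p V t i x :=
  div_nonneg (partialDensity_nonneg ht i x) (smoothedDensity_nonneg _ ht x)

lemma IsExactRecovery.sum_weight (h : IsExactRecovery p V A c) (ht : 0 < t) (x : E d) :
    ∑ i, weight p V t i x = 1 := by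
  unfold weight
  rw [← Finset.sum_div, h.sum_partialDensity ht, div_self (smoothedDensity_pos p ht x).ne']

/-- The true score is the posterior mean of the component scores. -/
lemma IsExactRecovery.score_eq_sum (h : IsExactRecovery p V A c) (hpos : ∀ i, p (V i) ≠ 0)
    (ht : 0 < t) (x : E d) :
    score p t x = ∑ i, weight p V t i x • componentScore (A i) (coordLaw p V A i) t x := by
  have h1 : smoothedGrad p t x = ∑ i, smoothedGrad (p.restrict (V i)) t x :=
    h.integral_eq_sum (integrable_kernelGrad_sub p ht x)
  rw [score_eq p ht x, h1, Finset.smul_sum]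
  refine Finset.sum_congr rfl fun i _ => ?_
  have hne := coordLaw_neZero (A := A) (hpos i)
  unfold coordLaw at hne ⊢
  unfold weight partialDensity
  rw [h.coe_eq_range i] at hne ⊢
  rw [smoothedGrad_restrict_range (A i) p ht x, smul_smul, one_div_mul_eq_div]

lemma IsExactRecovery.partialDensityEst_eq (h : IsExactRecovery p V A c) (ht : 0 < t)
    {X : Fin N → E d} (hX : ∀ j i, c (X j) = i ↔ X j ∈ V i) (i : Fin M) (x : E d) :
    partialDensityEst c t X i x = partialDensityEmp V A t X i x := by
  rw [partialDensityEmp, h.coe_eq_range i, ← sum_indicator_gaussDensity_eq (A i) ht X x,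
    ← h.coe_eq_range i, partialDensityEst]
  congr 1
  refine Finset.sum_congr rfl fun j _ => ?_
  by_cases hj : X j ∈ V i
  · rw [if_pos ((hX j i).2 hj), Set.indicator_of_mem (by exact hj), mul_one]
  · rw [if_neg (fun hc => hj ((hX j i).1 hc)), Set.indicator_of_notMem (by exact hj), mul_zero]

lemma sum_partialDensityEst (c : E d → Fin M) (X : Fin N → E d) (x : E d) :
    ∑ i, partialDensityEst c t X i x = densityEst t X x := by
  unfold partialDensityEst densityEst
  rw [← Finset.mul_sum, Finset.sum_comm]
  congr 1
  refine Finset.sum_congr rfl fun j _ => ?_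
  rw [← Finset.mul_sum]
  simp

lemma densityEst_pos (ht : 0 < t) (hN : 0 < N) (X : Fin N → E d) (x : E d) :
    0 < densityEst t X x := by
  have : Nonempty (Fin N) := ⟨⟨0, hN⟩⟩
  unfold densityEst
  refine mul_pos (by positivity) (Finset.sum_pos (fun j _ => gaussDensity_pos ht _)
    Finset.univ_nonempty)

lemma partialDensityEmp_nonneg (ht : 0 < t) (X : Fin N → E d) (i : Fin M) (x : E d) :
    0 ≤ partialDensityEmp V A t X i x :=
  mul_nonneg (normalFactor_pos _ ht x).le (empDensity_nonneg ht _ _)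

/-- The relative error of the estimated contribution of the `i`-th subspace, capped at `1`. -/
noncomputable def relErr (p : Measure (E d)) (V : Fin M → Submodule ℝ (E d))
    (A : ∀ i, E (k i) →ₗᵢ[ℝ] E d) (t : ℝ) (X : Fin N → E d) (i : Fin M) (x : E d) : ℝ :=
  min 1 (|partialDensityEmp V A t X i x - partialDensity p V t i x| / smoothedDensity p t x)

open Classical in
/-- The contribution of the orthogonal directions that is cut off by the regularisation. -/
noncomputable def cutoffErr (R t : ℝ) (N : ℕ) {k : ℕ} (A : E k →ₗᵢ[ℝ] E d) (x : E d) : ℝ :=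
  if ‖x - proj A x‖ ≤ R then 0 else ‖x - proj A x‖ ^ 2 / t ^ 2 + 2 * Real.log N / t

lemma cutoffErr_nonneg (hN : 2 ≤ N) (ht : 0 < t) {k : ℕ} (A : E k →ₗᵢ[ℝ] E d) (R : ℝ) (x : E d) :
    0 ≤ cutoffErr R t N A x := by
  have := half_le_log hN
  unfold cutoffErr
  split_ifs
  · exact le_rfl
  · positivity

/-- The deterministic error decomposition. `H` bounds the size of the component estimators that are
not cut off. -/
lemma IsExactRecovery.norm_scoreEst_sub_score_sq_le (h : IsExactRecovery p V A c)
    (hpos : ∀ i, p (V i) ≠ 0) (ht : 0 < t) (hN : 2 ≤ N) {X : Fin N → E d}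
    (hX : ∀ j i, c (X j) = i ↔ X j ∈ V i) (CR : ℝ) (x : E d) {H : ℝ} (hH0 : 0 ≤ H)
    (hH : ∀ i, ‖x - proj (A i) x‖ ≤ regRadius CR d N (k i) t →
      ‖x - proj (A i) x‖ ^ 2 / t ^ 2 + 2 * Real.log N / t ≤ H) :
    ‖scoreEst CR V A c t X x - score p t x‖ ^ 2 ≤
      ∑ i, (12 * M * H * relErr p V A t X i x ^ 2 +
        3 * (weight p V t i x * cutoffErr (regRadius CR d N (k i) t) t N (A i) x) +
        3 * (weight p V t i x * lowErrBound (coordLaw p V A i) (V i) (tr (A i)) t X (tr (A i) x))) := by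
  classical
  have hN0 : 0 < N := by omega
  have hest : scoreEst CR V A c t X x = ∑ i,
      (if ‖x - proj (A i) x‖ ≤ regRadius CR d N (k i) t then
        partialDensityEst c t X i x / densityEst t X x else 0) •
        componentScoreEst (V i) (A i) t X x := by
    unfold scoreEst
    refine Finset.sum_congr rfl fun i _ => ?_
    unfold weightEst
    congr
  rw [hest, h.score_eq_sum hpos ht x]
  refine (norm_sum_truncated_sub_sq_le (fun i => weight_nonneg ht i x) (h.sum_weight ht x)
    (fun i => componentScoreEst (V i) (A i) t X x)
    (fun i => componentScore (A i) (coordLaw p V A i) t x)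
    (fun i => ‖x - proj (A i) x‖ ≤ regRadius CR d N (k i) t) hH0
    (fun i hi => (norm_componentScoreEst_sq_le (A i) (V i) ht hN X x).trans (hH i hi))).trans ?_
  rw [Finset.sum_add_distrib, Finset.sum_add_distrib, ← Finset.mul_sum, ← Finset.mul_sum,
    ← Finset.mul_sum]
  refine add_le_add (add_le_add ?_ ?_) ?_
  · have hw := sum_abs_div_sub_div_sq_le (a := fun i => partialDensityEst c t X i x)
      (b := fun i => partialDensity p V t i x)
      (fun i => by rw [h.partialDensityEst_eq ht hX]; exact partialDensityEmp_nonneg ht X i x)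
      (fun i => partialDensity_nonneg ht i x)
      (by rw [sum_partialDensityEst]; exact densityEst_pos ht hN0 X x)
      (by rw [h.sum_partialDensity ht]; exact smoothedDensity_pos p ht x)
    rw [sum_partialDensityEst, h.sum_partialDensity ht, Fintype.card_fin] at hw
    have hrel : ∀ i, min 1 (|partialDensityEst c t X i x - partialDensity p V t i x| /
        smoothedDensity p t x) = relErr p V A t X i x := by
      intro i; rw [h.partialDensityEst_eq ht hX]; rfl
    simp only [hrel] at hw
    calc 3 * ((∑ i, |partialDensityEst c t X i x / densityEst t X x - weight p V t i x|) ^ 2 * H)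
        ≤ 3 * ((4 * M * ∑ i, relErr p V A t X i x ^ 2) * H) := by
          refine mul_le_mul_of_nonneg_left (mul_le_mul_of_nonneg_right hw hH0) (by norm_num)
      _ = _ := by ring
  · refine mul_le_mul_of_nonneg_left (Finset.sum_le_sum fun i _ => ?_) (by norm_num)
    refine mul_le_mul_of_nonneg_left ?_ (weight_nonneg ht i x)
    unfold cutoffErr
    split_ifs
    · exact le_rfl
    · exact norm_componentScoreEst_sq_le (A i) (V i) ht hN X x
  · refine mul_le_mul_of_nonneg_left (Finset.sum_le_sum fun i _ => ?_) (by norm_num)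
    refine mul_le_mul_of_nonneg_left ?_ (weight_nonneg ht i x)
    rw [componentScoreEst_sub_componentScore]
    have hne := coordLaw_neZero (A := A) (hpos i)
    exact norm_lowScoreEst_sub_subScore_sq_le (coordLaw p V A i) ht (subLaw_real_univ_le (by fun_prop)) hN X _

/-! ### Integration of the error decomposition -/

lemma measurable_partialDensity (i : Fin M) : Measurable (partialDensity p V t i) :=
  measurable_smoothedDensity _

lemma measurable_weight (i : Fin M) : Measurable (weight p V t i) :=
  (measurable_partialDensity i).div (measurable_smoothedDensity p)

lemma measurable_normalFactor {k : ℕ} (A : E k →ₗᵢ[ℝ] E d) : Measurable (normalFactor A t) := by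
  unfold normalFactor; fun_prop

lemma measurable_cutoffErr (R : ℝ) {k : ℕ} (A : E k →ₗᵢ[ℝ] E d) :
    Measurable (cutoffErr R t N A) := by
  unfold cutoffErr
  exact Measurable.ite (measurableSet_le (by fun_prop) measurable_const) measurable_const
    (by fun_prop)

lemma measurable_comp_tr {β : Type*} [MeasurableSpace β] {k : ℕ} (A : E k →ₗᵢ[ℝ] E d)
    {f : (Fin N → E d) × E k → β} (hf : Measurable f) :
    Measurable fun w : (Fin N → E d) × E d => f (w.1, tr A w.2) :=
  hf.comp (by fun_prop)

lemma measurable_relErr (i : Fin M) :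
    Measurable fun w : (Fin N → E d) × E d => relErr p V A t w.1 i w.2 := by
  unfold relErr partialDensityEmp
  have h1 : Measurable fun w : (Fin N → E d) × E d =>
      empDensity (V i : Set (E d)) (tr (A i)) t w.1 (tr (A i) w.2) :=
    measurable_comp_tr (A i)
      (measurable_empDensity (N := N) (t := t) (measurableSet_submodule (V i)) (by fun_prop))
  have h2 : Measurable fun w : (Fin N → E d) × E d => normalFactor (A i) t w.2 :=
    (measurable_normalFactor (A i)).comp measurable_snd
  have h3 : Measurable fun w : (Fin N → E d) × E d => partialDensity p V t i w.2 :=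
    (measurable_partialDensity i).comp measurable_snd
  have h4 : Measurable fun w : (Fin N → E d) × E d => smoothedDensity p t w.2 :=
    (measurable_smoothedDensity p).comp measurable_snd
  fun_prop

/-- The variance proxy of the `i`-th weight at a point with coordinates `z`. -/
noncomputable def weightVar (q : Measure (E n)) (t : ℝ) (N : ℕ) (z : E n) : ℝ :=
  min 1 (peak n t / (N * smoothedDensity q t z))

lemma measurable_weightVar {n : ℕ} (q : Measure (E n)) [IsFiniteMeasure q] :
    Measurable (weightVar q t N) := by
  unfold weightVar; fun_prop

lemma weightVar_nonneg {n : ℕ} (q : Measure (E n)) [IsFiniteMeasure q] (ht : 0 < t) (z : E n) :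
    0 ≤ weightVar q t N z :=
  le_min zero_le_one (div_nonneg (peak_pos ht).le
    (mul_nonneg (Nat.cast_nonneg N) (smoothedDensity_nonneg q ht z)))

lemma weight_le_one (ht : 0 < t) (i : Fin M) (x : E d) : weight p V t i x ≤ 1 := by
  refine (div_le_one (smoothedDensity_pos p ht x)).2 ?_
  exact setIntegral_le_integral (integrable_gaussDensity_sub p ht x)
    (Filter.Eventually.of_forall fun y => gaussDensity_nonneg ht _)

/-- The second moment of the capped relative error. The cap `1` is used where `G` is below `peak / N`
(through the first moment), the variance of the estimator elsewhere; here `G` is the smoothed density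
of `coordLaw i`. The normal factor times `G` over the full density is the weight, so only the kernel of the low-dimensional space remains. -/
lemma IsExactRecovery.lintegral_relErr_sq_le (h : IsExactRecovery p V A c)
    (hpos : ∀ i, p (V i) ≠ 0) (ht : 0 < t) (hN : 0 < N) (i : Fin M) (x : E d) :
    ∫⁻ X, ENNReal.ofReal (relErr p V A t X i x ^ 2) ∂(Measure.pi fun _ : Fin N => p) ≤
      ENNReal.ofReal (2 * (weight p V t i x * weightVar (coordLaw p V A i) t N (tr (A i) x))) := by
  have hne := coordLaw_neZero (A := A) (hpos i)
  have hS := measurableSet_submodule (V i)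
  have hE1 := lintegral_sq_empDensity_sub_le (p := p) (S := V i) (T := tr (A i)) hS (by fun_prop)
    ht hN (tr (A i) x)
  have hE2 := lintegral_abs_empDensity_sub_le (p := p) (S := V i) (T := tr (A i)) hS (by fun_prop)
    ht hN (tr (A i) x)
  have hm : Measurable fun X : Fin N → E d =>
      empDensity (V i : Set (E d)) (tr (A i)) t X (tr (A i) x) :=
    (measurable_empDensity (N := N) (t := t) hS (T := tr (A i)) (by fun_prop)).comp
      (f := fun X => (X, tr (A i) x)) (by fun_prop)
  change _ ≤ ENNReal.ofReal (_ * (_ * smoothedDensity (coordLaw p V A i) t _)) at hE1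
  change _ ≤ ENNReal.ofReal (_ * smoothedDensity (coordLaw p V A i) t _) at hE2
  have hG := smoothedDensity_pos (coordLaw p V A i) ht (tr (A i) x)
  have hP := smoothedDensity_pos p ht x
  have hν := normalFactor_pos (A i) ht x
  have hw0 := weight_nonneg (p := p) (V := V) ht i x
  have hw1 := weight_le_one (p := p) (V := V) ht i x
  have hp := peak_pos (n := k i) ht
  have hN' : (0 : ℝ) < N := by exact_mod_cast hN
  have hw : weight p V t i x = normalFactor (A i) t x / smoothedDensity p t x *
      smoothedDensity (coordLaw p V A i) t (tr (A i) x) := by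
    rw [weight, h.partialDensity_eq ht]; ring
  have hrel : ∀ X : Fin N → E d, relErr p V A t X i x =
      min 1 (normalFactor (A i) t x / smoothedDensity p t x *
        |empDensity (V i : Set (E d)) (tr (A i)) t X (tr (A i) x) -
          smoothedDensity (coordLaw p V A i) t (tr (A i) x)|) := by
    intro X
    rw [relErr, partialDensityEmp, h.partialDensity_eq ht, ← mul_sub, abs_mul, abs_of_pos hν]
    congr 1; ring
  set G := smoothedDensity (coordLaw p V A i) t (tr (A i) x)
  set ν := normalFactor (A i) t x / smoothedDensity p t x with hνdef
  have hν0 : 0 < ν := div_pos hν hP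
  rw [weightVar]
  -- either argument of the minimum in `weightVar` is treated separately
  have hcase : ∀ {b : ℝ}, (∫⁻ X, ENNReal.ofReal (relErr p V A t X i x ^ 2)
      ∂(Measure.pi fun _ : Fin N => p) ≤ ENNReal.ofReal (2 * weight p V t i x)) →
      (∫⁻ X, ENNReal.ofReal (relErr p V A t X i x ^ 2)
      ∂(Measure.pi fun _ : Fin N => p) ≤ ENNReal.ofReal (2 * (weight p V t i x * b))) →
      ∫⁻ X, ENNReal.ofReal (relErr p V A t X i x ^ 2) ∂(Measure.pi fun _ : Fin N => p) ≤
        ENNReal.ofReal (2 * (weight p V t i x * min 1 b)) := by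
    intro b h1 h2
    rcases min_choice 1 b with hb | hb <;> rw [hb]
    · rwa [mul_one]
    · exact h2
  refine hcase ?_ ?_
  · have h1 : ∀ X : Fin N → E d, ENNReal.ofReal (relErr p V A t X i x ^ 2) ≤ ENNReal.ofReal ν *
        ENNReal.ofReal |empDensity (V i : Set (E d)) (tr (A i)) t X (tr (A i) x) - G| := by
      intro X
      rw [← ENNReal.ofReal_mul hν0.le, hrel]
      refine ENNReal.ofReal_le_ofReal ?_
      have h0 : 0 ≤ min 1 (ν * |empDensity (V i : Set (E d)) (tr (A i)) t X (tr (A i) x) - G|) :=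
        le_min zero_le_one (by positivity)
      refine le_trans ?_ (min_le_right 1 _)
      rw [sq]
      exact mul_le_of_le_one_left h0 (min_le_left _ _)
    refine (lintegral_mono h1).trans ?_
    rw [lintegral_const_mul _ (by fun_prop)]
    refine (mul_le_mul_right hE2 _).trans ?_
    rw [← ENNReal.ofReal_mul hν0.le, hw]
    exact ENNReal.ofReal_le_ofReal (le_of_eq (by ring))
  · have h1 : ∀ X : Fin N → E d, ENNReal.ofReal (relErr p V A t X i x ^ 2) ≤
        ENNReal.ofReal (ν ^ 2) *
        ENNReal.ofReal ((empDensity (V i : Set (E d)) (tr (A i)) t X (tr (A i) x) - G) ^ 2) := by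
      intro X
      rw [← ENNReal.ofReal_mul (by positivity), hrel]
      refine ENNReal.ofReal_le_ofReal ?_
      have h0 : 0 ≤ min 1 (ν * |empDensity (V i : Set (E d)) (tr (A i)) t X (tr (A i) x) - G|) :=
        le_min zero_le_one (by positivity)
      refine (pow_le_pow_left₀ h0 (min_le_right 1 _) 2).trans (le_of_eq ?_)
      rw [mul_pow, sq_abs]
    refine (lintegral_mono h1).trans ?_
    rw [lintegral_const_mul _ (by fun_prop)]
    refine (mul_le_mul_right hE1 _).trans ?_
    rw [← ENNReal.ofReal_mul (by positivity)]
    refine ENNReal.ofReal_le_ofReal ?_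
    have h2 : ν ^ 2 * (1 / N * (peak (k i) t * G)) =
        weight p V t i x * (weight p V t i x * (peak (k i) t / (N * G))) := by
      rw [hw]; field_simp
    rw [h2]
    have h3 : 0 ≤ weight p V t i x * (peak (k i) t / (N * G)) := by positivity
    calc _ ≤ 1 * (weight p V t i x * (peak (k i) t / (N * G))) :=
          mul_le_mul_of_nonneg_right hw1 h3
      _ ≤ _ := by linarith

/-- Weighting the smoothed law by a posterior probability gives the smoothed law of a part. -/
lemma lintegral_weight_mul (ht : 0 < t) (i : Fin M) {h : E d → ℝ≥0∞} (hh : Measurable h) :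
    ∫⁻ x, ENNReal.ofReal (weight p V t i x) * h x ∂(smoothedLaw p t) =
      ∫⁻ x, h x ∂(smoothedLaw (p.restrict (V i)) t) := by
  have hm := measurable_weight (p := p) (V := V) (t := t) i
  rw [lintegral_smoothedLaw_eq_volume p ht (by fun_prop),
    lintegral_smoothedLaw_eq_volume _ ht hh]
  refine lintegral_congr fun x => ?_
  rw [← mul_assoc, ← ENNReal.ofReal_mul (smoothedDensity_nonneg p ht x), weight,
    mul_div_cancel₀ _ (smoothedDensity_pos p ht x).ne']
  rfl

lemma IsExactRecovery.lintegral_restrict_comp_tr (h : IsExactRecovery p V A c) (ht : 0 < t)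
    (i : Fin M) {f : E (k i) → ℝ≥0∞} (hf : Measurable f) :
    ∫⁻ x, f (tr (A i) x) ∂(smoothedLaw (p.restrict (V i)) t) =
      ∫⁻ z, ENNReal.ofReal (smoothedDensity (coordLaw p V A i) t z) * f z := by
  rw [coordLaw, h.coe_eq_range i, lintegral_smoothedLaw_comp_tr (A i) p ht hf]

instance : IsProbabilityMeasure (smoothedLaw p t) := by unfold smoothedLaw; infer_instance

lemma lowErrBound_nonneg {n : ℕ} (q : Measure (E n)) (S : Set (E d)) (T : E d → E n) (ht : 0 < t)
    (hN : 2 ≤ N) (X : Fin N → E d) (z : E n) : 0 ≤ lowErrBound q S T t X z := by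
  have hℓ := half_le_log hN
  unfold lowErrBound
  refine le_min (by positivity) ?_
  split_ifs <;> positivity

/-- The risk is bounded by integrals over the parts of the smoothed law that belong to the different
subspaces. -/
lemma IsExactRecovery.risk_le_sum (h : IsExactRecovery p V A c) (hpos : ∀ i, p (V i) ≠ 0)
    (ht : 0 < t) (hN : 2 ≤ N) (CR : ℝ) {H : E d → ℝ} (hHm : Measurable H) (hH0 : ∀ x, 0 ≤ H x)
    (hH : ∀ x i, ‖x - proj (A i) x‖ ≤ regRadius CR d N (k i) t →
      ‖x - proj (A i) x‖ ^ 2 / t ^ 2 + 2 * Real.log N / t ≤ H x) :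
    ∫⁻ X, ∫⁻ x, ‖scoreEst CR V A c t X x - score p t x‖ₑ ^ 2 ∂(smoothedLaw p t)
        ∂(Measure.pi fun _ : Fin N => p) ≤
      ∑ i, (ENNReal.ofReal (24 * M) * ∫⁻ x, ENNReal.ofReal
            (H x * weightVar (coordLaw p V A i) t N (tr (A i) x))
          ∂(smoothedLaw (p.restrict (V i)) t) +
        3 * ∫⁻ x, ENNReal.ofReal (cutoffErr (regRadius CR d N (k i) t) t N (A i) x)
          ∂(smoothedLaw (p.restrict (V i)) t) +
        3 * ∫⁻ z, ENNReal.ofReal (smoothedDensity (coordLaw p V A i) t z) *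
          ∫⁻ X, ENNReal.ofReal (lowErrBound (coordLaw p V A i) (V i) (tr (A i)) t X z)
            ∂(Measure.pi fun _ : Fin N => p)) := by
  have hX : ∀ᵐ X ∂(Measure.pi fun _ : Fin N => p), ∀ j i, c (X j) = i ↔ X j ∈ V i := by
    rw [ae_all_iff]
    exact fun j => (measurePreserving_eval (fun _ : Fin N => p) j).quasiMeasurePreserving.ae
      h.classify
  have hrel := fun i => measurable_relErr (N := N) (p := p) (V := V) (A := A) (t := t) i
  have hcut := fun i => measurable_cutoffErr (t := t) (N := N) (regRadius CR d N (k i) t) (A i)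
  have hwm := fun i => measurable_weight (p := p) (V := V) (t := t) i
  have hlow0 := fun i => measurable_lowErrBound (N := N) (t := t) (coordLaw p V A i)
      (measurableSet_submodule (V i)) (T := tr (A i)) (by fun_prop)
  have hlow := fun i => measurable_comp_tr (A i) (hlow0 i)
  -- the three terms of the decomposition, as functions with values in `ℝ≥0∞`
  set f1 : Fin M → (Fin N → E d) × E d → ℝ≥0∞ := fun i w =>
    ENNReal.ofReal (12 * M * H w.2) * ENNReal.ofReal (relErr p V A t w.1 i w.2 ^ 2) with hf1
  set f2 : Fin M → E d → ℝ≥0∞ := fun i x => 3 * (ENNReal.ofReal (weight p V t i x) *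
    ENNReal.ofReal (cutoffErr (regRadius CR d N (k i) t) t N (A i) x)) with hf2
  set f3 : Fin M → (Fin N → E d) × E d → ℝ≥0∞ := fun i w => 3 * (ENNReal.ofReal (weight p V t i w.2) *
    ENNReal.ofReal (lowErrBound (coordLaw p V A i) (V i) (tr (A i)) t w.1 (tr (A i) w.2))) with hf3
  have hf1m : ∀ i, Measurable (f1 i) := fun i => by
    have := hrel i; fun_prop
  have hf2m : ∀ i, Measurable (f2 i) := fun i => by
    have := hcut i; have := hwm i; fun_prop
  have hf3m : ∀ i, Measurable (f3 i) := fun i => by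
    have h1 := hlow i
    have h2 : Measurable fun w : (Fin N → E d) × E d => weight p V t i w.2 :=
      (hwm i).comp measurable_snd
    exact ((h2.ennreal_ofReal).mul h1.ennreal_ofReal).const_mul _
  have hpt : ∀ᵐ X ∂(Measure.pi fun _ : Fin N => p),
      ∫⁻ x, ‖scoreEst CR V A c t X x - score p t x‖ₑ ^ 2 ∂(smoothedLaw p t) ≤
        ∫⁻ x, ∑ i, (f1 i (X, x) + f2 i x + f3 i (X, x)) ∂(smoothedLaw p t) := by
    filter_upwards [hX] with X hX
    refine lintegral_mono fun x => ?_
    rw [← ofReal_norm, ← ENNReal.ofReal_pow (norm_nonneg _)]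
    refine (ENNReal.ofReal_le_ofReal (h.norm_scoreEst_sub_score_sq_le hpos ht hN hX CR x (hH0 x)
      (hH x))).trans ?_
    have h1 : ∀ i, 0 ≤ 12 * M * H x * relErr p V A t X i x ^ 2 := fun i => by
      have := hH0 x; positivity
    have h2 : ∀ i, 0 ≤ weight p V t i x *
        cutoffErr (regRadius CR d N (k i) t) t N (A i) x := fun i =>
      mul_nonneg (weight_nonneg ht i x) (cutoffErr_nonneg hN ht _ _ _)
    have h3 : ∀ i, 0 ≤ weight p V t i x *
        lowErrBound (coordLaw p V A i) (V i) (tr (A i)) t X (tr (A i) x) := fun i =>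
      mul_nonneg (weight_nonneg ht i x) (lowErrBound_nonneg _ _ _ ht hN _ _)
    rw [ENNReal.ofReal_sum_of_nonneg fun i _ => add_nonneg (add_nonneg (h1 i)
      (mul_nonneg (by norm_num) (h2 i))) (mul_nonneg (by norm_num) (h3 i))]
    refine Finset.sum_le_sum fun i _ => ?_
    rw [ENNReal.ofReal_add (add_nonneg (h1 i) (mul_nonneg (by norm_num) (h2 i)))
      (mul_nonneg (by norm_num) (h3 i)), ENNReal.ofReal_add (h1 i) (mul_nonneg (by norm_num) (h2 i)),
      ENNReal.ofReal_mul (by have := hH0 x; positivity), ENNReal.ofReal_mul (p := 3) (by norm_num),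
      ENNReal.ofReal_mul (p := 3) (by norm_num), ENNReal.ofReal_mul (weight_nonneg ht i x),
      ENNReal.ofReal_mul (weight_nonneg ht i x), ENNReal.ofReal_ofNat]
  refine (lintegral_mono_ae hpt).trans ?_
  have hsum : Measurable fun w : (Fin N → E d) × E d =>
      ∑ i, (f1 i w + f2 i w.2 + f3 i w) :=
    Finset.measurable_sum _ fun i _ =>
      ((hf1m i).add ((hf2m i).comp measurable_snd)).add (hf3m i)
  rw [lintegral_lintegral_swap hsum.aemeasurable]
  have hX1 : ∀ i x, Measurable fun X : Fin N → E d => f1 i (X, x) := fun i x =>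
    (hf1m i).comp (by fun_prop)
  have hX3 : ∀ i x, Measurable fun X : Fin N → E d => f3 i (X, x) := fun i x =>
    (hf3m i).comp (by fun_prop)
  have hx1 : ∀ i, Measurable fun x => ∫⁻ X, f1 i (X, x) ∂(Measure.pi fun _ : Fin N => p) :=
    fun i => (hf1m i).lintegral_prod_left'
  have hx3 : ∀ i, Measurable fun x => ∫⁻ X, f3 i (X, x) ∂(Measure.pi fun _ : Fin N => p) :=
    fun i => (hf3m i).lintegral_prod_left'
  have hinner : ∀ x, ∫⁻ X, ∑ i, (f1 i (X, x) + f2 i x + f3 i (X, x))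
      ∂(Measure.pi fun _ : Fin N => p) =
      ∑ i, (∫⁻ X, f1 i (X, x) ∂(Measure.pi fun _ : Fin N => p) + f2 i x +
        ∫⁻ X, f3 i (X, x) ∂(Measure.pi fun _ : Fin N => p)) := by
    intro x
    rw [lintegral_finsetSum _ fun i _ => by
      exact ((hX1 i x).add measurable_const).add (hX3 i x)]
    refine Finset.sum_congr rfl fun i _ => ?_
    rw [lintegral_add_right _ (hX3 i x), lintegral_add_right _ measurable_const, lintegral_const,
      measure_univ, mul_one]
  simp only [hinner]
  rw [lintegral_finsetSum _ fun i _ => by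
    exact ((hx1 i).add (hf2m i)).add (hx3 i)]
  refine Finset.sum_le_sum fun i _ => ?_
  rw [lintegral_add_right _ (hx3 i), lintegral_add_right _ (hf2m i)]
  have hvm : Measurable fun x => weightVar (coordLaw p V A i) t N (tr (A i) x) :=
    (measurable_weightVar (t := t) (N := N) (coordLaw p V A i)).comp (by fun_prop)
  have hcuti := hcut i
  refine add_le_add (add_le_add ?_ ?_) ?_
  · rw [← lintegral_weight_mul ht i (by fun_prop), ← lintegral_const_mul _ (by
      have := hwm i; fun_prop)]
    refine lintegral_mono fun x => ?_
    simp only [hf1]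
    rw [lintegral_const_mul _ (by
      have := (hrel i).comp (f := fun X : Fin N → E d => (X, x)) (by fun_prop)
      simp only [Function.comp_def] at this
      fun_prop)]
    refine (mul_le_mul_right (h.lintegral_relErr_sq_le hpos ht (by omega) i x) _).trans ?_
    have hHx := hH0 x
    have hw0 := weight_nonneg (p := p) (V := V) ht i x
    rw [← ENNReal.ofReal_mul (by positivity), ← ENNReal.ofReal_mul hw0,
      ← ENNReal.ofReal_mul (by positivity)]
    exact ENNReal.ofReal_le_ofReal (le_of_eq (by ring))
  · simp only [hf2]
    have := hwm i
    rw [lintegral_const_mul _ (by fun_prop), lintegral_weight_mul ht i (by fun_prop)]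
  · have hgm : Measurable fun z => ∫⁻ X, ENNReal.ofReal
        (lowErrBound (coordLaw p V A i) (V i) (tr (A i)) t X z) ∂(Measure.pi fun _ : Fin N => p) :=
      ((hlow0 i).ennreal_ofReal).lintegral_prod_left'
    rw [← h.lintegral_restrict_comp_tr ht i hgm, ← lintegral_weight_mul ht i (by fun_prop)]
    simp only [hf3]
    have hstep : ∀ x, ∫⁻ X, 3 * (ENNReal.ofReal (weight p V t i x) *
        ENNReal.ofReal (lowErrBound (coordLaw p V A i) (V i) (tr (A i)) t X (tr (A i) x)))
          ∂(Measure.pi fun _ : Fin N => p) =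
        3 * (ENNReal.ofReal (weight p V t i x) * ∫⁻ X, ENNReal.ofReal
          (lowErrBound (coordLaw p V A i) (V i) (tr (A i)) t X (tr (A i) x))
          ∂(Measure.pi fun _ : Fin N => p)) := by
      intro x
      have hmx : Measurable fun X : Fin N → E d =>
          lowErrBound (coordLaw p V A i) (V i) (tr (A i)) t X (tr (A i) x) :=
        (hlow i).comp (f := fun X : Fin N → E d => (X, x)) (by fun_prop)
      rw [lintegral_const_mul _ (by fun_prop), lintegral_const_mul _ (by fun_prop)]
    simp only [hstep]
    rw [lintegral_const_mul _ (by have := hwm i; fun_prop)]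

end Mixture

/-! ### The rate of each term -/

section Rate

variable {d M N : ℕ} {t σ : ℝ} {p : Measure (E d)} [IsProbabilityMeasure p]
  {V : Fin M → Submodule ℝ (E d)} {k : Fin M → ℕ} {A : ∀ i, E (k i) →ₗᵢ[ℝ] E d} {c : E d → Fin M}

lemma IsExactRecovery.isSubSubgaussian (h : IsExactRecovery p V A c) {i : Fin M} {s : ℝ}
    (hs : IsSubgaussian (lowLaw p (A i)) s) (hsσ : s ≤ σ) (hpos : p (V i) ≠ 0) :
    IsSubSubgaussian (coordLaw p V A i) σ := by
  have hs0 := hs.1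
  refine ⟨subLaw_univ_le (by fun_prop), hs0.trans_le hsσ, fun θ hθ => ?_⟩
  have h1 : coordLaw p V A i = p (V i) • lowLaw p (A i) := by
    rw [coordLaw, subLaw, lowLaw, ← h.coe_eq_range i, ProbabilityTheory.cond, Measure.map_smul, smul_smul,
      ENNReal.mul_inv_cancel hpos (measure_ne_top _ _), one_smul]
  rw [h1, lintegral_smul_measure, smul_eq_mul]
  have h2 : ∫⁻ x, ENNReal.ofReal (Real.exp ((inner ℝ x θ / σ) ^ 2)) ∂(lowLaw p (A i)) ≤ 2 := by
    refine (lintegral_mono fun x => ENNReal.ofReal_le_ofReal (Real.exp_le_exp.2 ?_)).trans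
      (hs.2 θ hθ)
    rw [div_pow, div_pow]
    gcongr
  exact (mul_le_mul' prob_le_one h2).trans (by rw [one_mul])

/-- The ratio of scales that governs the rate. -/
noncomputable def scaleRatio (σ t : ℝ) (κ : ℕ) : ℝ := 1 + σ ^ κ / t ^ ((κ : ℝ) / 2)

lemma one_le_scaleRatio (hσ : 0 < σ) (ht : 0 < t) (κ : ℕ) : 1 ≤ scaleRatio σ t κ := by
  have : 0 ≤ σ ^ κ / t ^ ((κ : ℝ) / 2) := by positivity
  unfold scaleRatio; linarith

lemma sq_div_le_scaleRatio (hσ : 0 < σ) (ht : 0 < t) {κ : ℕ} (hκ : 2 ≤ κ) :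
    σ ^ 2 / t ≤ scaleRatio σ t κ := by
  have hu0 : 0 < σ ^ 2 / t := by positivity
  have h4 : (σ ^ 2 / t) ^ ((κ : ℝ) / 2) = σ ^ κ / t ^ ((κ : ℝ) / 2) := by
    rw [Real.div_rpow (by positivity) ht.le, ← Real.rpow_natCast σ 2, ← Real.rpow_mul hσ.le,
      ← Real.rpow_natCast σ κ]
    congr 2; push_cast; ring
  rw [scaleRatio, ← h4]
  rcases le_total (σ ^ 2 / t) 1 with h | h
  · have : 0 ≤ (σ ^ 2 / t) ^ ((κ : ℝ) / 2) := by positivity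
    linarith
  · have hκ' : (1 : ℝ) ≤ (κ : ℝ) / 2 := by
      have : (2 : ℝ) ≤ κ := by exact_mod_cast hκ
      linarith
    have := Real.rpow_le_rpow_of_exponent_le h hκ'
    rw [Real.rpow_one] at this
    linarith

lemma rpow_neg_le_scaleRatio {σ₀ : ℝ} (hσ₀ : 0 < σ₀) (hσ : σ₀ ≤ σ) (ht : 0 < t) {n κ : ℕ}
    (hn : n ≤ κ) : (t ^ ((n : ℝ) / 2))⁻¹ ≤ (1 + (σ₀ ^ κ)⁻¹) * scaleRatio σ t κ := by
  have hσ' : 0 < σ := hσ₀.trans_le hσ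
  have hr := one_le_scaleRatio hσ' ht κ
  have h0 : 0 < (σ₀ ^ κ)⁻¹ := by positivity
  rcases le_total 1 t with h | h
  · have h1 : (t ^ ((n : ℝ) / 2))⁻¹ ≤ 1 := inv_le_one_of_one_le₀ (Real.one_le_rpow h (by positivity))
    nlinarith
  · have h1 : (t ^ ((n : ℝ) / 2))⁻¹ ≤ (t ^ ((κ : ℝ) / 2))⁻¹ := by
      refine inv_anti₀ (by positivity) (Real.rpow_le_rpow_of_exponent_ge ht h ?_)
      have : (n : ℝ) ≤ κ := by exact_mod_cast hn
      linarith
    have h2 : (t ^ ((κ : ℝ) / 2))⁻¹ ≤ (σ₀ ^ κ)⁻¹ * (σ ^ κ / t ^ ((κ : ℝ) / 2)) := by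
      rw [div_eq_mul_inv (σ ^ κ), ← mul_assoc]
      refine le_mul_of_one_le_left (by positivity) ?_
      rw [inv_mul_eq_div, one_le_div (by positivity)]
      gcongr
    have h3 : (σ₀ ^ κ)⁻¹ * (σ ^ κ / t ^ ((κ : ℝ) / 2)) ≤ (σ₀ ^ κ)⁻¹ * scaleRatio σ t κ := by
      refine mul_le_mul_of_nonneg_left ?_ h0.le
      unfold scaleRatio; linarith
    nlinarith

/-- The rate of convergence, up to a constant. -/
noncomputable def rate (d N : ℕ) (σ t : ℝ) (κ : ℕ) : ℝ :=
  d / (N * t) * scaleRatio σ t κ * Real.log N ^ (κ + 2)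

lemma one_le_pow_log (hN : 2 ≤ N) (m : ℕ) : 1 ≤ 2 ^ m * Real.log N ^ m := by
  rw [← mul_pow]
  exact one_le_pow₀ (by linarith [half_le_log hN])

/-- The constant of the truncation bound. -/
noncomputable def truncConst (K κ : ℕ) : ℝ := 5 * (4 * (K + 8)) ^ κ * 2 ^ K

lemma two_rpow_half_le {n K : ℕ} (hn : n ≤ K) : (2 : ℝ) ^ ((n : ℝ) / 2) ≤ 2 ^ K := by
  rw [← Real.rpow_natCast 2 K]
  refine Real.rpow_le_rpow_of_exponent_le (by norm_num) ?_
  have : (n : ℝ) ≤ K := by exact_mod_cast hn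
  have : (0 : ℝ) ≤ n := Nat.cast_nonneg n
  linarith

lemma lintegral_low_le {K κ : ℕ} (hK : ∀ i, k i ≤ K) (hκ : K ≤ κ) (ht : 0 < t) (hN : 2 ≤ N)
    (hd : 1 ≤ d) (hpos : ∀ i, p (V i) ≠ 0) {i : Fin M}
    (hsub : IsSubSubgaussian (coordLaw p V A i) σ) :
    ∫⁻ z, ENNReal.ofReal (smoothedDensity (coordLaw p V A i) t z) *
          ∫⁻ X, ENNReal.ofReal (lowErrBound (coordLaw p V A i) (V i) (tr (A i)) t X z)
            ∂(Measure.pi fun _ : Fin N => p) ≤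
      ENNReal.ofReal (80 * truncConst K κ * rate d N σ t κ) := by
  have hne := coordLaw_neZero (A := A) (hpos i)
  have hℓ := half_le_log hN
  have hlc : 0 ≤ lowErrConst (k i) N t := by unfold lowErrConst; positivity
  unfold coordLaw at hne
  refine (hsub.lintegral_le_rate (hK i) hκ ht hN hlc
    (fun z => mul_lintegral_lowErrBound_le_peak (measurableSet_submodule (V i)) (by fun_prop) ht hN z)
    (fun z => mul_lintegral_lowErrBound_le_density ht hN z)).trans (ENNReal.ofReal_le_ofReal ?_)
  have hσ := hsub.pos
  have hr := one_le_scaleRatio hσ ht κ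
  have hd' : (1 : ℝ) ≤ d := by exact_mod_cast hd
  have h2 := two_rpow_half_le (hK i)
  have hN' : (0 : ℝ) < N := by positivity
  change 5 * (4 * ((K : ℝ) + 8)) ^ κ * (lowErrConst (k i) N t / N) *
    (Real.log N ^ κ * scaleRatio σ t κ) ≤ _
  rw [lowErrConst, truncConst, rate]
  have h3 : 0 ≤ 80 * (5 * (4 * ((K : ℝ) + 8)) ^ κ) * (scaleRatio σ t κ * Real.log N ^ (κ + 2) /
    (N * t)) := by positivity
  calc _ = 80 * (5 * (4 * ((K : ℝ) + 8)) ^ κ) * (scaleRatio σ t κ * Real.log N ^ (κ + 2) /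
        (N * t)) * 2 ^ ((k i : ℝ) / 2) := by rw [pow_add]; field_simp
    _ ≤ 80 * (5 * (4 * ((K : ℝ) + 8)) ^ κ) * (scaleRatio σ t κ * Real.log N ^ (κ + 2) /
        (N * t)) * (2 ^ K * d) := by
        refine mul_le_mul_of_nonneg_left ?_ h3
        exact h2.trans (le_mul_of_one_le_right (by positivity) hd')
    _ = _ := by field_simp

lemma IsExactRecovery.lintegral_weightVar_le (h : IsExactRecovery p V A c) {K κ : ℕ}
    (hK : ∀ i, k i ≤ K) (hκ : K ≤ κ) (ht : 0 < t) (hN : 2 ≤ N) (hpos : ∀ i, p (V i) ≠ 0) {i : Fin M}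
    (hsub : IsSubSubgaussian (coordLaw p V A i) σ) :
    ∫⁻ x, ENNReal.ofReal (weightVar (coordLaw p V A i) t N (tr (A i) x))
        ∂(smoothedLaw (p.restrict (V i)) t) ≤
      ENNReal.ofReal (truncConst K κ / N * (Real.log N ^ κ * scaleRatio σ t κ)) := by
  have hne := coordLaw_neZero (A := A) (hpos i)
  have hℓ := half_le_log hN
  have hm := measurable_weightVar (t := t) (N := N) (coordLaw p V A i)
  rw [h.lintegral_restrict_comp_tr ht i (f := fun z =>
    ENNReal.ofReal (weightVar (coordLaw p V A i) t N z)) (by fun_prop)]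
  have hσ := hsub.pos
  have hr := one_le_scaleRatio hσ ht κ
  have hp := peak_pos (n := k i) ht
  have hP : (1 : ℝ) ≤ 2 ^ ((k i : ℝ) / 2) := Real.one_le_rpow (by norm_num) (by positivity)
  have hN' : (0 : ℝ) < N := by positivity
  refine (hsub.lintegral_le_rate (K := 2 ^ ((k i : ℝ) / 2)) (hK i) hκ ht hN (by positivity)
    (fun z => ?_) (fun z => ?_)).trans (ENNReal.ofReal_le_ofReal ?_)
  · have hG := smoothedDensity_pos (coordLaw p V A i) ht z
    rw [← ENNReal.ofReal_mul hG.le]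
    refine ENNReal.ofReal_le_ofReal ?_
    calc _ ≤ smoothedDensity (coordLaw p V A i) t z *
          (peak (k i) t / (N * smoothedDensity (coordLaw p V A i) t z)) :=
          mul_le_mul_of_nonneg_left (min_le_right _ _) hG.le
      _ = peak (k i) t / N := by field_simp
      _ ≤ _ := le_mul_of_one_le_left (by positivity) hP
  · have hG := smoothedDensity_pos (coordLaw p V A i) ht z
    rw [← ENNReal.ofReal_mul hG.le]
    refine ENNReal.ofReal_le_ofReal ((mul_le_of_le_one_right hG.le (min_le_left _ _)).trans ?_)
    exact smoothedDensity_le_two_mul _ ht z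
  · change 5 * (4 * ((K : ℝ) + 8)) ^ κ * (2 ^ ((k i : ℝ) / 2) / N) *
      (Real.log N ^ κ * scaleRatio σ t κ) ≤ _
    rw [truncConst]
    have h2 := two_rpow_half_le (hK i)
    calc _ = 5 * (4 * ((K : ℝ) + 8)) ^ κ / N * (Real.log N ^ κ * scaleRatio σ t κ) *
          2 ^ ((k i : ℝ) / 2) := by ring
      _ ≤ 5 * (4 * ((K : ℝ) + 8)) ^ κ / N * (Real.log N ^ κ * scaleRatio σ t κ) * 2 ^ K := by
          gcongr
      _ = _ := by ring

lemma IsExactRecovery.proj_eq_self (h : IsExactRecovery p V A c) {i : Fin M} {y : E d}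
    (hy : y ∈ V i) : proj (A i) y = y :=
  proj_of_mem_range (A i) (by rw [← h.coe_eq_range i]; exact hy)

lemma proj_add {n : ℕ} (B : E n →ₗᵢ[ℝ] E d) (x y : E d) : proj B (x + y) = proj B x + proj B y := by
  simp [proj]

/-- The loss through the cut-off is a Gaussian tail probability: the distance to the own subspace is
at most the norm of the noise. With the factor `4` in the radius the tail starts at squared norm
`16 * t * d * log (N * d * t ^ (k / 2))`, so that it is at most of order `d / (N * d * t ^ (k / 2))`. -/
lemma IsExactRecovery.lintegral_cutoffErr_le (h : IsExactRecovery p V A c) {κ : ℕ}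
    (hκ : ∀ i, k i ≤ κ) (ht : 0 < t) (hN : 2 ≤ N) (hd : 1 ≤ d) {σ₀ : ℝ} (hσ₀ : 0 < σ₀)
    (hσ : σ₀ ≤ σ) (i : Fin M) :
    ∫⁻ x, ENNReal.ofReal (cutoffErr (regRadius 4 d N (k i) t) t N (A i) x)
          ∂(smoothedLaw (p.restrict (V i)) t) ≤
      ENNReal.ofReal (150 * 2 ^ (κ + 1) * (1 + (σ₀ ^ κ)⁻¹) * rate d N σ t κ) := by
  have hℓ := half_le_log hN
  have hN' : (0 : ℝ) < N := by positivity
  have hd' : (1 : ℝ) ≤ d := by exact_mod_cast hd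
  have hm := measurable_cutoffErr (t := t) (N := N) (regRadius 4 d N (k i) t) (A i)
  rw [lintegral_smoothedLaw _ (by fun_prop)]
  set L := Real.log (N * d * t ^ ((k i : ℝ) / 2)) with hL
  have hL' : Real.exp (-L) = 1 / (N * d) * (t ^ ((k i : ℝ) / 2))⁻¹ := by
    rw [Real.exp_neg, hL, Real.exp_log (by positivity)]
    field_simp
  have hpt : ∀ y ∈ (V i : Set (E d)), ∫⁻ ξ, ENNReal.ofReal (cutoffErr (regRadius 4 d N (k i) t) t N
      (A i) (y + ξ)) ∂(noise d t) ≤ ENNReal.ofReal (2 * Real.log N / t * (75 * d * Real.exp (-L))) := by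
    intro y hy
    have h1 : ∀ ξ : E d, ENNReal.ofReal (cutoffErr (regRadius 4 d N (k i) t) t N (A i) (y + ξ)) ≤
        ENNReal.ofReal (2 * Real.log N / t) *
        {x : E d | 16 * (t * d * max L 0) < ‖x‖ ^ 2}.indicator
          (fun x => ENNReal.ofReal (1 + ‖x‖ ^ 2 / t)) ξ := by
      intro ξ
      have h2 : y + ξ - proj (A i) (y + ξ) = ξ - proj (A i) ξ := by
        rw [proj_add, h.proj_eq_self hy]; abel
      have h3 := norm_sub_proj_le (A i) ξ
      unfold cutoffErr
      rw [h2]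
      split_ifs with hcut
      · simp
      · push Not at hcut
        have hR0 : 0 ≤ regRadius 4 d N (k i) t := by unfold regRadius; positivity
        have hR2 : regRadius 4 d N (k i) t ^ 2 = 16 * (t * d * max L 0) := by
          rw [regRadius, ← hL, mul_pow]
          rcases le_total 0 L with h0 | h0
          · rw [Real.sq_sqrt (by positivity), max_eq_left h0]; norm_num
          · rw [Real.sqrt_eq_zero_of_nonpos, max_eq_right h0]
            · norm_num
            · exact mul_nonpos_of_nonneg_of_nonpos (by positivity) h0
        have hmem : 16 * (t * d * max L 0) < ‖ξ‖ ^ 2 := by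
          rw [← hR2]
          exact pow_lt_pow_left₀ (hcut.trans_le h3) hR0 (by norm_num)
        rw [Set.indicator_of_mem (by exact hmem), ← ENNReal.ofReal_mul (by positivity)]
        refine ENNReal.ofReal_le_ofReal ?_
        have h4 : ‖ξ - proj (A i) ξ‖ ^ 2 / t ^ 2 ≤ ‖ξ‖ ^ 2 / t / t := by
          rw [div_div, ← sq]
          gcongr
        have h5 : 1 * (‖ξ‖ ^ 2 / t / t) ≤ 2 * Real.log N * (‖ξ‖ ^ 2 / t / t) :=
          mul_le_mul_of_nonneg_right (by linarith) (by positivity)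
        calc _ ≤ 2 * Real.log N * (‖ξ‖ ^ 2 / t / t) + 2 * Real.log N / t := by linarith
          _ = _ := by ring
    refine (lintegral_mono h1).trans ?_
    rw [lintegral_const_mul' _ _ ENNReal.ofReal_ne_top, ENNReal.ofReal_mul (by positivity)]
    exact mul_le_mul_right (lintegral_tail_noise' ht hd L) _
  refine (setLIntegral_mono' (measurableSet_submodule (V i)) hpt).trans ?_
  rw [setLIntegral_const]
  refine (mul_le_of_le_one_right' prob_le_one).trans (ENNReal.ofReal_le_ofReal ?_)
  have hrat := rpow_neg_le_scaleRatio hσ₀ hσ ht (hκ i)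
  have hr := one_le_scaleRatio (hσ₀.trans_le hσ) ht κ
  have hpow := one_le_pow_log hN (κ + 1)
  set B := (1 + (σ₀ ^ κ)⁻¹) * scaleRatio σ t κ with hB
  have hB0 : 0 < B := by positivity
  rw [hL', rate]
  calc 2 * Real.log N / t * (75 * d * (1 / (N * d) * (t ^ ((k i : ℝ) / 2))⁻¹))
      = 150 * Real.log N / (N * t) * (t ^ ((k i : ℝ) / 2))⁻¹ := by field_simp; ring
    _ ≤ 150 * Real.log N / (N * t) * B := by gcongr
    _ ≤ 150 * Real.log N / (N * t) * B * (d * (2 ^ (κ + 1) * Real.log N ^ (κ + 1))) := by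
        refine le_mul_of_one_le_right (by positivity) ?_
        nlinarith
    _ = _ := by rw [hB]; ring

/-- Second moment of a subgaussian law. -/
lemma IsSubSubgaussian.lintegral_sq_le {n K : ℕ} {q : Measure (E n)} (hq : IsSubSubgaussian q σ)
    (hn : n ≤ K) : ∫⁻ y, ENNReal.ofReal (‖y‖ ^ 2) ∂q ≤ ENNReal.ofReal (2 * (K + 1) * σ ^ 2) := by
  have hσ := hq.pos
  have h1 := lintegral_exp_norm_sq_le q hq.mass (b := 1 / ((K + 1) * σ ^ 2)) hn (by positivity)
    (by rw [div_mul_eq_mul_div, div_le_div_iff₀ (by positivity) (by positivity)]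
        nlinarith [sq_nonneg σ]) hq.bound
  have hpt : ∀ y : E n, ENNReal.ofReal (‖y‖ ^ 2) ≤ ENNReal.ofReal ((K + 1) * σ ^ 2) *
      ENNReal.ofReal (Real.exp (1 / ((K + 1) * σ ^ 2) * ‖y‖ ^ 2)) := by
    intro y
    rw [← ENNReal.ofReal_mul (by positivity)]
    refine ENNReal.ofReal_le_ofReal ?_
    have h2 := Real.add_one_le_exp (1 / ((K + 1) * σ ^ 2) * ‖y‖ ^ 2)
    calc ‖y‖ ^ 2 = (K + 1) * σ ^ 2 * (1 / ((K + 1) * σ ^ 2) * ‖y‖ ^ 2) := by field_simp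
      _ ≤ _ := mul_le_mul_of_nonneg_left (by linarith) (by positivity)
  refine (lintegral_mono hpt).trans ?_
  rw [lintegral_const_mul _ (by fun_prop)]
  refine (mul_le_mul_right h1 _).trans (le_of_eq ?_)
  rw [← ENNReal.ofReal_ofNat 2, ← ENNReal.ofReal_mul (by positivity)]
  congr 1; ring

/-- In high dimension (`N ≤ d`) the weight error is multiplied by the crude bound `‖x‖` for the
distances to the subspaces: the noise part of `‖x‖` is of order `√(t d)` and the signal part is
negligible because the target rate is larger than `σ² / t²`. -/
lemma IsExactRecovery.lintegral_weight_le_of_le_dim (h : IsExactRecovery p V A c) {K κ : ℕ}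
    (hK : ∀ i, k i ≤ K) (hκ : K ≤ κ) (hκ2 : 2 ≤ κ) (ht : 0 < t) (hN : 2 ≤ N) (hNd : N ≤ d)
    (hpos : ∀ i, p (V i) ≠ 0) {i : Fin M} (hsub : IsSubSubgaussian (coordLaw p V A i) σ) :
    ∫⁻ x, ENNReal.ofReal ((‖x‖ ^ 2 / t ^ 2 + 2 * Real.log N / t) *
        weightVar (coordLaw p V A i) t N (tr (A i) x)) ∂(smoothedLaw (p.restrict (V i)) t) ≤
      ENNReal.ofReal ((132 * truncConst K κ + (4 * K + 20) * 2 ^ (κ + 2)) * rate d N σ t κ) := by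
  have hℓ := half_le_log hN
  have hN' : (0 : ℝ) < N := by positivity
  have hd : 1 ≤ d := by omega
  have hd' : (1 : ℝ) ≤ d := by exact_mod_cast hd
  have hσ := hsub.pos
  have hne := coordLaw_neZero (A := A) (hpos i)
  have hm0 := measurable_weightVar (t := t) (N := N) (coordLaw p V A i)
  have hm : Measurable fun x => weightVar (coordLaw p V A i) t N (tr (A i) x) :=
    hm0.comp (by fun_prop)
  have hU := h.lintegral_weightVar_le hK hκ ht hN hpos hsub
  rw [lintegral_smoothedLaw _ (by fun_prop)] at hU ⊢
  have hpt : ∀ y : E d, ∫⁻ ξ, ENNReal.ofReal ((‖y + ξ‖ ^ 2 / t ^ 2 + 2 * Real.log N / t) *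
        weightVar (coordLaw p V A i) t N (tr (A i) (y + ξ))) ∂(noise d t) ≤
      ENNReal.ofReal (2 / t ^ 2) * ENNReal.ofReal (‖y‖ ^ 2) +
      ENNReal.ofReal (66 * d * Real.log N / t) * ∫⁻ ξ, ENNReal.ofReal
        (weightVar (coordLaw p V A i) t N (tr (A i) (y + ξ))) ∂(noise d t) +
      ENNReal.ofReal (16 / (N * t)) := by
    intro y
    have hpt' : ∀ ξ : E d, ENNReal.ofReal ((‖y + ξ‖ ^ 2 / t ^ 2 + 2 * Real.log N / t) *
        weightVar (coordLaw p V A i) t N (tr (A i) (y + ξ))) ≤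
      ENNReal.ofReal (2 / t ^ 2) * ENNReal.ofReal (‖y‖ ^ 2) +
      ENNReal.ofReal (66 * d * Real.log N / t) * ENNReal.ofReal
        (weightVar (coordLaw p V A i) t N (tr (A i) (y + ξ))) +
      ENNReal.ofReal (2 / t) * {x : E d | 16 * t * d * (2 * Real.log N) < ‖x‖ ^ 2}.indicator
        (fun x => ENNReal.ofReal (‖x‖ ^ 2 / t)) ξ := by
      intro ξ
      have hw0 := weightVar_nonneg (N := N) (coordLaw p V A i) ht (tr (A i) (y + ξ))
      have hw1 : weightVar (coordLaw p V A i) t N (tr (A i) (y + ξ)) ≤ 1 := min_le_left _ _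
      set w := weightVar (coordLaw p V A i) t N (tr (A i) (y + ξ))
      have h2 : ‖y + ξ‖ ^ 2 ≤ 2 * ‖y‖ ^ 2 + 2 * ‖ξ‖ ^ 2 := by
        have := norm_add_le y ξ
        nlinarith [norm_nonneg (y + ξ), sq_nonneg (‖y‖ - ‖ξ‖), norm_nonneg y, norm_nonneg ξ]
      have h3 : (‖y + ξ‖ ^ 2 / t ^ 2 + 2 * Real.log N / t) * w ≤
          2 / t ^ 2 * ‖y‖ ^ 2 + (2 / t * (‖ξ‖ ^ 2 / t) + 2 * Real.log N / t) * w := by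
        have h4 : ‖y + ξ‖ ^ 2 / t ^ 2 ≤ (2 * ‖y‖ ^ 2 + 2 * ‖ξ‖ ^ 2) / t ^ 2 := by gcongr
        have h5 : 2 / t ^ 2 * ‖y‖ ^ 2 * w ≤ 2 / t ^ 2 * ‖y‖ ^ 2 :=
          mul_le_of_le_one_right (by positivity) hw1
        calc (‖y + ξ‖ ^ 2 / t ^ 2 + 2 * Real.log N / t) * w
            ≤ ((2 * ‖y‖ ^ 2 + 2 * ‖ξ‖ ^ 2) / t ^ 2 + 2 * Real.log N / t) * w := by gcongr
          _ = 2 / t ^ 2 * ‖y‖ ^ 2 * w + (2 / t * (‖ξ‖ ^ 2 / t) + 2 * Real.log N / t) * w := by ring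
          _ ≤ _ := by linarith
      have h6 : 2 * Real.log N / t ≤ 2 * d * Real.log N / t := by
        gcongr
        linarith
      rw [← ENNReal.ofReal_mul (by positivity), ← ENNReal.ofReal_mul (by positivity)]
      by_cases hξ : 16 * t * d * (2 * Real.log N) < ‖ξ‖ ^ 2
      · rw [Set.indicator_of_mem (by exact hξ), ← ENNReal.ofReal_mul (by positivity),
          ← ENNReal.ofReal_add (by positivity) (by positivity),
          ← ENNReal.ofReal_add (by positivity) (by positivity)]
        refine ENNReal.ofReal_le_ofReal (h3.trans ?_)
        have h7 : 2 / t * (‖ξ‖ ^ 2 / t) * w ≤ 2 / t * (‖ξ‖ ^ 2 / t) :=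
          mul_le_of_le_one_right (by positivity) hw1
        have h8 : 2 * Real.log N / t * w ≤ 66 * d * Real.log N / t * w := by
          gcongr
          nlinarith
        linarith
      · rw [Set.indicator_of_notMem (by exact hξ), mul_zero, add_zero,
          ← ENNReal.ofReal_add (by positivity) (by positivity)]
        refine ENNReal.ofReal_le_ofReal (h3.trans ?_)
        push Not at hξ
        have h7 : ‖ξ‖ ^ 2 / t ≤ 32 * d * Real.log N := by
          rw [div_le_iff₀ ht]; linarith
        have h8 : 2 / t * (‖ξ‖ ^ 2 / t) + 2 * Real.log N / t ≤ 66 * d * Real.log N / t := by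
          calc _ ≤ 2 / t * (32 * d * Real.log N) + 2 * d * Real.log N / t := by gcongr
            _ = _ := by ring
        have h9 := mul_le_mul_of_nonneg_right h8 hw0
        linarith
    refine (lintegral_mono hpt').trans ?_
    have hmy : Measurable fun ξ => weightVar (coordLaw p V A i) t N (tr (A i) (y + ξ)) :=
      hm0.comp (by fun_prop)
    rw [lintegral_add_left (by fun_prop), lintegral_add_left (by fun_prop), lintegral_const,
      measure_univ, mul_one, lintegral_const_mul _ (by fun_prop),
      lintegral_const_mul' _ _ ENNReal.ofReal_ne_top]
    refine add_le_add le_rfl ((mul_le_mul_right (lintegral_tail_noise ht hd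
      (L := 2 * Real.log N) (by linarith)) _).trans ?_)
    rw [← ENNReal.ofReal_mul (by positivity)]
    refine ENNReal.ofReal_le_ofReal ?_
    have h10 : Real.exp (-(2 * Real.log N)) ≤ 1 / N := by
      calc Real.exp (-(2 * Real.log N)) ≤ Real.exp (-Real.log N) :=
            Real.exp_le_exp.2 (by linarith)
        _ = 1 / N := by rw [Real.exp_neg, Real.exp_log hN', one_div]
    calc 2 / t * (8 * Real.exp (-(2 * Real.log N))) ≤ 2 / t * (8 * (1 / N)) := by gcongr
      _ = _ := by field_simp; norm_num
  refine (lintegral_mono hpt).trans ?_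
  have hsq : ∫⁻ y, ENNReal.ofReal (‖y‖ ^ 2) ∂(p.restrict (V i)) ≤
      ENNReal.ofReal (2 * (K + 1) * σ ^ 2) := by
    have h1 := hsub.lintegral_sq_le (hK i)
    rw [coordLaw, subLaw, lintegral_map (by fun_prop) (by fun_prop)] at h1
    refine le_trans (setLIntegral_mono' (measurableSet_submodule (V i)) fun y hy => ?_) h1
    refine ENNReal.ofReal_le_ofReal (le_of_eq ?_)
    have h2 := norm_sub_proj_sq_add (A i) y
    rw [h.proj_eq_self hy, sub_self, norm_zero] at h2
    linarith
  have hm3 : Measurable fun y => ∫⁻ ξ, ENNReal.ofReal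
      (weightVar (coordLaw p V A i) t N (tr (A i) (y + ξ))) ∂(noise d t) := by
    have : Measurable fun w : E d × E d => ENNReal.ofReal
        (weightVar (coordLaw p V A i) t N (tr (A i) (w.1 + w.2))) :=
      (hm0.comp (by fun_prop)).ennreal_ofReal
    exact this.lintegral_prod_right'
  rw [lintegral_add_right _ measurable_const, lintegral_add_left (by fun_prop),
    lintegral_const_mul _ (by fun_prop), lintegral_const_mul _ hm3, lintegral_const]
  have hone : p.restrict (V i) Set.univ ≤ 1 := by
    rw [Measure.restrict_apply_univ]; exact prob_le_one
  have hr := one_le_scaleRatio hσ ht κ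
  have hC0 : 0 ≤ truncConst K κ := by unfold truncConst; positivity
  refine (add_le_add (add_le_add (mul_le_mul_right hsq _) (mul_le_mul_right hU _))
    (mul_le_of_le_one_right' hone)).trans ?_
  rw [← ENNReal.ofReal_mul (by positivity), ← ENNReal.ofReal_mul (by positivity),
    ← ENNReal.ofReal_add (by positivity) (by positivity),
    ← ENNReal.ofReal_add (by positivity) (by positivity)]
  refine ENNReal.ofReal_le_ofReal ?_
  have hsr := sq_div_le_scaleRatio hσ ht hκ2
  have hpow := one_le_pow_log hN (κ + 2)
  have hdN : 1 ≤ (d : ℝ) / N := by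
    rw [one_le_div hN']; exact_mod_cast hNd
  set r := scaleRatio σ t κ
  set ℓ := Real.log N with hℓdef
  have e1 : 2 / t ^ 2 * (2 * (K + 1) * σ ^ 2) ≤ (4 * K + 4) * (d / (N * t) * r * (2 ^ (κ + 2) * ℓ ^ (κ + 2))) := by
    calc 2 / t ^ 2 * (2 * (K + 1) * σ ^ 2) = (4 * K + 4) * (1 / t * (σ ^ 2 / t)) := by
          field_simp; ring
      _ ≤ (4 * K + 4) * (1 / t * r) := by gcongr
      _ ≤ (4 * K + 4) * (1 / t * r * (d / N * (2 ^ (κ + 2) * ℓ ^ (κ + 2)))) := by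
          refine mul_le_mul_of_nonneg_left (le_mul_of_one_le_right (by positivity) ?_)
            (by positivity)
          nlinarith
      _ = _ := by field_simp
  have e2 : 66 * d * ℓ / t * (truncConst K κ / N * (ℓ ^ κ * r)) ≤
      132 * truncConst K κ * (d / (N * t) * r * ℓ ^ (κ + 2)) := by
    calc 66 * d * ℓ / t * (truncConst K κ / N * (ℓ ^ κ * r)) =
          66 * truncConst K κ * (d / (N * t) * r * (ℓ ^ κ * ℓ)) * 1 := by field_simp
      _ ≤ 66 * truncConst K κ * (d / (N * t) * r * (ℓ ^ κ * ℓ)) * (2 * ℓ) := by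
          refine mul_le_mul_of_nonneg_left (by linarith) (by positivity)
      _ = _ := by ring
  have e3 : 16 / (N * t) ≤ 16 * (d / (N * t) * r * (2 ^ (κ + 2) * ℓ ^ (κ + 2))) := by
    calc 16 / (N * t) = 16 * (1 / (N * t)) * 1 := by ring
      _ ≤ 16 * (1 / (N * t)) * (d * (r * (2 ^ (κ + 2) * ℓ ^ (κ + 2)))) := by
          refine mul_le_mul_of_nonneg_left ?_ (by positivity)
          exact one_le_mul_of_one_le_of_one_le hd' (one_le_mul_of_one_le_of_one_le hr hpow)
      _ = _ := by ring
  have hgoal : (132 * truncConst K κ + (4 * K + 20) * 2 ^ (κ + 2)) * rate d N σ t κ =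
      (4 * K + 4) * (d / (N * t) * r * (2 ^ (κ + 2) * ℓ ^ (κ + 2))) +
      132 * truncConst K κ * (d / (N * t) * r * ℓ ^ (κ + 2)) +
      16 * (d / (N * t) * r * (2 ^ (κ + 2) * ℓ ^ (κ + 2))) := by
    rw [rate]; ring
  rw [hgoal]
  linarith

/-- With polynomially bounded noise level and `d ≤ N`, the logarithm in the cut-off radius is at most
of order `log N`. -/
lemma log_radius_le {n K : ℕ} (hn : n ≤ K) {a : ℝ} (ht : 0 < t) (hta : t ≤ (N : ℝ) ^ a)
    (hN : 2 ≤ N) (hd : 1 ≤ d) (hdN : d ≤ N) :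
    Real.log (N * d * t ^ ((n : ℝ) / 2)) ≤ (2 + |a| * K) * Real.log N := by
  have hN' : (0 : ℝ) < N := by positivity
  have hN1 : (1 : ℝ) ≤ N := by exact_mod_cast (by omega : 1 ≤ N)
  have hℓ := half_le_log hN
  have hd' : (0 : ℝ) < d := by exact_mod_cast hd
  have h1 : Real.log d ≤ Real.log N := Real.log_le_log hd' (by exact_mod_cast hdN)
  have h2 : Real.log t ≤ |a| * Real.log N := by
    have h3 := Real.log_le_log ht hta
    rw [Real.log_rpow hN'] at h3
    exact h3.trans (mul_le_mul_of_nonneg_right (le_abs_self a) (by linarith))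
  rw [Real.log_mul (by positivity) (by positivity), Real.log_mul (by positivity) (by positivity),
    Real.log_rpow ht]
  have hn0 : (0 : ℝ) ≤ n := Nat.cast_nonneg n
  have hnK : (n : ℝ) ≤ K := by exact_mod_cast hn
  have h0 : 0 ≤ |a| * Real.log N := by positivity
  have h4 : (n : ℝ) / 2 * Real.log t ≤ K * (|a| * Real.log N) := by
    calc (n : ℝ) / 2 * Real.log t ≤ (n : ℝ) / 2 * (|a| * Real.log N) := by gcongr
      _ ≤ K * (|a| * Real.log N) := by
          refine mul_le_mul_of_nonneg_right ?_ h0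
          linarith
  linarith

/-- In moderate dimension (`d ≤ N`) the cut-off bounds the distances to the subspaces. -/
lemma sub_proj_sq_le_of_le_radius {n K : ℕ} (B : E n →ₗᵢ[ℝ] E d) (hn : n ≤ K) {a : ℝ} (ht : 0 < t)
    (hta : t ≤ (N : ℝ) ^ a) (hN : 2 ≤ N) (hd : 1 ≤ d) (hdN : d ≤ N) {x : E d}
    (hx : ‖x - proj B x‖ ≤ regRadius 4 d N n t) :
    ‖x - proj B x‖ ^ 2 / t ^ 2 + 2 * Real.log N / t ≤
      (34 + 16 * (|a| * K)) * (d * Real.log N / t) := by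
  have hℓ := half_le_log hN
  have hd' : (1 : ℝ) ≤ d := by exact_mod_cast hd
  have hlog := log_radius_le hn ht hta hN hd hdN
  have h1 : ‖x - proj B x‖ ^ 2 ≤ 16 * (t * d * ((2 + |a| * K) * Real.log N)) := by
    refine (pow_le_pow_left₀ (norm_nonneg _) hx 2).trans ?_
    rw [regRadius, mul_pow]
    have h2 : Real.sqrt (t * d * Real.log (N * d * t ^ ((n : ℝ) / 2))) ≤
        Real.sqrt (t * d * ((2 + |a| * K) * Real.log N)) :=
      Real.sqrt_le_sqrt (by gcongr)
    have h3 := pow_le_pow_left₀ (Real.sqrt_nonneg _) h2 2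
    rw [Real.sq_sqrt (show 0 ≤ t * d * ((2 + |a| * K) * Real.log N) by positivity)] at h3
    linarith
  calc _ ≤ 16 * (t * d * ((2 + |a| * K) * Real.log N)) / t ^ 2 + 2 * (d * Real.log N / t) := by
        refine add_le_add (by gcongr) ?_
        rw [mul_div_assoc]
        gcongr
        exact le_mul_of_one_le_left (by linarith) hd'
    _ = _ := by field_simp; ring

end Rate

/-! ### Combination of the terms -/

section Combination

variable {d M N : ℕ} {t σ : ℝ} {p : Measure (E d)} [IsProbabilityMeasure p]
  {V : Fin M → Submodule ℝ (E d)} {k : Fin M → ℕ} {A : ∀ i, E (k i) →ₗᵢ[ℝ] E d} {c : E d → Fin M}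

/-- The constant in front of the contribution of the weights. -/
noncomputable def weightConst (K κ : ℕ) (a : ℝ) : ℝ :=
  2 * (34 + 16 * (|a| * K)) * truncConst K κ + 132 * truncConst K κ + (4 * K + 20) * 2 ^ (κ + 2)

/-- The constant in front of the contributions of the cut-off and of the low-dimensional scores. -/
noncomputable def restConst (K κ : ℕ) (σ₀ : ℝ) : ℝ :=
  150 * 2 ^ (κ + 1) * (1 + (σ₀ ^ κ)⁻¹) + 80 * truncConst K κ

lemma truncConst_nonneg (K κ : ℕ) : 0 ≤ truncConst K κ := by unfold truncConst; positivity

lemma rate_nonneg (hN : 2 ≤ N) (hσ : 0 < σ) (ht : 0 < t) (κ : ℕ) : 0 ≤ rate d N σ t κ := by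
  have := half_le_log hN
  have := one_le_scaleRatio hσ ht κ
  unfold rate; positivity

/-- The envelope of the component estimators that enters the weight error: the cut-off radius in
moderate dimension, the norm of the argument in high dimension. -/
noncomputable def envelope (d N K : ℕ) (a t : ℝ) (x : E d) : ℝ :=
  if d ≤ N then (34 + 16 * (|a| * K)) * (d * Real.log N / t)
  else ‖x‖ ^ 2 / t ^ 2 + 2 * Real.log N / t

lemma IsExactRecovery.lintegral_envelope_le (h : IsExactRecovery p V A c) {K κ : ℕ} (a : ℝ)
    (hK : ∀ i, k i ≤ K) (hκ : K ≤ κ) (hκ2 : 2 ≤ κ) (ht : 0 < t) (hN : 2 ≤ N)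
    (hpos : ∀ i, p (V i) ≠ 0) {i : Fin M} (hsub : IsSubSubgaussian (coordLaw p V A i) σ) :
    ∫⁻ x, ENNReal.ofReal (envelope d N K a t x *
        weightVar (coordLaw p V A i) t N (tr (A i) x)) ∂(smoothedLaw (p.restrict (V i)) t) ≤
      ENNReal.ofReal (weightConst K κ a * rate d N σ t κ) := by
  have hℓ := half_le_log hN
  have hσ := hsub.pos
  have hr := one_le_scaleRatio hσ ht κ
  have hC0 := truncConst_nonneg K κ
  have hrate := rate_nonneg (d := d) hN hσ ht κ
  have hN' : (0 : ℝ) < N := by positivity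
  by_cases hdN : d ≤ N
  · simp only [envelope, if_pos hdN]
    have hm : Measurable fun x => weightVar (coordLaw p V A i) t N (tr (A i) x) :=
      (measurable_weightVar (t := t) (N := N) (coordLaw p V A i)).comp (by fun_prop)
    have hH : 0 ≤ (34 + 16 * (|a| * K)) * (d * Real.log N / t) := by positivity
    simp only [ENNReal.ofReal_mul hH]
    rw [lintegral_const_mul _ (by fun_prop)]
    refine (mul_le_mul_right (h.lintegral_weightVar_le hK hκ ht hN hpos hsub) _).trans ?_
    rw [← ENNReal.ofReal_mul hH]
    refine ENNReal.ofReal_le_ofReal ?_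
    have e1 : (34 + 16 * (|a| * K)) * (d * Real.log N / t) *
        (truncConst K κ / N * (Real.log N ^ κ * scaleRatio σ t κ)) ≤
        2 * (34 + 16 * (|a| * K)) * truncConst K κ * rate d N σ t κ := by
      calc _ = (34 + 16 * (|a| * K)) * truncConst K κ *
            (d / (N * t) * scaleRatio σ t κ * (Real.log N ^ κ * Real.log N)) * 1 := by
            field_simp
        _ ≤ (34 + 16 * (|a| * K)) * truncConst K κ *
            (d / (N * t) * scaleRatio σ t κ * (Real.log N ^ κ * Real.log N)) *
              (2 * Real.log N) :=
            mul_le_mul_of_nonneg_left (by linarith) (by positivity)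
        _ = _ := by rw [rate]; ring
    refine e1.trans (mul_le_mul_of_nonneg_right ?_ hrate)
    have : 0 ≤ 132 * truncConst K κ + (4 * (K : ℝ) + 20) * 2 ^ (κ + 2) := by positivity
    rw [weightConst]; linarith
  · simp only [envelope, if_neg hdN]
    refine (h.lintegral_weight_le_of_le_dim hK hκ hκ2 ht hN (by omega) hpos hsub).trans
      (ENNReal.ofReal_le_ofReal (mul_le_mul_of_nonneg_right ?_ hrate))
    have : 0 ≤ 2 * (34 + 16 * (|a| * K)) * truncConst K κ := by positivity
    rw [weightConst]; linarith

/-- The risk bound with explicit constants. Dimension zero is excluded because the logarithm in the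
cut-off radius degenerates there. -/
lemma IsExactRecovery.risk_le (h : IsExactRecovery p V A c) {K κ : ℕ} {a σ₀ : ℝ}
    (hK : ∀ i, k i ≤ K) (hκ : K ≤ κ) (hκ2 : 2 ≤ κ) (ht : 0 < t) (hta : t ≤ (N : ℝ) ^ a)
    (hN : 2 ≤ N) (hd : 1 ≤ d) (hpos : ∀ i, p (V i) ≠ 0) (hσ₀ : 0 < σ₀) (hσ : σ₀ ≤ σ)
    (hsub : ∀ i, IsSubSubgaussian (coordLaw p V A i) σ) :
    ∫⁻ X, ∫⁻ x, ‖scoreEst 4 V A c t X x - score p t x‖ₑ ^ 2 ∂(smoothedLaw p t)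
        ∂(Measure.pi fun _ : Fin N => p) ≤
      ENNReal.ofReal ((24 * weightConst K κ a + 3 * restConst K κ σ₀) *
        ((M : ℝ) ^ 3 * rate d N σ t κ)) := by
  have hℓ := half_le_log hN
  have hσ' : 0 < σ := hσ₀.trans_le hσ
  have hrate := rate_nonneg (d := d) hN hσ' ht κ
  have hT0 := truncConst_nonneg K κ
  have hW0 : 0 ≤ weightConst K κ a := by unfold weightConst; positivity
  have hR0 : 0 ≤ restConst K κ σ₀ := by unfold restConst; positivity
  refine (h.risk_le_sum hpos ht hN 4 (H := envelope d N K a t) ?_ ?_ ?_).trans ?_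
  · unfold envelope; split_ifs <;> fun_prop
  · intro x; unfold envelope; split_ifs <;> positivity
  · intro x i hx
    unfold envelope
    split_ifs with hdN
    · exact sub_proj_sq_le_of_le_radius (A i) (hK i) ht hta hN hd hdN hx
    · have := norm_sub_proj_le (A i) x
      gcongr
  have hterm : ∀ i ∈ Finset.univ, (ENNReal.ofReal (24 * M) * ∫⁻ x, ENNReal.ofReal
            (envelope d N K a t x * weightVar (coordLaw p V A i) t N (tr (A i) x))
          ∂(smoothedLaw (p.restrict (V i)) t) +
        3 * ∫⁻ x, ENNReal.ofReal (cutoffErr (regRadius 4 d N (k i) t) t N (A i) x)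
          ∂(smoothedLaw (p.restrict (V i)) t) +
        3 * ∫⁻ z, ENNReal.ofReal (smoothedDensity (coordLaw p V A i) t z) *
          ∫⁻ X, ENNReal.ofReal (lowErrBound (coordLaw p V A i) (V i) (tr (A i)) t X z)
            ∂(Measure.pi fun _ : Fin N => p)) ≤
      ENNReal.ofReal ((24 * M * weightConst K κ a + 3 * restConst K κ σ₀) *
        rate d N σ t κ) := by
    intro i _
    have h1 := h.lintegral_envelope_le a hK hκ hκ2 ht hN hpos (hsub i)
    have h2 := h.lintegral_cutoffErr_le (fun i => (hK i).trans hκ) ht hN hd hσ₀ hσ i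
    have h3 := lintegral_low_le hK hκ ht hN hd hpos (hsub i)
    refine (add_le_add (add_le_add (mul_le_mul_right h1 _) (mul_le_mul_right h2 _))
      (mul_le_mul_right h3 _)).trans (le_of_eq ?_)
    rw [← ENNReal.ofReal_ofNat 3, ← ENNReal.ofReal_mul (by positivity),
      ← ENNReal.ofReal_mul (by positivity), ← ENNReal.ofReal_mul (by positivity),
      ← ENNReal.ofReal_add (by positivity) (by positivity),
      ← ENNReal.ofReal_add (by positivity) (by positivity)]
    congr 1
    rw [restConst]; ring
  refine (Finset.sum_le_sum hterm).trans ?_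
  rw [Finset.sum_const, Finset.card_univ, Fintype.card_fin, nsmul_eq_mul,
    ← ENNReal.ofReal_natCast, ← ENNReal.ofReal_mul (by positivity)]
  refine ENNReal.ofReal_le_ofReal ?_
  -- the weights contribute `M ^ 2` and the other terms `M`, both below `M ^ 3`
  rcases Nat.eq_zero_or_pos M with hM | hM
  · simp [hM]
  have hM1 : (1 : ℝ) ≤ M := by exact_mod_cast hM
  have hM3 : (M : ℝ) * M ≤ (M : ℝ) ^ 3 := by nlinarith [mul_nonneg (sub_nonneg.2 hM1) (sq_nonneg (M : ℝ))]
  have hM4 : (M : ℝ) ≤ (M : ℝ) ^ 3 := by nlinarith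
  have e1 : (M : ℝ) * M * (24 * weightConst K κ a * rate d N σ t κ) ≤
      (M : ℝ) ^ 3 * (24 * weightConst K κ a * rate d N σ t κ) :=
    mul_le_mul_of_nonneg_right hM3 (by positivity)
  have e2 : (M : ℝ) * (3 * restConst K κ σ₀ * rate d N σ t κ) ≤
      (M : ℝ) ^ 3 * (3 * restConst K κ σ₀ * rate d N σ t κ) :=
    mul_le_mul_of_nonneg_right hM4 (by positivity)
  linarith

end Combination

end UnionScore

theorem theorem1 :
    ∃ CR : ℝ, 0 < CR ∧
    ∀ k : ℕ, ∃ m : ℕ, ∀ cp σ₀ a : ℝ, 0 < cp → 0 < σ₀ → ∃ C : ℝ, 0 < C ∧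
    ∀ (d M N : ℕ) (p : Measure (UnionScore.E d)) (_ : IsProbabilityMeasure p)
      (V : Fin M → Submodule ℝ (UnionScore.E d)) (ks : Fin M → ℕ)
      (A : ∀ i, UnionScore.E (ks i) →ₗᵢ[ℝ] UnionScore.E d)
      (c : UnionScore.E d → Fin M) (σs : Fin M → ℝ) (σ t : ℝ),
      UnionScore.IsUnionOfSubspaces p V ks cp →
      (∀ i, ks i ≤ k) →
      UnionScore.IsExactRecovery p V A c →
      (∀ i, UnionScore.IsSubgaussian (UnionScore.lowLaw p (A i)) (σs i)) →
      IsGreatest (Set.range σs) σ →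
      σ₀ ≤ σ →
      2 ≤ N →
      0 < t →
      t ≤ (N : ℝ) ^ a →
      ∫⁻ X, ∫⁻ x, ‖UnionScore.scoreEst CR V A c t X x - UnionScore.score p t x‖ₑ ^ 2
          ∂(UnionScore.smoothedLaw p t) ∂(Measure.pi fun _ : Fin N => p) ≤
        ENNReal.ofReal (C * ((d : ℝ) * (M : ℝ) ^ 3 / N) *
          (1 / t + σ ^ (max k 2) / t ^ (((max k 2 : ℕ) : ℝ) / 2 + 1)) * Real.log N ^ m) := by
  refine ⟨4, by norm_num, fun k => ⟨max k 2 + 2, fun cp σ₀ a hcp hσ₀ => ?_⟩⟩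
  have hT0 := UnionScore.truncConst_nonneg k (max k 2)
  refine ⟨24 * UnionScore.weightConst k (max k 2) a + 3 * UnionScore.restConst k (max k 2) σ₀,
    by unfold UnionScore.weightConst UnionScore.restConst; positivity, ?_⟩
  intro d M N p _ V ks A c σs σ t hU hk hR hsub hσmax hσ hN ht hta
  rcases Nat.eq_zero_or_pos d with hd | hd
  · -- in dimension zero both scores vanish
    subst hd
    have h0 : ∀ v : UnionScore.E 0, ‖v‖ₑ ^ 2 = 0 := fun v => by
      rw [Subsingleton.elim v 0]; simp
    simp only [h0, lintegral_zero]
    exact zero_le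
  have hM : 0 < M := Fin.pos (c 0)
  have hpos : ∀ i, p (V i : Set (UnionScore.E d)) ≠ 0 := by
    intro i h0
    have h1 := hU.mass_ge i
    rw [h0, nonpos_iff_eq_zero, ENNReal.ofReal_eq_zero] at h1
    have : 0 < 1 / (cp * M) := by positivity
    linarith
  have hsub' : ∀ i, UnionScore.IsSubSubgaussian (UnionScore.coordLaw p V A i) σ := fun i =>
    hR.isSubSubgaussian (hsub i) (hσmax.2 ⟨i, rfl⟩) (hpos i)
  refine (hR.risk_le hk (le_max_left k 2) (le_max_right k 2) ht hta hN hd hpos hσ₀ hσ hsub').trans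
    (ENNReal.ofReal_le_ofReal (le_of_eq ?_))
  have hN' : (N : ℝ) ≠ 0 := by positivity
  rw [UnionScore.rate, UnionScore.scaleRatio, Real.rpow_add ht, Real.rpow_one]
  have ht' : t ^ (((max k 2 : ℕ) : ℝ) / 2) ≠ 0 := (Real.rpow_pos_of_pos ht _).ne'
  field_simp
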